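/- Let $K$ be a field complete with respect to a nontrivial nonarchimedean absolute value $|\cdot|$, let $n \ge 0$, and let $\rho = (\rho_1, \dots, \rho_n)$ be a tuple of positive real numbers such that for each $i$ there are an integer $m_i \ge 1$ and an element $a_i \in K$ with $\rho_i^{m_i} = |a_i|$. Let $$K\langle t_1, \dots, t_n \rangle_\rho = \Big\{ \sum_I c_I t^I \in K[[t_1, \dots, t_n]] : |c_I|\, \rho_1^{i_1} \cdots \rho_n^{i_n} \to 0 \text{ as } i_1 + \cdots + i_n \to \infty \Big\},$$ where $I = (i_1, \dots, i_n)$ runs over $n$-tuples of nonnegative integers and $t^I = t_1^{i_1} \cdots t_n^{i_n}$. Then every finite (i.e. finitely generated) projective module over $K\langle t_1, \dots, t_n \rangle_\rho$ is free. -/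

import Mathlib

/-! All finite projective modules are free exactly when every idempotent matrix p splits as p = X Y
with Y X = 1 (`SplitsIdempotents`). The restricted power series ring is one of a family: for a
submonoid S of ℤⁿ, the series with exponents in S inside the completion of the Laurent polynomials
for the Gauss norm. An additive function l and some v in S with l v > 0 give a relative situation: T
is the ring of series on S, A the subring of series on S ∩ ker l, and t in T the monomial of
exponent v.

The algebraic core is `free_of_matrix_factorization_aux`. Let w be monic over A, with unique
division by w(t) in T, and let a finite projective T-module P contain a free module F with w(t) P ⊆
F. Then P / F is finite projective over A, hence free by induction. If τ is the matrix of t on P /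
F, then P is the cokernel of the matrix with blocks t - τ and -B, with B over A: the value at t of a
linear pencil X E + F₀ over A[X]. Projectivity of P makes this matrix left invertible over T, and
division by w(t) makes the pencil left invertible over A[X]. Such a pencil, with E left invertible,
extends to an invertible matrix: over local rings by a Horrocks-type induction, in general by
Quillen patching (`completable_pencil`). Hence P is free.

The analytic task is to find w: an idempotent splits after inverting some f, and f should divide a
Weierstrass polynomial in t. For Laurent series, l is chosen injective on the finitely many
exponents where f attains its norm; up to an invertible monomial, f is then close to a monic
polynomial in t with unit constant coefficient, and the rank of the exponent group drops. For
nonnegative exponents, one variable is inverted. A splitting over the larger ring is approximated by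
matrices whose denominators are powers of that variable, and a determinant produces an f close to a
power of the variable. Weierstrass preparation then applies without a change of variables. -/

open Polynomial

/-! ### Completable matrices and Horrocks' theorem for linear pencils -/

namespace Matrix

variable {R : Type*} [CommRing R] {m n : Type*} [Fintype m] [Fintype n] [DecidableEq m]
  [DecidableEq n]

/-- A matrix `V` is completable if it is the first block of columns of an invertible matrix
`[V N]`, whose inverse has the blocks of rows `L` and `L'`. -/
def Completable (V : Matrix m n R) : Prop :=
  ∃ (k : ℕ) (N : Matrix m (Fin k) R) (L : Matrix n m R) (L' : Matrix (Fin k) m R),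
    V * L + N * L' = 1 ∧ L * V = 1 ∧ L * N = 0 ∧ L' * V = 0 ∧ L' * N = 1

theorem Completable.map {S : Type*} [CommRing S] {V : Matrix m n R} (h : Completable V)
    (f : R →+* S) : Completable (V.map f) := by
  obtain ⟨k, N, L, L', h1, h2, h3, h4, h5⟩ := h
  refine ⟨k, N.map f, L.map f, L'.map f, ?_, ?_, ?_, ?_, ?_⟩
  · rw [← Matrix.map_mul, ← Matrix.map_mul, ← Matrix.map_add _ (map_add f), h1]; simp
  · rw [← Matrix.map_mul, h2]; simp
  · rw [← Matrix.map_mul, h3]; simp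
  · rw [← Matrix.map_mul, h4]; simp
  · rw [← Matrix.map_mul, h5]; simp

theorem Completable.of_mul_left {V : Matrix m n R} {G G' : Matrix m m R} (hG : G' * G = 1)
    (h : Completable (G * V)) : Completable V := by
  obtain ⟨k, N, L, L', h1, h2, h3, h4, h5⟩ := h
  have hG' : G * G' = 1 := mul_eq_one_comm.mp hG
  refine ⟨k, G' * N, L * G, L' * G, ?_, ?_, ?_, ?_, ?_⟩
  · have : G' * (G * V * L + N * L') * G = 1 := by rw [h1, mul_one, hG]
    rw [← this]
    simp only [Matrix.mul_add, Matrix.add_mul, ← Matrix.mul_assoc, hG, Matrix.one_mul]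
  · rw [Matrix.mul_assoc, h2]
  · rw [Matrix.mul_assoc, ← Matrix.mul_assoc G, hG', Matrix.one_mul, h3]
  · rw [Matrix.mul_assoc, h4]
  · rw [Matrix.mul_assoc, ← Matrix.mul_assoc G, hG', Matrix.one_mul, h5]

theorem Completable.of_mul_right {V : Matrix m n R} {H H' : Matrix n n R} (hH : H * H' = 1)
    (h : Completable (V * H)) : Completable V := by
  obtain ⟨k, N, L, L', h1, h2, h3, h4, h5⟩ := h
  have hV : V = V * H * H' := by rw [Matrix.mul_assoc, hH, Matrix.mul_one]
  refine ⟨k, N, H * L, L', ?_, ?_, ?_, ?_, h5⟩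
  · rw [← Matrix.mul_assoc, h1]
  · rw [hV, ← Matrix.mul_assoc, Matrix.mul_assoc H, h2, Matrix.mul_one, hH]
  · rw [Matrix.mul_assoc, h3, Matrix.mul_zero]
  · rw [hV, ← Matrix.mul_assoc, h4, Matrix.zero_mul]

theorem Completable.of_submatrix {m' n' : Type*} [Fintype m'] [Fintype n'] [DecidableEq m']
    [DecidableEq n'] {V : Matrix m n R} (e : m' ≃ m) (f : n' ≃ n)
    (h : Completable (V.submatrix e f)) : Completable V := by
  obtain ⟨k, N, L, L', h1, h2, h3, h4, h5⟩ := h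
  have hV : V = (V.submatrix e f).submatrix e.symm f.symm := by simp
  refine ⟨k, N.submatrix e.symm id, L.submatrix f.symm e.symm, L'.submatrix id e.symm,
    ?_, ?_, ?_, ?_, ?_⟩
  · rw [hV, submatrix_mul_equiv, submatrix_mul _ _ _ id _ Function.bijective_id |>.symm]
    exact (congrArg (fun A ↦ A.submatrix e.symm e.symm) h1).trans (submatrix_one_equiv _)
  · rw [hV, submatrix_mul_equiv, h2, submatrix_one_equiv]
  · rw [submatrix_mul_equiv, h3]; simp
  · rw [hV, submatrix_mul_equiv, h4]; simp
  · rw [submatrix_mul_equiv, h5]; simp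

/-- Row operations clear c against the identity block; they enter the inverse as -L c and -L' c.
This splits off a constant row in the induction on pencils. -/
theorem Completable.fromBlocks_one_zero {u : Type*} [Fintype u] [DecidableEq u]
    {V : Matrix m n R} (h : Completable V) (c : Matrix m u R) :
    Completable (fromBlocks (1 : Matrix u u R) 0 c V) := by
  obtain ⟨k, N, L, L', h1, h2, h3, h4, h5⟩ := h
  refine ⟨k, fromRows 0 N, fromBlocks 1 0 (-(L * c)) L, fromCols (-(L' * c)) L', ?_, ?_, ?_, ?_, ?_⟩
  · rw [fromBlocks_multiply, fromRows_mul_fromCols, fromBlocks_add, ← fromBlocks_one]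
    congr 1
    · simp
    · simp
    · have : c - (V * L + N * L') * c = 0 := by rw [h1]; simp
      rw [← this, Matrix.add_mul]
      simp only [Matrix.mul_one, Matrix.mul_neg, Matrix.mul_assoc]
      abel
    · simpa using h1
  · rw [fromBlocks_multiply, ← fromBlocks_one]
    congr 1 <;> simp [h2]
  · rw [fromBlocks_mul_fromRows]; simp [h3]
  · rw [fromCols_mul_fromBlocks]; simp [h4]
  · rw [fromCols_mul_fromRows]; simp [h5]

-- Because of the zero block, the lower right corner of L is itself a left inverse of V. The smaller
-- pencil in the induction inherits its hypotheses this way.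
omit [Fintype n] [DecidableEq m] in
theorem fromBlocks_leftInverse {u : Type*} [Fintype u] [DecidableEq u]
    {a : Matrix u u R} {c : Matrix m u R} {V : Matrix m n R}
    (h : ∃ L : Matrix (u ⊕ n) (u ⊕ m) R, L * fromBlocks a 0 c V = 1) : ∃ L : Matrix n m R, L * V = 1 := by
  obtain ⟨L, hL⟩ := h
  rw [← fromBlocks_toBlocks L, fromBlocks_multiply, ← fromBlocks_one, fromBlocks_inj] at hL
  exact ⟨_, by simpa using hL.2.2.2⟩

theorem isUnit_updateRow_one {i : m} {l : m → R} (h : IsUnit (l i)) :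
    ∃ G : Matrix m m R, G * (1 : Matrix m m R).updateRow i l = 1 := by
  have : IsUnit ((1 : Matrix m m R).updateRow i l).det := by
    have h2 : ((1 : Matrix m m R).updateRow i l).det = l i := by
      have := cramer_transpose_apply (1 : Matrix m m R) l i
      rw [← this, transpose_one, cramer_one]; rfl
    rwa [h2]
  exact ⟨_, nonsing_inv_mul _ this⟩

/-- The linear matrix pencil `X E + C`. -/
noncomputable def pencil (E F : Matrix m n R) : Matrix m n R[X] :=
  (X : R[X]) • E.map C + F.map C

omit [Fintype m] [Fintype n] [DecidableEq m] [DecidableEq n] in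
theorem pencil_map {S : Type*} [CommRing S] (f : R →+* S) (E F : Matrix m n R) :
    (pencil E F).map (mapRingHom f) = pencil (E.map f) (F.map f) := by
  ext1 i j
  simp [pencil]

omit [Fintype n] [DecidableEq m] [DecidableEq n] in
theorem map_C_mul_pencil {l : Type*} (G : Matrix l m R) (E F : Matrix m n R) :
    G.map C * pencil E F = pencil (G * E) (G * F) := by
  simp [pencil, Matrix.mul_add, Matrix.map_mul]

omit [Fintype m] [DecidableEq m] [DecidableEq n] in
theorem pencil_mul_map_C {l : Type*} (E F : Matrix m n R) (G : Matrix n l R) :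
    pencil E F * G.map C = pencil (E * G) (F * G) := by
  simp [pencil, Matrix.add_mul, Matrix.map_mul]

/-- Over a local ring, if `X E + F` is left invertible, then `(1 - E K) F` has a unit entry. -/
theorem exists_isUnit_of_pencil [IsLocalRing R] [Nonempty n] {E F : Matrix m n R}
    (K : Matrix n m R) (hL : ∃ L : Matrix n m R[X], L * pencil E F = 1) :
    ∃ i j, IsUnit ((((1 : Matrix m m R) - E * K) * F) i j) := by
  classical
  by_contra! hcon
  obtain ⟨L, hL⟩ := hL
  let f := IsLocalRing.residue R
  have h0 : (((1 : Matrix m m R) - E * K) * F).map f = 0 := by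
    ext i j
    simpa [f, IsLocalRing.residue_eq_zero_iff] using hcon i j
  -- Over the residue field the pencil thus factors as E (X + K F), so the characteristic polynomial
  -- of -K F is a unit although its degree is the positive size of n.
  have h1 : F.map f = (E.map f) * ((K.map f) * (F.map f)) := by
    have : F = ((1 : Matrix m m R) - E * K) * F + E * (K * F) := by
      rw [Matrix.sub_mul, Matrix.one_mul, Matrix.mul_assoc]; abel
    conv_lhs => rw [this]
    rw [Matrix.map_add _ (map_add f), h0, zero_add, Matrix.map_mul, Matrix.map_mul]
  have h2 : pencil (E.map f) (F.map f) =
      (E.map f).map C * charmatrix (-((K.map f) * (F.map f))) := by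
    have : charmatrix (-((K.map f) * (F.map f))) = pencil 1 ((K.map f) * (F.map f)) := by
      ext1 i j
      by_cases h : i = j <;> simp [pencil, h, -Matrix.map_map, ← Matrix.map_mul]
    rw [this, map_C_mul_pencil, ← h1, Matrix.mul_one]
  have h3 : (L.map (mapRingHom f) * (E.map f).map C) *
      charmatrix (-((K.map f) * (F.map f))) = 1 := by
    rw [Matrix.mul_assoc, ← h2, ← pencil_map, ← Matrix.map_mul, hL]
    simp
  have h4 : IsUnit (charpoly (-((K.map f) * (F.map f)))) := by
    have := congrArg det h3
    rw [det_mul, det_one] at this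
    exact IsUnit.of_mul_eq_one_right _ this
  have h5 := natDegree_eq_zero_of_isUnit h4
  rw [charpoly_natDegree_eq_dim] at h5
  exact Fintype.card_ne_zero h5

/-- A form of Horrocks' theorem: over a local ring, a left invertible pencil with left invertible
leading part is completable. -/
theorem completable_pencil_of_isLocalRing [IsLocalRing R] (k : ℕ) :
    ∀ (m n : Type) [Fintype m] [Fintype n] [DecidableEq m] [DecidableEq n],
      Fintype.card n = k → ∀ (E F : Matrix m n R), (∃ K : Matrix n m R, K * E = 1) →
      (∃ L : Matrix n m R[X], L * pencil E F = 1) → Completable (pencil E F) := by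
  induction k with
  | zero =>
    intro m n _ _ _ _ hn E F _ _
    have : IsEmpty n := Fintype.card_eq_zero_iff.mp hn
    let e := Fintype.equivFin m
    refine ⟨Fintype.card m, (1 : Matrix m m R[X]).submatrix id e.symm, 0,
      (1 : Matrix m m R[X]).submatrix e.symm id, ?_, ?_, ?_, ?_, ?_⟩
    · rw [submatrix_mul_equiv]; simp
    · ext i; exact isEmptyElim i
    · ext i; exact isEmptyElim i
    · ext _ i; exact isEmptyElim i
    · rw [← submatrix_mul _ _ _ id _ Function.bijective_id]; simp
  | succ k ih =>
    intro m n _ _ _ _ hn E F ⟨K, hK⟩ hL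
    have : Nonempty n := Fintype.card_pos_iff.mp (by omega)
    obtain ⟨i₀, j, hij⟩ := exists_isUnit_of_pencil K hL
    -- Since K E = 1, every row of 1 - E K annihilates E. Combining the rows of the pencil with
    -- coefficients l therefore leaves a row b = l F free of X, with a unit entry.
    set l := ((1 : Matrix m m R) - E * K) i₀ with hl
    have hlE : l ᵥ* E = 0 := by
      have : ((1 : Matrix m m R) - E * K) * E = 0 := by
        rw [Matrix.sub_mul, Matrix.mul_assoc, hK]; simp
      exact congrFun this i₀
    set b := l ᵥ* F with hb
    have hbj : IsUnit (b j) := hij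
    obtain ⟨i, hi⟩ : ∃ i, IsUnit (l i) := by
      by_contra! h
      have : b j ∈ IsLocalRing.maximalIdeal R := by
        refine Ideal.sum_mem _ fun i _ ↦ Ideal.mul_mem_right _ _ (h i)
      exact this hbj
    -- G puts the constant row b in place of row i; the inverse of H on the right turns it into the
    -- unit vector at j, which can be split off.
    obtain ⟨G', hG'⟩ := isUnit_updateRow_one hi
    obtain ⟨H', hH'⟩ := isUnit_updateRow_one hbj
    set G := (1 : Matrix m m R).updateRow i l with hG
    set H := (1 : Matrix n n R).updateRow j b with hH
    have hGC : G'.map C * G.map C = (1 : Matrix m m R[X]) := by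
      rw [← Matrix.map_mul, hG']; simp
    have hHC : H'.map C * H.map C = (1 : Matrix n n R[X]) := by
      rw [← Matrix.map_mul, hH']; simp
    have hH'H : H * H' = 1 := mul_eq_one_comm.mp hH'
    refine Completable.of_mul_left hGC (Completable.of_mul_right hHC ?_)
    rw [map_C_mul_pencil, pencil_mul_map_C]
    set E₁ := G * E * H' with hE₁
    set F₁ := G * F * H' with hF₁
    have hEi : ∀ j', E₁ i j' = 0 := by
      intro j'
      have : (G * E) i = 0 := by
        rw [← hlE]; ext a; simp [hG, Matrix.mul_apply, vecMul, dotProduct]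
      rw [hE₁, Matrix.mul_apply]
      simp [this]
    have hFi : ∀ j', F₁ i j' = (1 : Matrix n n R) j j' := by
      intro j'
      have : (G * F) i = H j := by
        simp only [hH, updateRow_self, hb]
        ext a; simp [hG, Matrix.mul_apply, vecMul, dotProduct]
      rw [← hH'H, hF₁, Matrix.mul_apply, Matrix.mul_apply]
      simp [this]
    let em := Equiv.sumCompl (fun a : m ↦ a = i)
    let en := Equiv.sumCompl (fun a : n ↦ a = j)
    let es : {a : m // a = i} ≃ {a : n // a = j} := Equiv.ofUnique _ _
    let en' : {a : m // a = i} ⊕ {a : n // ¬ a = j} ≃ n := (es.sumCongr (Equiv.refl _)).trans en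
    let val : {a : m // ¬ a = i} → m := Subtype.val
    let val' : {a : n // ¬ a = j} → n := Subtype.val
    have hP : (pencil E₁ F₁).submatrix em en' = fromBlocks 1 0
        ((pencil E₁ F₁).submatrix val (fun a ↦ (es a).1))
        (pencil (E₁.submatrix val val') (F₁.submatrix val val')) := by
      ext1 a c
      rcases a with ⟨a, rfl⟩ | a <;> rcases c with ⟨c, rfl⟩ | c
      · simpa [em, en', en, pencil, hEi, hFi, one_apply] using (es _).2.symm
      · simp [em, en', en, pencil, hEi, hFi, Ne.symm c.2]
      · rfl
      · rfl
    have hQ : E₁.submatrix em en' = fromBlocks 0 0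
        (E₁.submatrix val (fun a ↦ (es a).1)) (E₁.submatrix val val') := by
      ext1 a c
      rcases a with ⟨a, rfl⟩ | a <;> rcases c with ⟨c, rfl⟩ | c
      · simp [em, en', en, hEi]
      · simp [em, en', en, hEi]
      · rfl
      · rfl
    refine Completable.of_submatrix em en' ?_
    rw [hP]
    refine Completable.fromBlocks_one_zero (ih _ _ ?_ _ _ ?_ ?_) _
    · rw [Fintype.card_subtype_compl, hn, Fintype.card_subtype_eq]; simp
    · refine fromBlocks_leftInverse (a := (0 : Matrix {a : m // a = i} {a : m // a = i} R))
        (c := E₁.submatrix val (fun a ↦ (es a).1)) ⟨(H * K * G').submatrix en' em, ?_⟩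
      rw [← hQ, submatrix_mul_equiv]
      have : H * K * G' * E₁ = 1 := by
        rw [hE₁, ← hH'H]
        calc H * K * G' * (G * E * H') = H * (K * ((G' * G) * E)) * H' := by
              simp only [Matrix.mul_assoc]
          _ = _ := by rw [hG', Matrix.one_mul, hK, Matrix.mul_one]
      rw [this, submatrix_one_equiv]
    · obtain ⟨L, hL⟩ := hL
      refine fromBlocks_leftInverse
        (a := (1 : Matrix {a : m // a = i} {a : m // a = i} R[X]))
        (c := (pencil E₁ F₁).submatrix val (fun a ↦ (es a).1))
        ⟨(H.map C * L * G'.map C).submatrix en' em, ?_⟩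
      rw [← hP, submatrix_mul_equiv]
      have : H.map C * L * G'.map C * pencil E₁ F₁ = 1 := by
        rw [hE₁, hF₁, ← pencil_mul_map_C, ← map_C_mul_pencil]
        calc H.map C * L * G'.map C * (G.map C * pencil E F * H'.map C)
            = H.map C * (L * ((G'.map C * G.map C) * pencil E F)) * H'.map C := by
              simp only [Matrix.mul_assoc]
          _ = _ := by rw [hGC, Matrix.one_mul, hL, Matrix.mul_one, mul_eq_one_comm.mp hHC]
      rw [this, submatrix_one_equiv]

/-- For the invertible matrix W = [V N] one takes M = W W(0)⁻¹, which carries the first block V(0)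
of W(0) to V. -/
theorem Completable.exists_eq_mul_eval_zero {V : Matrix m n R[X]} (h : Completable V) :
    ∃ M M' : Matrix m m R[X], M * M' = 1 ∧ V = M * (V.map (evalRingHom 0)).map C := by
  obtain ⟨k, N, L, L', h1, h2, h3, h4, h5⟩ := h
  let φ : R[X] →+* R[X] := C.comp (evalRingHom 0)
  have hV : (V.map (evalRingHom 0)).map C = V.map φ := by simp [φ, Matrix.map_map]
  have e2 : L.map φ * V.map φ = 1 := by rw [← Matrix.map_mul, h2]; simp
  have e3 : L.map φ * N.map φ = 0 := by rw [← Matrix.map_mul, h3]; simp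
  have e4 : L'.map φ * V.map φ = 0 := by rw [← Matrix.map_mul, h4]; simp
  have e5 : L'.map φ * N.map φ = 1 := by rw [← Matrix.map_mul, h5]; simp
  refine ⟨V * L.map φ + N * L'.map φ, V.map φ * L + N.map φ * L', ?_, ?_⟩
  · calc (V * L.map φ + N * L'.map φ) * (V.map φ * L + N.map φ * L')
        = V * (L.map φ * V.map φ) * L + V * (L.map φ * N.map φ) * L'
          + (N * (L'.map φ * V.map φ) * L + N * (L'.map φ * N.map φ) * L') := by
          simp only [Matrix.add_mul, Matrix.mul_add, Matrix.mul_assoc]; abel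
      _ = V * L + N * L' := by rw [e2, e3, e4, e5]; simp
      _ = 1 := h1
  · rw [hV, Matrix.add_mul, Matrix.mul_assoc, Matrix.mul_assoc, e2, e4]; simp

end Matrix

/-! ### Quillen patching -/

/-- A commutative ring over which all idempotent matrices split; equivalently, all finite
projective modules are free. -/
def SplitsIdempotents (R : Type*) [CommRing R] : Prop :=
  ∀ (m : ℕ) (p : Matrix (Fin m) (Fin m) R), p * p = p →
    ∃ (k : ℕ) (X : Matrix (Fin m) (Fin k) R) (Y : Matrix (Fin k) (Fin m) R), Y * X = 1 ∧ X * Y = p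

universe u

namespace Matrix

attribute [local instance] Polynomial.algebra

/-- Scaling the second variable of a bivariate polynomial whose constant coefficient has
coefficients in the base ring clears all denominators. -/
theorem exists_comp_mem_range {A Q : Type*} [CommRing A] [CommRing Q] [Algebra A Q]
    (S : Submonoid A) [IsLocalization S Q] (h : Q[X][X])
    (h0 : h.coeff 0 ∈ (mapRingHom (algebraMap A Q)).range) :
    ∃ c ∈ S, ∀ a : A, h.comp (C (C (algebraMap A Q (c * a))) * X) ∈
      (mapRingHom (mapRingHom (algebraMap A Q))).range := by
  classical
  have := Polynomial.isLocalization S Q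
  obtain ⟨⟨b, s, hs, rfl⟩, hb⟩ := IsLocalization.exist_integer_multiples_of_finset
    (S.map (C : A →+* A[X])) (h.support.image h.coeff)
  have hb' : ∀ j, C (algebraMap A Q s) * h.coeff j ∈ (mapRingHom (algebraMap A Q)).range := by
    intro j
    by_cases hj : j ∈ h.support
    · obtain ⟨y, hy⟩ := hb _ (Finset.mem_image_of_mem _ hj)
      refine ⟨y, ?_⟩
      rw [← algebraMap_def, hy]
      simp [Algebra.smul_def, algebraMap_def]
    · rw [notMem_support_iff.mp hj, mul_zero]
      exact zero_mem _
  have hC : ∀ a : A, C (algebraMap A Q a) ∈ (mapRingHom (algebraMap A Q)).range :=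
    fun a ↦ ⟨C a, by simp⟩
  refine ⟨s, hs, fun a ↦ ?_⟩
  rw [mem_map_range]
  intro j
  rw [comp_C_mul_X_coeff]
  rcases j with _ | j
  · simpa using h0
  -- In positive degree one of the j + 1 factors s clears the denominator.
  · have : h.coeff (j + 1) * C (algebraMap A Q (s * a)) ^ (j + 1) =
        C (algebraMap A Q s) * h.coeff (j + 1) * C (algebraMap A Q a) *
          C (algebraMap A Q (s * a)) ^ j := by
      rw [pow_succ, map_mul, C_mul]; ring
    rw [this]
    exact mul_mem (mul_mem (hb' _) (hC _)) (pow_mem (hC _) _)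

theorem exists_matrix_map_eq {A B : Type*} [CommRing A] [CommRing B] (f : A →+* B) {m n : Type*}
    (M : Matrix m n B) (h : ∀ i j, M i j ∈ f.range) : ∃ M' : Matrix m n A, M'.map f = M := by
  choose g hg using h
  exact ⟨of g, by ext i j; exact hg i j⟩

variable {A : Type u} [CommRing A] {m n : Type} [Fintype m] [Fintype n] [DecidableEq m]
  [DecidableEq n]

/-- The value at `x` of a matrix of polynomials. -/
noncomputable def evalAt {E : Type*} [CommRing E] [Algebra A E] (V : Matrix m n A[X]) (x : E) :
    Matrix m n E :=
  V.map (aeval x)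

/-- Those `c` for which `V (x + c y)` and `V x` are left equivalent, `x` and `y` being
variables. -/
def patchingIdeal (V : Matrix m n A[X]) : Ideal A where
  carrier := {c | ∀ (E : Type u) [CommRing E] [Algebra A E] (x y : E), ∃ G G' : Matrix m m E,
    G * G' = 1 ∧ V.evalAt (x + algebraMap A E c * y) = G * V.evalAt x}
  zero_mem' E _ _ x y := ⟨1, 1, by simp, by simp⟩
  -- The second translation starts at x + a y, which is why x and y range over all elements of all
  -- algebras.
  add_mem' := by
    intro a b ha hb E _ _ x y
    obtain ⟨G, G', h1, h2⟩ := ha E x y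
    obtain ⟨H, H', h3, h4⟩ := hb E (x + algebraMap A E a * y) y
    refine ⟨H * G, G' * H', ?_, ?_⟩
    · rw [Matrix.mul_assoc, ← Matrix.mul_assoc G, h1, Matrix.one_mul, h3]
    · rw [Matrix.mul_assoc, ← h2, ← h4, map_add, add_mul, add_assoc]
  smul_mem' := by
    intro a c hc E _ _ x y
    obtain ⟨G, G', h1, h2⟩ := hc E x (algebraMap A E a * y)
    refine ⟨G, G', h1, ?_⟩
    rw [← h2, smul_eq_mul, map_mul, mul_comm (algebraMap A E a), mul_assoc]

-- The matrix G = M(X + Y) M(X)⁻¹ carries V(X) to V(X + Y) and is the identity at Y = 0. Replacing Y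
-- by d Y, for a suitable d outside I, clears the denominators of G and of its inverse. As A is a
-- domain, the identities descend from Q to A, and they specialise to every x and y.
omit [Fintype n] [DecidableEq n] in
theorem exists_mem_patchingIdeal [IsDomain A] (V : Matrix m n A[X]) (I : Ideal A) [I.IsPrime]
    (Q : Type*) [CommRing Q] [Algebra A Q] [IsLocalization.AtPrime Q I]
    (h : ∃ M M' : Matrix m m Q[X], M * M' = 1 ∧ V.map (mapRingHom (algebraMap A Q)) =
      M * (V.map (evalRingHom 0)).map (C.comp (algebraMap A Q))) :
    ∃ c ∈ patchingIdeal V, c ∉ I := by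
  classical
  let ι : A →+* Q := algebraMap A Q
  obtain ⟨M, M', hM, hV⟩ := h
  have hM' : M' * M = 1 := mul_eq_one_comm.mp hM
  let σ : Q[X] →+* Q[X][X] := eval₂RingHom (C.comp C) (C X + X)
  let V₀ : Matrix m n Q[X][X] := (V.map (evalRingHom 0)).map ((C.comp C).comp ι)
  have hVσ : (V.map (mapRingHom ι)).map σ = M.map σ * V₀ := by
    rw [hV, Matrix.map_mul]
    congr 1
    ext1 i j
    simp [V₀, σ, ι]
  have hVC : (V.map (mapRingHom ι)).map (C : Q[X] →+* _) = M.map C * V₀ := by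
    rw [hV, Matrix.map_mul]
    congr 1
  let G := M.map σ * M'.map (C : Q[X] →+* _)
  let G' := M.map (C : Q[X] →+* _) * M'.map σ
  have hGG' : G * G' = 1 := by
    have e1 : M'.map (C : Q[X] →+* _) * M.map (C : Q[X] →+* _) = 1 := by
      rw [← Matrix.map_mul, hM']; simp
    have e2 : M.map σ * M'.map σ = 1 := by
      rw [← Matrix.map_mul, hM]; simp
    calc G * G' = M.map σ * (M'.map (C : Q[X] →+* _) * M.map (C : Q[X] →+* _)) * M'.map σ := by
          simp only [G, G', Matrix.mul_assoc]
      _ = 1 := by rw [e1, Matrix.mul_one, e2]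
  have hGV : (V.map (mapRingHom ι)).map σ = G * (V.map (mapRingHom ι)).map (C : Q[X] →+* _) := by
    have e1 : M'.map (C : Q[X] →+* _) * M.map (C : Q[X] →+* _) = 1 := by
      rw [← Matrix.map_mul, hM']; simp
    rw [hVσ, hVC]
    simp only [G, Matrix.mul_assoc]
    rw [← Matrix.mul_assoc (M'.map _), e1, Matrix.one_mul]
  have hσ0 : (evalRingHom (0 : Q[X])).comp σ = RingHom.id _ := by
    ext <;> simp [σ]
  have hσ1 : (evalRingHom (0 : Q[X])).comp C = RingHom.id Q[X] := by
    ext <;> simp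
  have hcoeff : ∀ N : Matrix m m Q[X][X], N.map (evalRingHom 0) = 1 →
      ∀ i j, (N i j).coeff 0 ∈ (mapRingHom ι).range := by
    intro N hN i j
    have : (N i j).coeff 0 = (1 : Matrix m m Q[X]) i j := by
      rw [← hN, coeff_zero_eq_eval_zero]; rfl
    rw [this, one_apply]
    split_ifs
    · exact one_mem _
    · exact zero_mem _
  have hev : ∀ N : Matrix m m Q[X], (N.map σ).map (evalRingHom 0) = N ∧
      (N.map (C : Q[X] →+* _)).map (evalRingHom 0) = N := by
    intro N
    refine ⟨?_, ?_⟩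
    · ext1 i j; exact congrArg (fun f : Q[X] →+* Q[X] ↦ f (N i j)) hσ0
    · ext1 i j; exact congrArg (fun f : Q[X] →+* Q[X] ↦ f (N i j)) hσ1
  have hG0 : G.map (evalRingHom 0) = 1 := by
    rw [Matrix.map_mul, (hev M).1, (hev M').2, hM]
  have hG0' : G'.map (evalRingHom 0) = 1 := by
    rw [Matrix.map_mul, (hev M).2, (hev M').1, hM]
  choose c hc hcG using fun ij : m × m ↦
    exists_comp_mem_range I.primeCompl (G ij.1 ij.2) (hcoeff G hG0 ij.1 ij.2)
  choose c' hc' hcG' using fun ij : m × m ↦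
    exists_comp_mem_range I.primeCompl (G' ij.1 ij.2) (hcoeff G' hG0' ij.1 ij.2)
  -- One scaling must serve all entries of G and G', so d is a multiple of each entry's denominator.
  let d : A := (∏ ij, c ij) * ∏ ij, c' ij
  have hd : d ∈ I.primeCompl :=
    mul_mem (prod_mem fun ij _ ↦ hc ij) (prod_mem fun ij _ ↦ hc' ij)
  let ψ : Q[X][X] →+* Q[X][X] := compRingHom (C (C (ι d)) * X)
  let Φ : A[X][X] →+* Q[X][X] := mapRingHom (mapRingHom ι)
  have hι : Function.Injective ι :=
    IsLocalization.injective Q I.primeCompl_le_nonZeroDivisors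
  have hΦ : Function.Injective Φ := Polynomial.map_injective _ (Polynomial.map_injective _ hι)
  obtain ⟨P, hP⟩ := exists_matrix_map_eq Φ (G.map ψ) fun i j ↦ by
    obtain ⟨a, ha⟩ : c (i, j) ∣ d := Dvd.dvd.mul_right (Finset.dvd_prod_of_mem _ (by simp)) _
    have := hcG (i, j) a
    rw [← ha] at this
    exact this
  obtain ⟨P', hP'⟩ := exists_matrix_map_eq Φ (G'.map ψ) fun i j ↦ by
    obtain ⟨a, ha⟩ : c' (i, j) ∣ d := Dvd.dvd.mul_left (Finset.dvd_prod_of_mem _ (by simp)) _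
    have := hcG' (i, j) a
    rw [← ha] at this
    exact this
  have hinj : ∀ {a b : Type} {N N' : Matrix a b A[X][X]}, N.map Φ = N'.map Φ → N = N' :=
    by
    intro a b N N' h; exact Matrix.map_injective hΦ h
  have hPP' : P * P' = 1 := by
    apply hinj
    rw [Matrix.map_mul, hP, hP', ← Matrix.map_mul, hGG']
    simp
  have hr1 : Φ.comp ((aeval (C X + algebraMap A A[X][X] d * X) : A[X] →ₐ[A] A[X][X]) :
      A[X] →+* A[X][X]) = (ψ.comp σ).comp (mapRingHom ι) := by
    ext <;> simp [Φ, ψ, σ, ι, Polynomial.algebraMap_apply]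
  have hr2 : Φ.comp ((aeval (C X : A[X][X]) : A[X] →ₐ[A] A[X][X]) :
      A[X] →+* A[X][X]) = (ψ.comp C).comp (mapRingHom ι) := by
    ext <;> simp [Φ, ψ, ι, Polynomial.algebraMap_apply]
  have hPV : V.evalAt (C X + algebraMap A A[X][X] d * X) = P * V.evalAt (C X : A[X][X]) := by
    apply hinj
    have e1 : (V.evalAt (C X + algebraMap A A[X][X] d * X)).map Φ =
        ((V.map (mapRingHom ι)).map σ).map ψ := by
      ext1 i j; exact congrArg (fun f : A[X] →+* Q[X][X] ↦ f (V i j)) hr1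
    have e2 : (V.evalAt (C X : A[X][X])).map Φ =
        ((V.map (mapRingHom ι)).map (C : Q[X] →+* _)).map ψ := by
      ext1 i j; exact congrArg (fun f : A[X] →+* Q[X][X] ↦ f (V i j)) hr2
    rw [Matrix.map_mul, e1, e2, hP, hGV, Matrix.map_mul]
  refine ⟨d, fun E _ _ x y ↦ ?_, hd⟩
  let τ : A[X][X] →+* E := eval₂RingHom (aeval x : A[X] →ₐ[A] E).toRingHom y
  refine ⟨P.map τ, P'.map τ, by rw [← Matrix.map_mul, hPP']; simp, ?_⟩
  have hs1 : τ.comp ((aeval (C X + algebraMap A A[X][X] d * X) : A[X] →ₐ[A] A[X][X]) :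
      A[X] →+* A[X][X]) = (aeval (x + algebraMap A E d * y) : A[X] →ₐ[A] E).toRingHom := by
    ext <;> simp [τ, Polynomial.algebraMap_apply]
  have hs2 : τ.comp ((aeval (C X : A[X][X]) : A[X] →ₐ[A] A[X][X]) :
      A[X] →+* A[X][X]) = (aeval x : A[X] →ₐ[A] E).toRingHom := by
    ext <;> simp [τ, Polynomial.algebraMap_apply]
  have e1 : V.evalAt (x + algebraMap A E d * y) =
      (V.evalAt (C X + algebraMap A A[X][X] d * X)).map τ := by
    ext1 i j; exact congrArg (fun f : A[X] →+* E ↦ f (V i j)) hs1.symm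
  have e2 : V.evalAt x = (V.evalAt (C X : A[X][X])).map τ := by
    ext1 i j; exact congrArg (fun f : A[X] →+* E ↦ f (V i j)) hs2.symm
  rw [e1, e2, hPV, Matrix.map_mul]

omit [Fintype n] [DecidableEq n] in
/-- Local-to-global principle for the left equivalence of `V` and `V(0)`. -/
theorem exists_eq_mul_eval_zero_of_local [IsDomain A] (V : Matrix m n A[X])
    (h : ∀ (I : Ideal A) [I.IsMaximal], ∃ M M' : Matrix m m (Localization.AtPrime I)[X],
      M * M' = 1 ∧ V.map (mapRingHom (algebraMap A (Localization.AtPrime I))) =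
        M * (V.map (evalRingHom 0)).map (C.comp (algebraMap A (Localization.AtPrime I)))) :
    ∃ G G' : Matrix m m A[X], G * G' = 1 ∧ V = G * (V.map (evalRingHom 0)).map C := by
  have h1 : patchingIdeal V = ⊤ := by
    by_contra hne
    obtain ⟨I, hI, hle⟩ := Ideal.exists_le_maximal _ hne
    obtain ⟨c, hc, hcI⟩ := exists_mem_patchingIdeal V I _ (h I)
    exact hcI (hle hc)
  have h2 : (1 : A) ∈ patchingIdeal V := by rw [h1]; trivial
  obtain ⟨G, G', hG, hV⟩ := h2 A[X] 0 X
  refine ⟨G, G', hG, ?_⟩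
  have e1 : V.evalAt (0 + algebraMap A A[X] 1 * X) = V := by
    ext1 i j; simp [evalAt]
  have e2 : V.evalAt (0 : A[X]) = (V.map (evalRingHom 0)).map C := by
    ext1 i j
    simp [evalAt, aeval_def, eval₂_eq_sum_range, eval_eq_sum_range]
  rw [← e2, ← hV, e1]

/-- The idempotent 1 - V L projects onto a complement of the image of V; splitting it supplies the
missing columns and rows. -/
theorem completable_of_splitsIdempotents (hA : SplitsIdempotents A) {V : Matrix m n A}
    (h : ∃ L : Matrix n m A, L * V = 1) : Completable V := by
  obtain ⟨L, hL⟩ := h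
  let e := (Fintype.equivFin m).symm
  let p := 1 - V * L
  have hp : p * p = p := by
    have : V * L * (V * L) = V * L := by
      rw [Matrix.mul_assoc, ← Matrix.mul_assoc L, hL, Matrix.one_mul]
    simp only [p, Matrix.mul_sub, Matrix.sub_mul, this, Matrix.mul_one, Matrix.one_mul]
    abel
  obtain ⟨k, X, Y, h1, h2⟩ := hA _ (p.submatrix e e) (by rw [submatrix_mul_equiv, hp])
  have hXY : X.submatrix e.symm id * Y.submatrix id e.symm = p := by
    rw [← submatrix_mul _ _ _ id _ Function.bijective_id, h2]; simp
  have hYX : Y.submatrix id e.symm * X.submatrix e.symm id = 1 := by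
    rw [submatrix_mul_equiv, h1]; simp
  have hpV : p * V = 0 := by
    simp only [p, Matrix.sub_mul, Matrix.mul_assoc, hL]; simp
  have hLp : L * p = 0 := by
    simp only [p, Matrix.mul_sub, ← Matrix.mul_assoc, hL]; simp
  refine ⟨k, X.submatrix e.symm id, L, Y.submatrix id e.symm, ?_, hL, ?_, ?_, hYX⟩
  · rw [hXY]; simp [p]
  · rw [← Matrix.mul_one (X.submatrix e.symm id), ← hYX, ← Matrix.mul_assoc (X.submatrix _ _), hXY,
      ← Matrix.mul_assoc, hLp, Matrix.zero_mul]
  · rw [← Matrix.one_mul (Y.submatrix id e.symm), ← hYX, Matrix.mul_assoc (Y.submatrix _ _), hXY,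
      Matrix.mul_assoc, hpV, Matrix.mul_zero]

/-- Left invertible pencils with left invertible leading part are completable over domains whose
finite projective modules are free. -/
theorem completable_pencil [IsDomain A] (hA : SplitsIdempotents A) {E F : Matrix m n A}
    (hE : ∃ K : Matrix n m A, K * E = 1) (hL : ∃ L : Matrix n m A[X], L * pencil E F = 1) :
    Completable (pencil E F) := by
  obtain ⟨G, G', hG, hV⟩ := exists_eq_mul_eval_zero_of_local (pencil E F) fun I _ ↦ by
    set ι := algebraMap A (Localization.AtPrime I)
    have hc : Completable ((pencil E F).map (mapRingHom ι)) := by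
      rw [pencil_map]
      refine completable_pencil_of_isLocalRing _ m n rfl _ _ ?_ ?_
      · obtain ⟨K, hK⟩ := hE
        exact ⟨K.map ι, by rw [← Matrix.map_mul, hK]; simp⟩
      · obtain ⟨L, hL⟩ := hL
        exact ⟨L.map (mapRingHom ι), by rw [← pencil_map, ← Matrix.map_mul, hL]; simp⟩
    obtain ⟨M, M', h1, h2⟩ := hc.exists_eq_mul_eval_zero
    refine ⟨M, M', h1, h2.trans ?_⟩
    congr 1
    ext1 i j
    simp [pencil]
  have hc : Completable ((pencil E F).map (evalRingHom 0)) := by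
    refine completable_of_splitsIdempotents hA ?_
    obtain ⟨L, hL⟩ := hL
    exact ⟨L.map (evalRingHom 0), by rw [← Matrix.map_mul, hL]; simp⟩
  refine Completable.of_mul_left (G := G') (G' := G) hG ?_
  have : G' * pencil E F = ((pencil E F).map (evalRingHom 0)).map C := by
    conv_lhs => rw [hV]
    rw [← Matrix.mul_assoc, mul_eq_one_comm.mp hG, Matrix.one_mul]
  rw [this]
  exact hc.map C

end Matrix

/-! ### Split idempotents and free modules -/

section Free

variable {R : Type*} [CommRing R]

theorem SplitsIdempotents.free (h : SplitsIdempotents R) (M : Type*) [AddCommGroup M] [Module R M]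
    [Module.Finite R M] [Module.Projective R M] : Module.Free R M := by
  classical
  obtain ⟨n, π, hπ⟩ := Module.Finite.exists_fin' R M
  obtain ⟨s, hs⟩ := Module.projective_lifting_property π LinearMap.id hπ
  have hs' : ∀ x, π (s x) = x := fun x ↦ LinearMap.congr_fun hs x
  obtain ⟨k, X, Y, hYX, hXY⟩ := h n (LinearMap.toMatrix' (s ∘ₗ π)) (by
    rw [← LinearMap.toMatrix'_comp]
    congr 1
    refine LinearMap.ext fun x ↦ ?_
    simp [hs'])
  have hp : ∀ v, X.mulVec (Y.mulVec v) = s (π v) := by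
    intro v
    rw [Matrix.mulVec_mulVec, hXY, LinearMap.toMatrix'_mulVec]; rfl
  have hYX' : ∀ v, Y.mulVec (X.mulVec v) = v := by
    intro v
    rw [Matrix.mulVec_mulVec, hYX, Matrix.one_mulVec]
  refine Module.Free.of_equiv (LinearEquiv.ofLinearMap (π ∘ₗ X.mulVecLin) (Y.mulVecLin ∘ₗ s) ?_ ?_)
  · ext1 x
    simp [hp, hs']
  · refine LinearMap.ext fun x ↦ ?_
    simp only [LinearMap.comp_apply, Matrix.mulVecLin_apply, LinearMap.id_apply]
    rw [← hp, hYX', hYX']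

/-- An idempotent matrix whose range is free splits. -/
theorem exists_split_of_free_range {m : ℕ} {p : Matrix (Fin m) (Fin m) R} (hp : p * p = p)
    [Module.Free R (LinearMap.range p.mulVecLin)] :
    ∃ (k : ℕ) (X : Matrix (Fin m) (Fin k) R) (Y : Matrix (Fin k) (Fin m) R),
      Y * X = 1 ∧ X * Y = p := by
  classical
  rcases subsingleton_or_nontrivial R with _ | _
  · exact ⟨0, 0, 0, Subsingleton.elim _ _, Subsingleton.elim _ _⟩
  let P := LinearMap.range p.mulVecLin
  have : Module.Finite R P := Module.Finite.range _
  let e : P ≃ₗ[R] (Fin (Module.finrank R P) → R) := (Module.finBasis R P).equivFun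
  refine ⟨Module.finrank R P, LinearMap.toMatrix' (P.subtype ∘ₗ e.symm.toLinearMap),
    LinearMap.toMatrix' (e.toLinearMap ∘ₗ p.mulVecLin.rangeRestrict), ?_, ?_⟩
  · rw [← LinearMap.toMatrix'_comp, ← LinearMap.toMatrix'_id]
    congr 1
    refine LinearMap.ext fun x ↦ ?_
    simp only [LinearMap.comp_apply, LinearEquiv.coe_coe, LinearMap.id_apply]
    rw [← LinearEquiv.eq_symm_apply]
    obtain ⟨y, hy⟩ := (e.symm x).2
    apply Subtype.ext
    change p.mulVec (e.symm x) = (e.symm x : Fin m → R)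
    rw [← hy, Matrix.mulVecLin_apply, Matrix.mulVec_mulVec, hp]
  · rw [← LinearMap.toMatrix'_comp]
    apply LinearMap.toMatrix'.symm.injective
    rw [LinearEquiv.symm_apply_apply]
    refine LinearMap.ext fun x ↦ ?_
    simp only [LinearMap.comp_apply, LinearEquiv.coe_coe, LinearEquiv.symm_apply_apply]
    simp [P]

theorem SplitsIdempotents.of_ringEquiv {S : Type*} [CommRing S] (f : R ≃+* S)
    (h : SplitsIdempotents R) : SplitsIdempotents S := by
  intro m p hp
  obtain ⟨k, X, Y, h1, h2⟩ := h m (p.map f.symm) (by rw [← Matrix.map_mul, hp])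
  refine ⟨k, X.map f, Y.map f, ?_, ?_⟩
  · rw [← Matrix.map_mul, h1]; simp
  · rw [← Matrix.map_mul, h2]; ext1 i j; simp

theorem splitsIdempotents_of_field (K : Type*) [Field K] : SplitsIdempotents K :=
  fun _ _ hp ↦ exists_split_of_free_range hp

end Free

/-! ### Division of polynomial matrices by X - τ -/

namespace Matrix

section Division

variable {A : Type*} [CommRing A] {s k : Type*} [Fintype s] [DecidableEq s] [Finite k]

/-- X and τ commute, so X - τ divides Xⁿ - τⁿ through the geometric sum. When f(τ) = 0, this makes X
- τ a factor of the scalar matrix f. -/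
theorem exists_smul_one_sub_aeval (τ : Matrix s s A) (f : A[X]) :
    ∃ G : Matrix s s A[X], G * charmatrix τ = f • (1 : Matrix s s A[X]) - (aeval τ f).map C ∧
      charmatrix τ * G = f • (1 : Matrix s s A[X]) - (aeval τ f).map C := by
  have hc : charmatrix τ = (X : A[X]) • (1 : Matrix s s A[X]) - τ.map C := by
    ext1 i j
    by_cases h : i = j <;> simp [h]
  have hcomm : Commute ((X : A[X]) • (1 : Matrix s s A[X])) (τ.map C) := by
    simp [Commute, SemiconjBy]
  induction f using Polynomial.induction_on' with
  | add p q hp hq =>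
    obtain ⟨G, h1, h2⟩ := hp
    obtain ⟨H, h3, h4⟩ := hq
    have : (aeval τ (p + q)).map C = (aeval τ p).map C + (aeval τ q).map (C : A →+* A[X]) := by
      rw [map_add, Matrix.map_add _ (map_add _)]
    refine ⟨G + H, ?_, ?_⟩
    · rw [Matrix.add_mul, h1, h3, this, add_smul]; abel
    · rw [Matrix.mul_add, h2, h4, this, add_smul]; abel
  | monomial n a =>
    have h1 : (aeval τ (monomial n a)).map (C : A →+* A[X]) = (C a : A[X]) • (τ.map C) ^ n := by
      rw [aeval_monomial, ← Matrix.map_pow, ← Algebra.smul_def]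
      ext1 i j; simp
    have h2 : (monomial n a) • (1 : Matrix s s A[X]) =
        (C a : A[X]) • ((X : A[X]) • (1 : Matrix s s A[X])) ^ n := by
      rw [_root_.smul_pow, one_pow, smul_smul, C_mul_X_pow_eq_monomial]
    rw [h1, h2, ← smul_sub, hc]
    refine ⟨(C a : A[X]) • ∑ i ∈ Finset.range n,
      ((X : A[X]) • (1 : Matrix s s A[X])) ^ i * (τ.map C) ^ (n - 1 - i), ?_, ?_⟩
    · rw [Matrix.smul_mul, hcomm.geom_sum₂_mul]
    · rw [Matrix.mul_smul, hcomm.mul_geom_sum₂]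

/-- Division by a monic linear polynomial; the induction on the degree rests on X B = B (X - τ) + B
τ. -/
theorem exists_eq_mul_charmatrix_add (τ : Matrix s s A) (x : Matrix k s A[X]) :
    ∃ (y : Matrix k s A[X]) (B : Matrix k s A), x = y * charmatrix τ + B.map C := by
  obtain ⟨N, hN⟩ : ∃ N, ∀ i j, (x i j).natDegree ≤ N := by
    have := Fintype.ofFinite k
    refine ⟨∑ i, ∑ j, (x i j).natDegree, fun i j ↦ ?_⟩
    exact (Finset.single_le_sum (f := fun j ↦ (x i j).natDegree) (fun _ _ ↦ Nat.zero_le _)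
      (Finset.mem_univ j)).trans (Finset.single_le_sum
      (f := fun i ↦ ∑ j, (x i j).natDegree) (fun _ _ ↦ Nat.zero_le _) (Finset.mem_univ i))
  induction N generalizing x with
  | zero =>
    refine ⟨0, of fun i j ↦ (x i j).coeff 0, ?_⟩
    ext1 i j
    simpa using eq_C_of_natDegree_le_zero (hN i j)
  | succ N ih =>
    obtain ⟨y, B, hy⟩ := ih (of fun i j ↦ divX (x i j)) fun i j ↦ by
      have := hN i j
      simp only [of_apply, natDegree_divX_eq_natDegree_tsub_one]
      omega
    have hB : (X : A[X]) • B.map (C : A →+* A[X]) =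
        B.map C * charmatrix τ + (B * τ).map C := by
      have hc : charmatrix τ = (X : A[X]) • (1 : Matrix s s A[X]) - τ.map C := by
        ext1 i j
        by_cases h : i = j <;> simp [h]
      rw [hc, Matrix.mul_sub, Matrix.map_mul]
      simp
    refine ⟨(X : A[X]) • y + B.map C, B * τ + of fun i j ↦ (x i j).coeff 0, ?_⟩
    have hx : x = (X : A[X]) • (of fun i j ↦ divX (x i j)) +
        (of fun i j ↦ (x i j).coeff 0 : Matrix k s A).map C := by
      ext1 i j
      simp only [add_apply, smul_apply, of_apply, map_apply, smul_eq_mul]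
      rw [mul_comm, divX_mul_X_add]
    rw [Matrix.map_add _ (map_add C), ← add_assoc]
    conv_lhs => rw [hx]
    rw [hy, smul_add, hB, Matrix.add_mul, Matrix.smul_mul]
    abel

theorem exists_eq_charmatrix_mul_add (τ : Matrix s s A) (x : Matrix s k A[X]) :
    ∃ (y : Matrix s k A[X]) (B : Matrix s k A), x = charmatrix τ * y + B.map C := by
  obtain ⟨y, B, h⟩ := exists_eq_mul_charmatrix_add τᵀ xᵀ
  refine ⟨yᵀ, Bᵀ, ?_⟩
  rw [← transpose_transpose x, h, transpose_add, transpose_mul, charmatrix_transpose]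
  simp [transpose_map]

end Division

end Matrix

/-! ### Matrix factorizations of a Weierstrass polynomial -/

section MatrixFactorization

variable {A : Type u} [CommRing A] {T : Type*} [CommRing T] [Algebra A T] {P : Type*}
  [AddCommGroup P] [Module T P]

/-- Unique division with remainder by the value at `t` of a monic polynomial `w`. -/
structure IsWeierstrassDivisor (t : T) (w : A[X]) : Prop where
  monic : w.Monic
  exists_div : ∀ x : T, ∃ r ∈ degreeLT A w.natDegree, ∃ q : T, x = aeval t r + aeval t w * q
  unique : ∀ r ∈ degreeLT A w.natDegree, ∀ q : T, aeval t r + aeval t w * q = 0 → r = 0 ∧ q = 0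

namespace IsWeierstrassDivisor

variable {t : T} {w : A[X]}

theorem eq_zero_of_mul_eq_zero (h : IsWeierstrassDivisor t w) {x : T} (hx : aeval t w * x = 0) :
    x = 0 :=
  (h.unique 0 (zero_mem _) x (by simpa using hx)).2

/-- Euclidean division of f by w in A[X] is also a division in T, and uniqueness there kills its
remainder: divisibility by w descends from T to A[X]. -/
theorem exists_eq_mul_of_aeval_eq [Nontrivial A] (h : IsWeierstrassDivisor t w) {f : A[X]} {q : T}
    (hf : aeval t f = aeval t w * q) : ∃ g : A[X], f = w * g ∧ q = aeval t g := by
  have h1 : f %ₘ w ∈ degreeLT A w.natDegree := by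
    rw [mem_degreeLT, ← degree_eq_natDegree h.monic.ne_zero]
    exact degree_modByMonic_lt _ h.monic
  have h2 := modByMonic_add_div f w
  have h3 : aeval t (f %ₘ w) + aeval t w * (aeval t (f /ₘ w) - q) = 0 := by
    have := congrArg (aeval t) h2
    rw [map_add, map_mul, hf] at this
    linear_combination this
  obtain ⟨h4, h5⟩ := h.unique _ h1 _ h3
  exact ⟨f /ₘ w, by rw [h4, zero_add] at h2; exact h2.symm, (sub_eq_zero.mp h5).symm⟩

/-- Division with remainder as a linear equivalence. -/
noncomputable def divEquiv (h : IsWeierstrassDivisor t w) :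
    (degreeLT A w.natDegree × T) ≃ₗ[A] T :=
  LinearEquiv.ofBijective
    ((aeval t).toLinearMap ∘ₗ (degreeLT A w.natDegree).subtype ∘ₗ LinearMap.fst A _ T +
      LinearMap.mulLeft A (aeval t w) ∘ₗ LinearMap.snd A _ T) <| by
    constructor
    · rw [injective_iff_map_eq_zero]
      rintro ⟨⟨r, hr⟩, q⟩ h0
      obtain ⟨h1, h2⟩ := h.unique r hr q (by simpa using h0)
      subst h1 h2
      rfl
    · intro x
      obtain ⟨r, hr, q, hx⟩ := h.exists_div x
      exact ⟨⟨⟨r, hr⟩, q⟩, by simpa using hx.symm⟩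

theorem divEquiv_apply (h : IsWeierstrassDivisor t w) (r : degreeLT A w.natDegree) (q : T) :
    h.divEquiv (r, q) = aeval t (r : A[X]) + aeval t w * q :=
  rfl

/-- The remainder. -/
noncomputable def rem (h : IsWeierstrassDivisor t w) : T →ₗ[A] degreeLT A w.natDegree :=
  LinearMap.fst A _ T ∘ₗ h.divEquiv.symm.toLinearMap

/-- The quotient. -/
noncomputable def quot (h : IsWeierstrassDivisor t w) : T →ₗ[A] T :=
  LinearMap.snd A _ T ∘ₗ h.divEquiv.symm.toLinearMap

theorem rem_add_quot (h : IsWeierstrassDivisor t w) (x : T) :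
    aeval t (h.rem x : A[X]) + aeval t w * h.quot x = x := by
  rw [← h.divEquiv_apply]
  exact h.divEquiv.apply_symm_apply x

theorem quot_mul (h : IsWeierstrassDivisor t w) (x : T) : h.quot (aeval t w * x) = x := by
  have : aeval t w * x = h.divEquiv (0, x) := by simp [h.divEquiv_apply]
  rw [this]
  simp [quot]

end IsWeierstrassDivisor

/-- If `w P ⊆ F ⊆ P` with `F` free, then a finite projective module `P` has an `A`-linear
idempotent endomorphism with kernel `F` whose range is finite projective over `A`. -/
theorem exists_projection_of_matrix_factorization [Module A P] [IsScalarTower A T P]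
    [Module.Finite T P] [Module.Projective T P] {t : T} {w : A[X]}
    (hw : IsWeierstrassDivisor t w) {k : ℕ} (α : (Fin k → T) →ₗ[T] P) (β : P →ₗ[T] (Fin k → T))
    (hαβ : ∀ x, α (β x) = aeval t w • x) (hβα : ∀ y, β (α y) = aeval t w • y) :
    ∃ (θ : P → (Fin k → T)) (e : P →ₗ[A] P), (∀ y, θ (α y) = y) ∧ (∀ x, e x + α (θ x) = x) ∧
      (∀ y, e (α y) = 0) ∧ (∀ x, e (e x) = e x) ∧ Module.Finite A (LinearMap.range e) ∧
      Module.Projective A (LinearMap.range e) := by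
  -- β α is multiplication by w(t), and the quotient of an exact multiple is exact; so the
  -- coordinatewise quotient of β is an A-linear retraction of α.
  let θ : P →ₗ[A] (Fin k → T) :=
    LinearMap.pi fun i ↦ hw.quot ∘ₗ LinearMap.proj i ∘ₗ β.restrictScalars A
  have hθ : ∀ y, θ (α y) = y := by
    intro y
    ext i
    simp [θ, hβα, hw.quot_mul]
  let e : P →ₗ[A] P := LinearMap.id - α.restrictScalars A ∘ₗ θ
  have he : ∀ x, e x = x - α (θ x) := fun x ↦ rfl
  have h1 : ∀ x, e x + α (θ x) = x := fun x ↦ by rw [he]; abel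
  have h2 : ∀ y, e (α y) = 0 := fun y ↦ by rw [he, hθ, sub_self]
  have h3 : ∀ x, e (e x) = e x := by
    intro x
    conv_rhs => rw [← h1 x, map_add, h2, add_zero]
  obtain ⟨m, π, hπ⟩ := Module.Finite.exists_fin' T P
  obtain ⟨ι, hι⟩ := Module.projective_lifting_property π LinearMap.id hπ
  have hι' : ∀ x, π (ι x) = x := fun x ↦ LinearMap.congr_fun hι x
  -- Remainders of coordinates lie in a finite free A-module. Passing to them loses only multiples
  -- of w(t), which land in the image of α and are killed by e; so the range of e is a retract of
  -- that free module.
  let i : LinearMap.range e →ₗ[A] (Fin m → degreeLT A w.natDegree) :=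
    LinearMap.pi fun j ↦ hw.rem ∘ₗ LinearMap.proj j ∘ₗ ι.restrictScalars A ∘ₗ Submodule.subtype _
  let s : (Fin m → degreeLT A w.natDegree) →ₗ[A] LinearMap.range e :=
    e.rangeRestrict ∘ₗ π.restrictScalars A ∘ₗ LinearMap.pi fun j ↦
      (aeval t).toLinearMap ∘ₗ (degreeLT A w.natDegree).subtype ∘ₗ LinearMap.proj j
  have hsi : s ∘ₗ i = LinearMap.id := by
    refine LinearMap.ext fun c ↦ Subtype.ext ?_
    obtain ⟨x, hx⟩ := c.2
    have h4 : (fun j ↦ aeval t (hw.rem (ι (c : P) j) : A[X])) =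
        ι (c : P) - aeval t w • (fun j ↦ hw.quot (ι (c : P) j)) := by
      ext j
      simp only [Pi.sub_apply, Pi.smul_apply, smul_eq_mul]
      exact eq_sub_of_add_eq (hw.rem_add_quot _)
    change e (π (fun j ↦ aeval t (hw.rem (ι (c : P) j) : A[X]))) = c
    rw [h4, map_sub, map_smul, hι', ← hαβ, map_sub, h2, sub_zero, ← hx, h3]
  have hsurj : Function.Surjective s := fun c ↦ ⟨i c, LinearMap.congr_fun hsi c⟩
  have : Module.Free A (degreeLT A w.natDegree) :=
    Module.Free.of_equiv (degreeLTEquiv A w.natDegree).symm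
  have : Module.Finite A (degreeLT A w.natDegree) :=
    Module.Finite.equiv (degreeLTEquiv A w.natDegree).symm
  exact ⟨θ, e, hθ, h1, h2, h3, Module.Finite.of_surjective s hsurj,
    Module.Projective.of_split i s hsi⟩

namespace Matrix

/-- P is the cokernel of the injection V, and projectivity splits the sequence: L x is the preimage
under V of x - v (q x). -/
theorem exists_leftInverse_of_injective {m n : Type*} [Fintype m] [Fintype n] [DecidableEq m]
    [DecidableEq n] {V : Matrix m n T} (hV : ∀ z, V *ᵥ z = 0 → z = 0)
    (q : (m → T) →ₗ[T] P) (hq : ∀ x, q x = 0 → ∃ z, x = V *ᵥ z) (hqV : ∀ z, q (V *ᵥ z) = 0)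
    (hsurj : Function.Surjective q) [Module.Projective T P] : ∃ L : Matrix n m T, L * V = 1 := by
  obtain ⟨v, hv⟩ := Module.projective_lifting_property q LinearMap.id hsurj
  have hv' : ∀ x, q (v x) = x := fun x ↦ LinearMap.congr_fun hv x
  have : ∀ i : m, ∃ z, Pi.single i 1 - v (q (Pi.single i 1)) = V *ᵥ z := by
    intro i
    exact hq _ (by rw [map_sub, hv', sub_self])
  choose z hz using this
  let L : Matrix n m T := of fun j i ↦ z i j
  have hL : ∀ x, V *ᵥ (L *ᵥ x) = x - v (q x) := by
    have : (V.mulVecLin ∘ₗ L.mulVecLin) = LinearMap.id - v ∘ₗ q := by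
      refine (Pi.basisFun T m).ext fun i ↦ ?_
      have h1 : L *ᵥ Pi.single i 1 = z i := by
        ext j; simp [L]
      simp [h1, ← hz]
    intro x
    exact LinearMap.congr_fun this x
  refine ⟨L, ?_⟩
  apply ext_of_mulVec_single
  intro j
  rw [one_mulVec, ← sub_eq_zero]
  apply hV
  rw [← mulVec_mulVec, mulVec_sub, hL, hqV]
  simp

/-- The complementary columns N span a free complement of the image of V, which q maps
isomorphically onto P. -/
theorem Completable.free_of_surjective {m n : Type*} [Fintype m] [Fintype n] [DecidableEq m]
    [DecidableEq n] {V : Matrix m n T} (hV : Completable V)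
    (q : (m → T) →ₗ[T] P) (hq : ∀ x, q x = 0 → ∃ z, x = V *ᵥ z) (hqV : ∀ z, q (V *ᵥ z) = 0)
    (hsurj : Function.Surjective q) : Module.Free T P := by
  obtain ⟨k, N, L, L', h1, h2, h3, h4, h5⟩ := hV
  refine Module.Free.of_equiv (LinearEquiv.ofBijective (q ∘ₗ N.mulVecLin) ⟨?_, ?_⟩)
  · rw [injective_iff_map_eq_zero]
    intro y hy
    obtain ⟨z, hz⟩ := hq _ hy
    have : L' *ᵥ (N *ᵥ y) = L' *ᵥ (V *ᵥ z) := congrArg _ hz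
    rwa [mulVec_mulVec, mulVec_mulVec, h5, h4, one_mulVec, zero_mulVec] at this
  · intro p
    obtain ⟨x, rfl⟩ := hsurj p
    refine ⟨L' *ᵥ x, ?_⟩
    have : x = V *ᵥ (L *ᵥ x) + N *ᵥ (L' *ᵥ x) := by
      rw [mulVec_mulVec, mulVec_mulVec, ← add_mulVec, h1, one_mulVec]
    conv_rhs => rw [this, map_add, hqV, zero_add]
    rfl

/-- A left inverse of a pencil descends from `T` to the polynomial ring. -/
theorem exists_leftInverse_pencil_of_aeval [Nontrivial A] {s k : Type*} [Fintype s] [Fintype k]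
    [DecidableEq s] [DecidableEq k] {t : T} {w : A[X]} (hw : IsWeierstrassDivisor t w)
    {V : Matrix k s A[X]} {G : Matrix s k A[X]} (hG : G * V = w • 1)
    {L : Matrix s k T} (hL : L * V.map (aeval t) = 1) : ∃ L : Matrix s k A[X], L * V = 1 := by
  choose r hr q hq using hw.exists_div
  let L₀ : Matrix s k A[X] := of fun i j ↦ r (L i j)
  let L₁ : Matrix s k T := of fun i j ↦ q (L i j)
  have hLL : L = L₀.map (aeval t) + aeval t w • L₁ := by
    ext i j
    exact hq (L i j)
  have h1 : ((1 : Matrix s s A[X]) - L₀ * V).map (aeval t) = aeval t w • (L₁ * V.map (aeval t)) := by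
    rw [Matrix.map_sub _ (map_sub (aeval t : A[X] →ₐ[A] T)), Matrix.map_mul, Matrix.map_one _ (map_zero _)
      (map_one _), ← hL, hLL, Matrix.add_mul, Matrix.smul_mul]
    simp
  choose g hg using fun i j ↦ hw.exists_eq_mul_of_aeval_eq
    (f := ((1 : Matrix s s A[X]) - L₀ * V) i j) (congrFun (congrFun h1 i) j)
  let Q : Matrix s s A[X] := of g
  have h2 : 1 - L₀ * V = w • Q := by
    ext1 i j
    exact (hg i j).1
  -- As G V = w, the product with V is L₀ V + w Q, and w Q is exactly the defect 1 - L₀ V.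
  refine ⟨L₀ + Q * G, ?_⟩
  rw [Matrix.add_mul, Matrix.mul_assoc, hG, Matrix.mul_smul, Matrix.mul_one, ← h2]
  abel

end Matrix

open Matrix in
/-- If `A` is a domain whose finite projective modules are free, `P` is a finite projective
`T`-module which becomes free after inverting a polynomial `w` over `A` with
`A[X] / w ≃ T / w T`, then `P` is free. -/
theorem free_of_matrix_factorization_aux [IsDomain A] (hA : SplitsIdempotents A) [Module A P]
    [IsScalarTower A T P] [Module.Finite T P] [Module.Projective T P] {t : T} {w : A[X]}
    (hw : IsWeierstrassDivisor t w) {k : ℕ} (α : (Fin k → T) →ₗ[T] P) (β : P →ₗ[T] (Fin k → T))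
    (hαβ : ∀ x, α (β x) = aeval t w • x) (hβα : ∀ y, β (α y) = aeval t w • y) :
    Module.Free T P := by
  classical
  obtain ⟨θ, e, hθ, h1, h2, h3, _, _⟩ :=
    exists_projection_of_matrix_factorization hw α β hαβ hβα
  have : Module.Free A (LinearMap.range e) := hA.free _
  let b := Module.finBasis A (LinearMap.range e)
  set s := Module.finrank A (LinearMap.range e)
  have hα : ∀ y, α y = 0 → y = 0 := by
    intro y hy
    have h0 := h2 0
    rw [← hθ y, hy, ← map_zero α, hθ]
  have heb : ∀ j, e (b j : P) = b j := by
    intro j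
    obtain ⟨x, hx⟩ := (b j).2
    rw [← hx, h3]
  -- the action of `t` on the range of `e`
  let S : Module.End A (LinearMap.range e) :=
    e.rangeRestrict ∘ₗ ((Module.toModuleEnd A (S := T) P t : Module.End A P)) ∘ₗ
      (LinearMap.range e).subtype
  have hS : ∀ c : LinearMap.range e, (S c : P) = e (t • (c : P)) := fun c ↦ rfl
  -- The kernel of e, the image of α, is stable under t; so S is the action of t on P modulo this
  -- image. It is annihilated by w because w(t) P lies in the image of α.
  have het : ∀ x, e (t • e x) = e (t • x) := by
    intro x
    conv_rhs => rw [← h1 x, smul_add, ← α.map_smul, map_add, h2, add_zero]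
  have hSf : ∀ (f : A[X]) (c : LinearMap.range e), (aeval S f c : P) = e (aeval t f • (c : P)) := by
    intro f
    induction f using Polynomial.induction_on' with
    | add p q hp hq => intro c; simp [add_smul, hp, hq]
    | monomial n a =>
      intro c
      have : ∀ n : ℕ, ((S ^ n) c : P) = e (t ^ n • (c : P)) := by
        intro n
        induction n with
        | zero =>
          obtain ⟨x, hx⟩ := c.2
          simp [← hx, h3]
        | succ n ih =>
          rw [pow_succ', Module.End.mul_apply, hS, ih, het, smul_smul, pow_succ']
      simp only [aeval_monomial, Module.End.mul_apply, Module.algebraMap_end_apply,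
        Submodule.coe_smul, this, mul_smul, algebraMap_smul, map_smul]
  have hSw : aeval S w = 0 := by
    refine LinearMap.ext fun c ↦ Subtype.ext ?_
    rw [hSf, ← hαβ, h2]; rfl
  let τ : Matrix (Fin s) (Fin s) A := LinearMap.toMatrixAlgEquiv b S
  have hτ : aeval τ w = 0 := by
    have := Polynomial.aeval_algHom_apply (LinearMap.toMatrixAlgEquiv b).toAlgHom S w
    rw [hSw, map_zero] at this
    exact this
  have htb : ∀ j, e (t • (b j : P)) = ∑ i, τ i j • (b i : P) := by
    intro j
    rw [← hS]
    have := congrArg Subtype.val (b.sum_repr (S (b j)))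
    rw [← this, Submodule.coe_sum]
    simp [τ, LinearMap.toMatrixAlgEquiv_apply]
  -- As w(τ) = 0, the matrix M = t - τ divides w(t) on both sides, so division by w(t) refines to
  -- division by M with remainders in A.
  obtain ⟨G, hG1, hG2⟩ := exists_smul_one_sub_aeval τ w
  rw [hτ] at hG1 hG2
  simp only [Matrix.map_zero _ (map_zero C), sub_zero] at hG1 hG2
  let M : Matrix (Fin s) (Fin s) T := (charmatrix τ).map (aeval t)
  have hM : ∀ i j, M i j = (if i = j then t else 0) - algebraMap A T (τ i j) := by
    intro i j
    by_cases h : i = j <;> simp [M, h]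
  have hGM1 : G.map (aeval t) * M = aeval t w • 1 := by
    rw [← Matrix.map_mul, hG1]
    ext1 i j
    by_cases h : i = j <;> simp [h]
  have hGM2 : M * G.map (aeval t) = aeval t w • 1 := by
    rw [← Matrix.map_mul, hG2]
    ext1 i j
    by_cases h : i = j <;> simp [h]
  -- division by `M` on both sides
  have hdivl : ∀ c : Matrix (Fin k) (Fin s) T, ∃ (y : Matrix (Fin k) (Fin s) T)
      (B : Matrix (Fin k) (Fin s) A), c = y * M + B.map (algebraMap A T) := by
    intro c
    choose r hr q hq using hw.exists_div
    obtain ⟨y, B, hy⟩ := exists_eq_mul_charmatrix_add τ (of fun i j ↦ r (c i j))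
    refine ⟨y.map (aeval t) + (of fun i j ↦ q (c i j)) * G.map (aeval t), B, ?_⟩
    have : c = (of fun i j ↦ r (c i j) : Matrix (Fin k) (Fin s) A[X]).map (aeval t) +
        aeval t w • (of fun i j ↦ q (c i j)) := by
      ext i j
      exact hq _
    conv_lhs => rw [this]
    rw [hy, Matrix.add_mul, Matrix.mul_assoc, hGM1, Matrix.map_add _ (map_add (aeval t)),
      Matrix.map_mul]
    have hB : (B.map C).map (aeval t) = B.map (algebraMap A T) := by
      ext1 i j; simp
    rw [hB]
    simp only [Matrix.mul_smul, Matrix.mul_one]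
    abel
  have hdivr : ∀ z : Fin s → T, ∃ (y : Fin s → T) (a : Fin s → A),
      z = M *ᵥ y + fun i ↦ algebraMap A T (a i) := by
    intro z
    choose r hr q hq using hw.exists_div
    obtain ⟨y, B, hy⟩ := exists_eq_charmatrix_mul_add τ
      (of fun i (_ : Unit) ↦ r (z i))
    refine ⟨(fun i ↦ aeval t (y i ())) + G.map (aeval t) *ᵥ (fun i ↦ q (z i)), fun i ↦ B i (), ?_⟩
    rw [mulVec_add, mulVec_mulVec, hGM2]
    ext i
    have h4 := congrArg (aeval t) (congrFun (congrFun hy i) ())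
    simp only [of_apply, Matrix.add_apply, map_add, map_apply, aeval_C, Matrix.mul_apply, map_sum,
      map_mul] at h4
    have h5 := hq (z i)
    rw [h4] at h5
    rw [h5]
    simp only [Pi.add_apply, smul_mulVec, one_mulVec, Pi.smul_apply, smul_eq_mul, mulVec,
      dotProduct, M, map_apply]
    ring
  -- The elements θ (t bⱼ) measure the failure of t b = b τ in P. Subtracting α(yⱼ) from bⱼ changes
  -- them by the columns of y M, leaving B over A; this is what makes the presentation of P a
  -- pencil.
  obtain ⟨y, B, hyB⟩ := hdivl (of fun i j ↦ θ (t • (b j : P)) i)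
  -- adjusted generators
  let p : Fin s → P := fun j ↦ b j - α (fun i ↦ y i j)
  have hep : ∀ j, e (p j) = b j := by
    intro j
    rw [map_sub, h2, sub_zero, heb]
  let γ : (Fin s → T) →ₗ[T] P := Fintype.linearCombination T p
  have hγ : ∀ z, γ z = ∑ j, z j • p j := fun z ↦ by simp [γ, Fintype.linearCombination_apply]
  let B' : Matrix (Fin k) (Fin s) T := B.map (algebraMap A T)
  have hsingle : ∀ j, γ (M *ᵥ Pi.single j 1) = α (B' *ᵥ Pi.single j 1) := by
    intro j
    have e1 : ∑ i, M i j • (b i : P) = α (θ (t • (b j : P))) := by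
      have := h1 (t • (b j : P))
      rw [htb] at this
      rw [eq_sub_of_add_eq' this]
      simp only [hM, sub_smul, Finset.sum_sub_distrib, ite_smul, zero_smul, algebraMap_smul]
      simp
    have e2 : ∑ i, M i j • α (fun l ↦ y l i) = α (fun l ↦ (y * M) l j) := by
      simp_rw [← map_smul]
      rw [← map_sum]
      congr 1
      ext l
      simp [Matrix.mul_apply, mul_comm]
    have e3 : θ (t • (b j : P)) = (fun l ↦ (y * M) l j) + fun l ↦ B' l j := by
      ext l
      exact congrFun (congrFun hyB l) j
    rw [hγ]
    have e4 : ∀ i, (M *ᵥ Pi.single j 1) i = M i j := fun i ↦ by simp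
    have e5 : B' *ᵥ Pi.single j 1 = fun l ↦ B' l j := by ext; simp
    simp only [e4, e5, p, smul_sub, Finset.sum_sub_distrib]
    rw [e1, e2, e3, map_add]
    abel
  have hγM : ∀ z, γ (M *ᵥ z) = α (B' *ᵥ z) := by
    have : γ ∘ₗ M.mulVecLin = α ∘ₗ B'.mulVecLin :=
      (Pi.basisFun T (Fin s)).ext fun j ↦ by simpa using hsingle j
    exact fun z ↦ LinearMap.congr_fun this z
  let E : Matrix (Fin s ⊕ Fin k) (Fin s) A := fromRows 1 0
  let F : Matrix (Fin s ⊕ Fin k) (Fin s) A := fromRows (-τ) (-B)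
  have hpen : pencil E F = fromRows (charmatrix τ) ((-B).map C) := by
    ext1 i j
    rcases i with i | i
    · by_cases h : i = j <;> simp [pencil, E, F, h, sub_eq_add_neg]
    · simp [pencil, E, F]
  let V : Matrix (Fin s ⊕ Fin k) (Fin s) T := (pencil E F).map (aeval t)
  have hV : V = fromRows M (-B') := by
    simp only [V, hpen]
    ext1 i j
    rcases i with i | i <;> simp [M, B']
  let q : ((Fin s ⊕ Fin k) → T) →ₗ[T] P :=
    γ ∘ₗ LinearMap.funLeft T T Sum.inl + α ∘ₗ LinearMap.funLeft T T Sum.inr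
  have hqx : ∀ x, q x = γ (fun i ↦ x (Sum.inl i)) + α (fun i ↦ x (Sum.inr i)) := fun x ↦ rfl
  have hVz : ∀ z, V *ᵥ z = Sum.elim (M *ᵥ z) (-(B' *ᵥ z)) := by
    intro z
    rw [hV, fromRows_mulVec, neg_mulVec]
  have hqV : ∀ z, q (V *ᵥ z) = 0 := by
    intro z
    rw [hqx, hVz]
    change γ (M *ᵥ z) + α (-(B' *ᵥ z)) = 0
    rw [hγM, map_neg, add_neg_cancel]
  have hVinj : ∀ z, V *ᵥ z = 0 → z = 0 := by
    intro z hz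
    rw [hVz] at hz
    have h5 : M *ᵥ z = 0 := by
      ext i
      exact congrFun hz (Sum.inl i)
    have h6 : G.map (aeval t) *ᵥ (M *ᵥ z) = 0 := by rw [h5, mulVec_zero]
    rw [mulVec_mulVec, hGM1] at h6
    ext i
    apply hw.eq_zero_of_mul_eq_zero
    have := congrFun h6 i
    simpa [smul_mulVec] using this
  -- Modulo M the first block of x becomes a vector a over A; applying e gives a relation between
  -- basis vectors, so a = 0, and injectivity of α determines the second block.
  have hker : ∀ x, q x = 0 → ∃ z, x = V *ᵥ z := by
    intro x hx
    obtain ⟨z, a, hz⟩ := hdivr (fun i ↦ x (Sum.inl i))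
    rw [hqx, hz, map_add, hγM] at hx
    have hγa : γ (fun i ↦ algebraMap A T (a i)) = ∑ i, a i • p i := by
      rw [hγ]; simp
    rw [hγa] at hx
    have h7 : ∑ i, a i • b i = 0 := by
      apply Subtype.ext
      have := congrArg e hx
      simpa [h2, hep] using this
    have ha : a = 0 := by
      ext i
      have := congrArg (fun c ↦ b.repr c i) h7
      simpa [Finsupp.single_apply] using this
    refine ⟨z, ?_⟩
    rw [ha] at hx hz
    have h8 : α (B' *ᵥ z + fun i ↦ x (Sum.inr i)) = 0 := by
      simpa [map_add] using hx
    have h9 := hα _ h8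
    rw [hVz]
    ext i
    rcases i with i | i
    · have := congrFun hz i
      simpa using this
    · have := congrFun h9 i
      simp only [Sum.elim_inr, Pi.neg_apply]
      exact eq_neg_of_add_eq_zero_right this
  have hsurj : Function.Surjective q := by
    intro x
    have hex : e x = ∑ i, b.repr ⟨e x, ⟨x, rfl⟩⟩ i • (b i : P) := by
      have := congrArg Subtype.val (b.sum_repr ⟨e x, ⟨x, rfl⟩⟩)
      rw [Submodule.coe_sum] at this
      exact this.symm
    have hbq : ∀ i, (b i : P) ∈ LinearMap.range q := by
      intro i
      refine ⟨Sum.elim (Pi.single i 1) (fun l ↦ y l i), ?_⟩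
      rw [hqx]
      change γ (Pi.single i 1) + α (fun l ↦ y l i) = b i
      simp [hγ, Pi.single_apply, ite_smul, p]
    have hαq : ∀ v, α v ∈ LinearMap.range q := by
      intro v
      refine ⟨Sum.elim 0 v, ?_⟩
      rw [hqx]
      change γ 0 + α v = α v
      simp
    change x ∈ LinearMap.range q
    rw [← h1 x, hex]
    refine add_mem (sum_mem fun i _ ↦ ?_) (hαq _)
    rw [← algebraMap_smul T]
    exact Submodule.smul_mem _ _ (hbq i)
  obtain ⟨L, hL⟩ := exists_leftInverse_of_injective hVinj q hker hqV hsurj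
  have hLp : ∃ L : Matrix (Fin s) (Fin s ⊕ Fin k) A[X], L * pencil E F = 1 := by
    refine exists_leftInverse_pencil_of_aeval hw (G := fromCols G 0) ?_ hL
    rw [hpen, fromCols_mul_fromRows, hG1, Matrix.zero_mul, add_zero]
  have hE : ∃ K : Matrix (Fin s) (Fin s ⊕ Fin k) A, K * E = 1 :=
    ⟨fromCols 1 0, by simp [E, fromCols_mul_fromRows]⟩
  have hc : Completable V := (completable_pencil hA hE hLp).map (aeval t : A[X] →ₐ[A] T).toRingHom
  exact hc.free_of_surjective q hker hqV hsurj

theorem free_of_matrix_factorization [IsDomain A] (hA : SplitsIdempotents A)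
    [Module.Finite T P] [Module.Projective T P] {t : T} {w : A[X]}
    (hw : IsWeierstrassDivisor t w) {k : ℕ} (α : (Fin k → T) →ₗ[T] P) (β : P →ₗ[T] (Fin k → T))
    (hαβ : ∀ x, α (β x) = aeval t w • x) (hβα : ∀ y, β (α y) = aeval t w • y) :
    Module.Free T P := by
  let _ : Module A P := Module.compHom P (algebraMap A T)
  have : IsScalarTower A T P := ⟨fun a x y ↦ by
    rw [Algebra.smul_def, mul_smul]; rfl⟩
  exact free_of_matrix_factorization_aux hA hw α β hαβ hβα

end MatrixFactorization

/-! ### Weierstrass division and preparation in complete ultrametric rings -/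

theorem IsUltrametricDist.norm_sub_le_max' {S : Type*} [SeminormedAddCommGroup S]
    [IsUltrametricDist S] (x y : S) : ‖x - y‖ ≤ max ‖x‖ ‖y‖ := by
  simpa [sub_eq_add_neg] using IsUltrametricDist.norm_add_le_max x (-y)

section Weierstrass

variable {A T : Type*} [NormedCommRing A] [CompleteSpace A] [NormedCommRing T] [CompleteSpace T]
  [IsUltrametricDist T] [Algebra A T] {D : ℕ} {t : T}

omit [CompleteSpace A] [CompleteSpace T] [IsUltrametricDist T] in
/-- The value of a polynomial of degree less than `D` with given coefficients. -/
noncomputable def evalCoeffs (t : T) (D : ℕ) : (Fin D → A) →ₗ[A] T :=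
  Fintype.linearCombination A fun i : Fin D ↦ t ^ (i : ℕ)

omit [CompleteSpace A] [CompleteSpace T] [IsUltrametricDist T] in
theorem evalCoeffs_apply (t : T) (a : Fin D → A) :
    evalCoeffs t D a = ∑ i, algebraMap A T (a i) * t ^ (i : ℕ) := by
  simp [evalCoeffs, Fintype.linearCombination_apply, Algebra.smul_def]

omit [CompleteSpace A] [CompleteSpace T] [IsUltrametricDist T] in
theorem aeval_eq_evalCoeffs {r : A[X]} (hr : r ∈ degreeLT A D) :
    aeval t r = evalCoeffs t D fun i ↦ r.coeff i := by
  rw [evalCoeffs_apply, aeval_def, eval₂_eq_sum, ← sum_fin _ (by simp) (mem_degreeLT.mp hr)]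

/-- The map `(a, q) ↦ ∑ aᵢ tⁱ + f q`. -/
noncomputable def divMap (t : T) (D : ℕ) (f : T) : ((Fin D → A) × T) →+ T :=
  (evalCoeffs t D).toAddMonoidHom.comp (AddMonoidHom.fst _ _) +
    (AddMonoidHom.mulLeft f).comp (AddMonoidHom.snd _ _)

omit [CompleteSpace A] [CompleteSpace T] [IsUltrametricDist T] in
theorem divMap_apply (f : T) (a : Fin D → A) (q : T) :
    divMap t D f (a, q) = evalCoeffs t D a + f * q := rfl

/-- The norm estimate for division by an element `f` of norm at most `c`. -/
structure DivEstimate (A : Type*) [NormedCommRing A] [Algebra A T] (t : T) (D : ℕ) (c : ℝ)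
    (f : T) : Prop where
  norm_le : ‖f‖ ≤ c
  le_norm : ∀ (a : Fin D → A) (q : T), c * ‖q‖ ≤ ‖evalCoeffs t D a + f * q‖

namespace DivEstimate

variable {c : ℝ} {f g : T}

omit [CompleteSpace A] [CompleteSpace T] in
theorem le_norm_left (h : DivEstimate A t D c f) (a : Fin D → A) (q : T) :
    ‖evalCoeffs t D a‖ ≤ ‖evalCoeffs t D a + f * q‖ := by
  have h1 : ‖f * q‖ ≤ ‖evalCoeffs t D a + f * q‖ :=
    (norm_mul_le _ _).trans
      ((mul_le_mul_of_nonneg_right h.norm_le (norm_nonneg _)).trans (h.le_norm a q))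
  have h2 : evalCoeffs t D a = (evalCoeffs t D a + f * q) - f * q := by abel
  conv_lhs => rw [h2]
  exact (IsUltrametricDist.norm_sub_le_max' _ _).trans (max_le le_rfl h1)

-- For q ≠ 0 the perturbation (g - f) q is strictly smaller than c ‖q‖, so by the ultrametric
-- inequality it cannot destroy a lower bound by c ‖q‖.
omit [CompleteSpace A] [CompleteSpace T] in
theorem of_norm_sub_lt (h : DivEstimate A t D c f) (hg : ‖g - f‖ < c) : DivEstimate A t D c g := by
  refine ⟨?_, fun a q ↦ ?_⟩
  · have : g = (g - f) + f := by abel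
    rw [this]
    exact (IsUltrametricDist.norm_add_le_max _ _).trans (max_le hg.le h.norm_le)
  · by_cases hq : q = 0
    · simp [hq]
    have h1 : ‖(g - f) * q‖ < c * ‖q‖ :=
      (norm_mul_le _ _).trans_lt (mul_lt_mul_of_pos_right hg (norm_pos_iff.mpr hq))
    have h2 := h.le_norm a q
    have h3 : evalCoeffs t D a + f * q = (evalCoeffs t D a + g * q) - (g - f) * q := by ring
    rw [h3] at h2
    rcases le_max_iff.mp (IsUltrametricDist.norm_sub_le_max' (evalCoeffs t D a + g * q)
      ((g - f) * q)) with h4 | h4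
    · exact h2.trans h4
    · exact absurd (h2.trans h4) (not_le.mpr h1)

/-- Remainder and quotient are both bounded by the value of `divMap`, and its source is complete.
Together with density this gives existence of division. -/
theorem isClosed_range [IsBoundedSMul A T] (hc : 0 < c) (h : DivEstimate A t D c f) {C : ℝ}
    (hC : ∀ a : Fin D → A, ‖a‖ ≤ C * ‖evalCoeffs t D a‖) :
    IsClosed (Set.range (divMap (A := A) t D f)) := by
  have hC0 : 0 ≤ max C c⁻¹ := le_max_of_le_right (inv_nonneg.mpr hc.le)
  have h1 : AntilipschitzWith ⟨max C c⁻¹, hC0⟩ (divMap (A := A) t D f) := by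
    refine AddMonoidHomClass.antilipschitz_of_bound _ ?_
    rintro ⟨a, q⟩
    rw [divMap_apply, Prod.norm_def]
    refine max_le ?_ ?_
    · refine (hC a).trans ?_
      exact (mul_le_mul_of_nonneg_right (le_max_left _ c⁻¹) (norm_nonneg _)).trans
        (mul_le_mul_of_nonneg_left (h.le_norm_left a q) hC0)
    · have h2 := h.le_norm a q
      have : ‖q‖ ≤ c⁻¹ * ‖evalCoeffs t D a + f * q‖ := by
        rw [inv_mul_eq_div, le_div_iff₀ hc, mul_comm]
        exact h2
      exact this.trans (mul_le_mul_of_nonneg_right (le_max_right _ _) (norm_nonneg _))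
  refine h1.isClosed_range (uniformContinuous_addMonoidHom_of_continuous ?_)
  have : (divMap (A := A) t D f : (Fin D → A) × T → T) =
      fun x ↦ (∑ i : Fin D, x.1 i • t ^ (i : ℕ)) + f * x.2 := by
    ext ⟨a, q⟩
    simp [divMap_apply, evalCoeffs, Fintype.linearCombination_apply]
  rw [this]
  fun_prop

-- Approximate division by f, reused for g, leaves an error smaller by a fixed factor θ < 1; the
-- error is then divided again.
omit [CompleteSpace A] [CompleteSpace T] in
theorem denseRange (hc : 0 < c) (h : DivEstimate A t D c f)
    (hd : DenseRange (divMap (A := A) t D f)) (hg : ‖g - f‖ < c) :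
    DenseRange (divMap (A := A) t D g) := by
  let θ := max (‖g - f‖ / c) (1 / 2)
  have hθ1 : θ < 1 := max_lt ((div_lt_one hc).mpr hg) (by norm_num)
  have hθ0 : 0 < θ := lt_max_of_lt_right (by norm_num)
  have step : ∀ x : T, ∃ y, ‖x - divMap (A := A) t D g y‖ ≤ θ * ‖x‖ := by
    intro x
    by_cases hx : x = 0
    · exact ⟨0, by simp [hx]⟩
    have hx' : 0 < ‖x‖ := norm_pos_iff.mpr hx
    obtain ⟨⟨a, q⟩, haq⟩ := hd.exists_dist_lt x (half_pos hx')
    rw [dist_eq_norm, divMap_apply] at haq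
    have h1 : ‖evalCoeffs t D a + f * q‖ ≤ ‖x‖ := by
      have : evalCoeffs t D a + f * q = x - (x - (evalCoeffs t D a + f * q)) := by abel
      rw [this]
      exact (IsUltrametricDist.norm_sub_le_max' _ _).trans (max_le le_rfl (haq.le.trans (by linarith)))
    have h2 : ‖q‖ ≤ ‖x‖ / c := by
      rw [le_div_iff₀ hc, mul_comm]
      exact (h.le_norm a q).trans h1
    refine ⟨(a, q), ?_⟩
    rw [divMap_apply]
    have : x - (evalCoeffs t D a + g * q) =
        (x - (evalCoeffs t D a + f * q)) - (g - f) * q := by ring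
    rw [this]
    refine (IsUltrametricDist.norm_sub_le_max' _ _).trans (max_le ?_ ?_)
    · have := mul_le_mul_of_nonneg_right (le_max_right (‖g - f‖ / c) (1 / 2)) hx'.le
      exact haq.le.trans (by simp only [θ]; linarith)
    · have h3 := mul_le_mul_of_nonneg_right (le_max_left (‖g - f‖ / c) (1 / 2)) hx'.le
      refine le_trans ?_ h3
      calc ‖(g - f) * q‖ ≤ ‖g - f‖ * ‖q‖ := norm_mul_le _ _
        _ ≤ ‖g - f‖ * (‖x‖ / c) := mul_le_mul_of_nonneg_left h2 (norm_nonneg _)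
        _ = _ := by ring
  have iter : ∀ (n : ℕ) (x : T), ∃ y, ‖x - divMap (A := A) t D g y‖ ≤ θ ^ n * ‖x‖ := by
    intro n
    induction n with
    | zero => exact fun x ↦ ⟨0, by simp⟩
    | succ n ih =>
      intro x
      obtain ⟨y, hy⟩ := ih x
      obtain ⟨z, hz⟩ := step (x - divMap (A := A) t D g y)
      refine ⟨y + z, ?_⟩
      rw [map_add, ← sub_sub]
      refine hz.trans ?_
      rw [pow_succ', mul_assoc]
      exact mul_le_mul_of_nonneg_left hy hθ0.le
  intro x
  rw [Metric.mem_closure_iff]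
  intro ε hε
  have hlim : Filter.Tendsto (fun n : ℕ ↦ θ ^ n * ‖x‖) Filter.atTop (nhds 0) := by
    simpa using (tendsto_pow_atTop_nhds_zero_of_lt_one hθ0.le hθ1).mul_const ‖x‖
  obtain ⟨n, hn⟩ := (hlim.eventually (gt_mem_nhds hε)).exists
  obtain ⟨y, hy⟩ := iter n x
  exact ⟨_, ⟨y, rfl⟩, by rw [dist_eq_norm]; exact hy.trans_lt hn⟩

/-- Weierstrass preparation: an element close to a monic polynomial `tᴰ + ∑ bᵢ tⁱ`, division by
which satisfies the norm estimate, divides the value of a monic polynomial, with unique division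
with remainder. -/
theorem exists_isWeierstrassDivisor [Nontrivial A] [IsBoundedSMul A T] (hc : 0 < c)
    (b : Fin D → A) (hf : f = t ^ D + evalCoeffs t D b) (h : DivEstimate A t D c f)
    (ht : ‖t ^ D‖ ≤ c) (hC : ∃ C : ℝ, ∀ a : Fin D → A, ‖a‖ ≤ C * ‖evalCoeffs t D a‖)
    (hd : DenseRange (divMap (A := A) t D f)) (hg : ‖g - f‖ < c) :
    ∃ w : A[X], IsWeierstrassDivisor t w ∧ ∃ q, aeval t w = g * q := by
  obtain ⟨C, hC⟩ := hC
  have hsurj : ∀ g', ‖g' - f‖ < c → ∀ x : T, ∃ (a : Fin D → A) (q : T),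
      x = evalCoeffs t D a + g' * q := by
    intro g' hg' x
    have h1 := (h.of_norm_sub_lt hg').isClosed_range hc hC
    have h2 := h.denseRange hc hd hg'
    obtain ⟨⟨a, q⟩, hx⟩ : x ∈ Set.range (divMap (A := A) t D g') := by
      rw [← h1.closure_eq]
      exact h2 x
    exact ⟨a, q, hx.symm⟩
  -- Dividing t ^ D by g exhibits the monic polynomial t ^ D - a as the multiple g q.
  obtain ⟨a, q, haq⟩ := hsurj g hg (t ^ D)
  let p := (degreeLTEquiv A D).symm (-a)
  have hp : (p : A[X]).degree < D := mem_degreeLT.mp p.2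
  have hpc : evalCoeffs t D (fun i ↦ (p : A[X]).coeff i) = -evalCoeffs t D a := by
    rw [← map_neg]
    congr 1
    exact (degreeLTEquiv A D).apply_symm_apply (-a)
  let w : A[X] := X ^ D + (p : A[X])
  have hwD : w.natDegree = D := by
    apply natDegree_eq_of_degree_eq_some
    rw [degree_add_eq_left_of_degree_lt] <;> simp [hp]
  have hwt : aeval t w = g * q := by
    simp only [w, map_add, map_pow, aeval_X]
    rw [aeval_eq_evalCoeffs p.2, hpc]
    conv_lhs => rw [haq]
    abel
  have hwt' : aeval t w - f = evalCoeffs t D (-(a + b)) := by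
    simp only [w, map_add, map_pow, aeval_X]
    rw [aeval_eq_evalCoeffs p.2, hpc, hf, map_neg, map_add]
    abel
  have hq : ‖q‖ ≤ 1 := by
    have h1 := (h.of_norm_sub_lt hg).le_norm a q
    rw [← haq] at h1
    exact le_of_mul_le_mul_left (by simpa using h1.trans ht) hc
  -- Dividing (g - f) q by f gives the remainder w(t) - f and the quotient 1 - q. So w(t) is as
  -- close to f as g is, and the same perturbation argument gives division by w(t).
  have hw : ‖aeval t w - f‖ < c := by
    have h1 := h.le_norm_left (-(a + b)) (1 - q)
    have h2 : evalCoeffs t D (-(a + b)) + f * (1 - q) = (g - f) * q := by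
      rw [← hwt', hwt]; ring
    rw [h2, ← hwt'] at h1
    refine h1.trans_lt (lt_of_le_of_lt ?_ hg)
    exact (norm_mul_le _ _).trans (mul_le_of_le_one_right (norm_nonneg _) hq)
  refine ⟨w, ⟨monic_X_pow_add hp, fun x ↦ ?_, fun r hr q hrq ↦ ?_⟩, q, hwt⟩
  · obtain ⟨a, q, hx⟩ := hsurj _ hw x
    refine ⟨(degreeLTEquiv A D).symm a, by rw [hwD]; exact Subtype.property _, q, ?_⟩
    rw [aeval_eq_evalCoeffs (Subtype.property _), hx]
    congr 2
    exact ((degreeLTEquiv A D).apply_symm_apply a).symm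
  · rw [hwD] at hr
    rw [aeval_eq_evalCoeffs hr] at hrq
    have h0 := h.of_norm_sub_lt hw
    have h1 := h0.le_norm _ q |>.trans_eq (congrArg norm hrq)
    have h2 := h0.le_norm_left _ q |>.trans_eq (congrArg norm hrq)
    rw [norm_zero] at h1 h2
    refine ⟨?_, ?_⟩
    · have h3 := hC (fun i ↦ r.coeff i)
      rw [le_antisymm h2 (norm_nonneg _), mul_zero] at h3
      have h4 := norm_le_zero_iff.mp h3
      have h5 : degreeLTEquiv A D ⟨r, hr⟩ = 0 := h4
      have := (LinearEquiv.map_eq_zero_iff _).mp h5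
      exact congrArg Subtype.val this
    · have : ‖q‖ ≤ 0 := le_of_mul_le_mul_left (by simpa using h1) hc
      exact norm_le_zero_iff.mp this

end DivEstimate

end Weierstrass

/-! ### The Gauss norm on Laurent polynomials -/

open Filter Topology
open scoped NNReal

/-- A positive multiplicative weight on a commutative additive group. -/
structure AddWeight (G : Type*) [AddCommGroup G] where
  /-- The weight of an element. -/
  toFun : G → ℝ
  pos : ∀ g, 0 < toFun g
  map_add : ∀ g h, toFun (g + h) = toFun g * toFun h

namespace AddWeight

variable {G : Type*} [AddCommGroup G]

instance : CoeFun (AddWeight G) fun _ ↦ G → ℝ := ⟨toFun⟩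

theorem map_zero (w : AddWeight G) : w 0 = 1 := by
  have h := w.map_add 0 0
  rw [add_zero] at h
  have := (w.pos 0).ne'
  field_simp at h
  exact h.symm

theorem map_nsmul (w : AddWeight G) (k : ℕ) (g : G) : w (k • g) = w g ^ k := by
  induction k with
  | zero => simp [w.map_zero]
  | succ k ih => rw [succ_nsmul, w.map_add, ih, pow_succ]

end AddWeight

/-- Laurent polynomials over `K` with exponents in `G`, carrying the Gauss norm. -/
def GaussPoly (K : Type*) [NormedField K] {G : Type*} [AddCommGroup G] (_w : AddWeight G) : Type _ :=
  AddMonoidAlgebra K G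

namespace GaussPoly

variable {K : Type*} [NormedField K] [IsUltrametricDist K] {G : Type*} [AddCommGroup G]
  {w : AddWeight G}

omit [IsUltrametricDist K] in
noncomputable instance : CommRing (GaussPoly K w) := inferInstanceAs (CommRing (AddMonoidAlgebra K G))

/-- The coefficients of a Laurent polynomial. -/
def coeff (f : GaussPoly K w) : G →₀ K := AddMonoidAlgebra.coeff f

/-- Monomials. -/
noncomputable def single (w : AddWeight G) (g : G) (c : K) : GaussPoly K w :=
  AddMonoidAlgebra.single g c

omit [IsUltrametricDist K] in
@[simp] theorem coeff_zero : coeff (0 : GaussPoly K w) = 0 := rfl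

omit [IsUltrametricDist K] in
@[simp] theorem coeff_add (f g : GaussPoly K w) : coeff (f + g) = coeff f + coeff g := rfl

omit [IsUltrametricDist K] in
@[simp] theorem coeff_neg (f : GaussPoly K w) : coeff (-f) = -coeff f := rfl

omit [IsUltrametricDist K] in
theorem coeff_single (g : G) (c : K) : coeff (single w g c) = Finsupp.single g c := rfl

omit [IsUltrametricDist K] in
theorem single_mul_single (g h : G) (c d : K) :
    single w g c * single w h d = single w (g + h) (c * d) :=
  AddMonoidAlgebra.single_mul_single ..

omit [IsUltrametricDist K] in
theorem coeff_single_mul (g h : G) (c : K) (f : GaussPoly K w) :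
    coeff (single w h c * f) g = c * coeff f (g - h) := by
  have := AddMonoidAlgebra.coeff_single_mul_apply (R := K) (G := G) f c h g
  rw [neg_add_eq_sub] at this
  exact this

omit [IsUltrametricDist K] in
theorem sum_single (f : GaussPoly K w) : ∑ g ∈ (coeff f).support, single w g (coeff f g) = f :=
  AddMonoidAlgebra.sum_coeff_single f

/-- The Gauss norm. -/
noncomputable def gaussNorm (f : GaussPoly K w) : ℝ≥0 :=
  (coeff f).support.sup fun g ↦ ‖coeff f g‖₊ * ⟨w g, (w.pos g).le⟩

omit [IsUltrametricDist K] in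
theorem gaussNorm_le_iff {f : GaussPoly K w} {C : ℝ} (hC : 0 ≤ C) :
    (gaussNorm f : ℝ) ≤ C ↔ ∀ g, ‖coeff f g‖ * w g ≤ C := by
  lift C to ℝ≥0 using hC
  rw [NNReal.coe_le_coe, gaussNorm, Finset.sup_le_iff]
  refine ⟨fun h g ↦ ?_, fun h g _ ↦ ?_⟩
  · by_cases hg : g ∈ (coeff f).support
    · exact_mod_cast h g hg
    · rw [Finsupp.notMem_support_iff.mp hg]; simp
  · exact_mod_cast h g

omit [IsUltrametricDist K] in
theorem le_gaussNorm (f : GaussPoly K w) (g : G) : ‖coeff f g‖ * w g ≤ gaussNorm f :=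
  (gaussNorm_le_iff (NNReal.coe_nonneg _)).mp le_rfl g

omit [IsUltrametricDist K] in
theorem gaussNorm_single_le (g : G) (c : K) : (gaussNorm (single w g c) : ℝ) ≤ ‖c‖ * w g := by
  rw [gaussNorm_le_iff (mul_nonneg (norm_nonneg _) (w.pos g).le)]
  classical
  intro h
  rw [coeff_single, Finsupp.single_apply]
  split_ifs with hgh
  · rw [hgh]
  · simpa using mul_nonneg (norm_nonneg _) (w.pos g).le

theorem gaussNorm_add_le (f g : GaussPoly K w) :
    (gaussNorm (f + g) : ℝ) ≤ max (gaussNorm f : ℝ) (gaussNorm g) := by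
  rw [gaussNorm_le_iff (le_max_of_le_left (NNReal.coe_nonneg _))]
  intro h
  have h1 := IsUltrametricDist.norm_add_le_max (coeff f h) (coeff g h)
  rw [coeff_add, Finsupp.add_apply]
  refine (mul_le_mul_of_nonneg_right h1 (w.pos h).le).trans ?_
  rw [max_mul_of_nonneg _ _ (w.pos h).le]
  exact max_le_max (le_gaussNorm f h) (le_gaussNorm g h)

theorem gaussNorm_sum_le {ι : Type*} (s : Finset ι) (f : ι → GaussPoly K w) {C : ℝ} (hC : 0 ≤ C)
    (h : ∀ i ∈ s, (gaussNorm (f i) : ℝ) ≤ C) : (gaussNorm (∑ i ∈ s, f i) : ℝ) ≤ C := by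
  classical
  induction s using Finset.induction_on with
  | empty => simpa [gaussNorm] using hC
  | insert a s ha ih =>
    rw [Finset.sum_insert ha]
    refine (gaussNorm_add_le _ _).trans (max_le (h a (by simp)) (ih fun i hi ↦ h i (by simp [hi])))

theorem gaussNorm_mul_le (f g : GaussPoly K w) :
    (gaussNorm (f * g) : ℝ) ≤ gaussNorm f * gaussNorm g := by
  have hC : (0 : ℝ) ≤ gaussNorm f * gaussNorm g :=
    mul_nonneg (NNReal.coe_nonneg _) (NNReal.coe_nonneg _)
  conv_lhs => rw [← sum_single f, ← sum_single g, Finset.sum_mul_sum]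
  refine gaussNorm_sum_le _ _ hC fun i _ ↦ gaussNorm_sum_le _ _ hC fun j _ ↦ ?_
  rw [single_mul_single]
  refine (gaussNorm_single_le _ _).trans ?_
  rw [norm_mul, w.map_add, mul_mul_mul_comm]
  exact mul_le_mul (le_gaussNorm f i) (le_gaussNorm g j)
    (mul_nonneg (norm_nonneg _) (w.pos j).le) (NNReal.coe_nonneg _)

/-- The Gauss norm as a ring norm. -/
noncomputable def gaussRingNorm : RingNorm (GaussPoly K w) where
  toFun f := gaussNorm f
  map_zero' := by simp [gaussNorm]
  add_le' f g := (gaussNorm_add_le f g).trans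
    (max_le_add_of_nonneg (NNReal.coe_nonneg _) (NNReal.coe_nonneg _))
  neg' f := by
    simp only [gaussNorm, coeff_neg, Finsupp.support_neg]
    simp
  mul_le' := gaussNorm_mul_le
  eq_zero_of_map_eq_zero' f hf := by
    refine AddMonoidAlgebra.coeff_injective (Finsupp.ext fun g ↦ ?_)
    have h1 := le_gaussNorm f g
    rw [hf] at h1
    have h2 : ‖coeff f g‖ ≤ 0 := le_of_mul_le_mul_right (by simpa using h1) (w.pos g)
    exact norm_le_zero_iff.mp h2

noncomputable instance : NormedCommRing (GaussPoly K w) :=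
  { gaussRingNorm.toNormedRing with mul_comm := mul_comm }

theorem norm_def (f : GaussPoly K w) : ‖f‖ = gaussNorm f := rfl

instance : IsUltrametricDist (GaussPoly K w) :=
  IsUltrametricDist.isUltrametricDist_of_forall_norm_add_le_max_norm gaussNorm_add_le

end GaussPoly

/-! ### Completed Laurent series and their coefficients -/

/-- The ring of Laurent series over `K` with exponents in `G` whose coefficients, multiplied by
the weights, tend to zero. -/
abbrev GaussRing (K : Type*) [NormedField K] [IsUltrametricDist K] {G : Type*} [AddCommGroup G]
    (w : AddWeight G) : Type _ :=
  UniformSpace.Completion (GaussPoly K w)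

instance UniformSpace.Completion.isUltrametricDist {E : Type*} [SeminormedAddCommGroup E]
    [IsUltrametricDist E] : IsUltrametricDist (UniformSpace.Completion E) := by
  refine IsUltrametricDist.isUltrametricDist_of_forall_norm_add_le_max_norm fun x y ↦ ?_
  induction x, y using UniformSpace.Completion.induction_on₂ with
  | hp => exact isClosed_le (by fun_prop) (by fun_prop)
  | ih a b =>
    rw [← UniformSpace.Completion.coe_add]
    simp only [UniformSpace.Completion.norm_coe]
    exact IsUltrametricDist.norm_add_le_max a b

namespace GaussRing

variable {K : Type*} [NormedField K] [IsUltrametricDist K] [CompleteSpace K] {G : Type*}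
  [AddCommGroup G] {w : AddWeight G}

/-- The coefficient of a polynomial as a bounded homomorphism. -/
noncomputable def polyCoeff (w : AddWeight G) (g : G) : NormedAddGroupHom (GaussPoly K w) K where
  toFun f := GaussPoly.coeff f g
  map_add' f h := by simp
  bound' := ⟨(w g)⁻¹, fun f ↦ by
    rw [inv_mul_eq_div, le_div_iff₀ (w.pos g)]
    exact GaussPoly.le_gaussNorm f g⟩

/-- The coefficient of a series. -/
noncomputable def coeff (g : G) : NormedAddGroupHom (GaussRing K w) K :=
  (polyCoeff w g).extension

/-- Monomials. -/
noncomputable def mono (w : AddWeight G) (g : G) (c : K) : GaussRing K w :=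
  (GaussPoly.single w g c : GaussPoly K w)

omit [CompleteSpace K] in
theorem mono_mul_mono (g h : G) (c d : K) : mono w g c * mono w h d = mono w (g + h) (c * d) := by
  rw [mono, mono, ← UniformSpace.Completion.coe_mul, GaussPoly.single_mul_single]
  rfl

omit [CompleteSpace K] in
theorem mono_zero_one : mono w 0 (1 : K) = 1 := rfl

omit [CompleteSpace K] in
theorem mono_pow (g : G) (c : K) (k : ℕ) : mono w g c ^ k = mono w (k • g) (c ^ k) := by
  induction k with
  | zero => simp [mono_zero_one]
  | succ k ih => rw [pow_succ, ih, mono_mul_mono, succ_nsmul, pow_succ]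

omit [CompleteSpace K] in
theorem mono_add (g : G) (c d : K) : mono w g (c + d) = mono w g c + mono w g d := by
  rw [mono, mono, mono, ← UniformSpace.Completion.coe_add]
  congr 1
  exact AddMonoidAlgebra.single_add ..

omit [CompleteSpace K] in
theorem mono_zero (g : G) : mono w g (0 : K) = 0 := by
  have := mono_add (w := w) g (0 : K) 0
  rw [add_zero] at this
  exact left_eq_add.mp this

theorem coeff_coe (f : GaussPoly K w) (g : G) : coeff g (f : GaussRing K w) = GaussPoly.coeff f g :=
  NormedAddGroupHom.extension_coe _ f

theorem continuous_coeff (g : G) : Continuous (coeff g : GaussRing K w → K) :=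
  (coeff g).continuous

theorem coeff_mono (g h : G) (c : K) [Decidable (h = g)] :
    coeff g (mono w h c) = if h = g then c else 0 := by
  rw [mono, coeff_coe, GaussPoly.coeff_single, Finsupp.single_apply]

theorem norm_coeff_le (x : GaussRing K w) (g : G) : ‖coeff g x‖ * w g ≤ ‖x‖ := by
  induction x using UniformSpace.Completion.induction_on with
  | hp =>
    have := continuous_coeff (w := w) (K := K) g
    exact isClosed_le (by fun_prop) (by fun_prop)
  | ih f =>
    rw [coeff_coe, UniformSpace.Completion.norm_coe]
    exact GaussPoly.le_gaussNorm f g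

omit [CompleteSpace K] in
theorem exists_coe_norm_sub_lt (x : GaussRing K w) {ε : ℝ} (hε : 0 < ε) :
    ∃ f : GaussPoly K w, ‖x - f‖ < ε := by
  obtain ⟨f, hf⟩ := UniformSpace.Completion.denseRange_coe.exists_dist_lt x hε
  exact ⟨f, by rwa [← dist_eq_norm]⟩

/-- Comparison with a Laurent polynomial within ε: after completion the norm is still the supremum
of the weighted coefficients. -/
theorem norm_le_of_forall {x : GaussRing K w} {C : ℝ} (hC : 0 ≤ C)
    (h : ∀ g, ‖coeff g x‖ * w g ≤ C) : ‖x‖ ≤ C := by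
  refine le_of_forall_pos_le_add fun ε hε ↦ ?_
  obtain ⟨f, hf⟩ := exists_coe_norm_sub_lt x hε
  have h1 : ‖(f : GaussRing K w)‖ ≤ max C ε := by
    rw [UniformSpace.Completion.norm_coe, GaussPoly.norm_def,
      GaussPoly.gaussNorm_le_iff (le_max_of_le_left hC)]
    intro g
    have h2 : GaussPoly.coeff f g = coeff g x - coeff g (x - (f : GaussRing K w)) := by
      rw [map_sub, coeff_coe]; abel
    rw [h2]
    refine (mul_le_mul_of_nonneg_right (IsUltrametricDist.norm_sub_le_max' _ _)
      (w.pos g).le).trans ?_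
    rw [max_mul_of_nonneg _ _ (w.pos g).le]
    exact max_le_max (h g) ((norm_coeff_le _ g).trans hf.le)
  have h3 : x = (x - f) + f := by abel
  rw [h3]
  refine (IsUltrametricDist.norm_add_le_max _ _).trans (max_le (hf.le.trans (by linarith)) ?_)
  exact h1.trans (max_le (by linarith) (by linarith))

theorem ext {x y : GaussRing K w} (h : ∀ g, coeff g x = coeff g y) : x = y := by
  rw [← sub_eq_zero, ← norm_le_zero_iff]
  exact norm_le_of_forall le_rfl fun g ↦ by simp [h g]

theorem norm_mono (g : G) (c : K) : ‖mono w g c‖ = ‖c‖ * w g := by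
  classical
  refine le_antisymm ?_ ?_
  · rw [mono, UniformSpace.Completion.norm_coe]
    exact GaussPoly.gaussNorm_single_le g c
  · simpa [coeff_mono] using norm_coeff_le (mono w g c) g

theorem finite_setOf_le (x : GaussRing K w) {ε : ℝ} (hε : 0 < ε) :
    {g | ε ≤ ‖coeff g x‖ * w g}.Finite := by
  obtain ⟨f, hf⟩ := exists_coe_norm_sub_lt x hε
  refine (GaussPoly.coeff f).support.finite_toSet.subset fun g hg ↦ ?_
  by_contra hgf
  have h1 : coeff g (x - (f : GaussRing K w)) = coeff g x := by
    rw [map_sub, coeff_coe, Finsupp.notMem_support_iff.mp hgf, sub_zero]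
  have h2 := (norm_coeff_le (x - (f : GaussRing K w)) g).trans_lt hf
  rw [h1] at h2
  exact absurd h2 (not_lt.mpr hg)

/-- Only finitely many weighted coefficients reach C / 2, so the supremum is attained or at most C /
2, and strictness survives. -/
theorem norm_lt_of_forall {x : GaussRing K w} {C : ℝ} (hC : 0 < C)
    (h : ∀ g, ‖coeff g x‖ * w g < C) : ‖x‖ < C := by
  have hfin := finite_setOf_le x (half_pos hC)
  rcases hfin.toFinset.eq_empty_or_nonempty with he | hne
  · refine (norm_le_of_forall (half_pos hC).le fun g ↦ ?_).trans_lt (half_lt_self hC)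
    by_contra! hg
    have : g ∈ hfin.toFinset := by simpa using hg.le
    simp [he] at this
  · obtain ⟨g₀, _, hg₀⟩ := Finset.exists_max_image _ (fun g ↦ ‖coeff g x‖ * w g) hne
    refine (norm_le_of_forall (C := max (C / 2) (‖coeff g₀ x‖ * w g₀))
      (le_max_of_le_left (half_pos hC).le) fun g ↦ ?_).trans_lt (max_lt (half_lt_self hC) (h g₀))
    by_cases hg : C / 2 ≤ ‖coeff g x‖ * w g
    · exact le_max_of_le_right (hg₀ g (by simpa using hg))
    · exact le_max_of_le_left (not_le.mp hg).le

theorem coeff_mono_mul (g h : G) (c : K) (x : GaussRing K w) :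
    coeff g (mono w h c * x) = c * coeff (g - h) x := by
  have h1 := continuous_coeff (w := w) (K := K) g
  have h2 := continuous_coeff (w := w) (K := K) (g - h)
  induction x using UniformSpace.Completion.induction_on with
  | hp => exact isClosed_eq (by fun_prop) (by fun_prop)
  | ih f =>
    rw [mono, ← UniformSpace.Completion.coe_mul, coeff_coe, coeff_coe, GaussPoly.coeff_single_mul]

theorem coeff_sum_mono [DecidableEq G] (s : Finset G) (c : G → K) (g : G) :
    coeff g (∑ h ∈ s, mono w h (c h)) = if g ∈ s then c g else 0 := by
  simp [map_sum, coeff_mono]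

theorem hasSum_mono (x : GaussRing K w) : HasSum (fun g ↦ mono w g (coeff g x)) x := by
  classical
  rw [HasSum, Metric.tendsto_nhds]
  intro ε hε
  simp only [SummationFilter.unconditional_filter]
  filter_upwards [eventually_ge_atTop (finite_setOf_le x hε).toFinset] with s hs
  rw [dist_comm, dist_eq_norm]
  refine norm_lt_of_forall hε fun g ↦ ?_
  rw [map_sub, coeff_sum_mono]
  split_ifs with hg
  · simpa using hε
  · rw [sub_zero]
    by_contra! hle
    exact hg (hs (by simpa using hle))

theorem hasSum_coeff_mul (x y : GaussRing K w) (g : G) :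
    HasSum (fun h ↦ coeff h x * coeff (g - h) y) (coeff g (x * y)) := by
  have h1 := ((hasSum_mono x).mul_right y).map (coeff g) (continuous_coeff g)
  simpa [Function.comp_def, coeff_mono_mul] using h1

theorem coeff_mul_eq_zero {x y : GaussRing K w} {g : G}
    (h : ∀ a, coeff a x ≠ 0 → coeff (g - a) y = 0) : coeff g (x * y) = 0 := by
  have h1 := hasSum_coeff_mul x y g
  have h2 : (fun a ↦ coeff a x * coeff (g - a) y) = fun _ ↦ 0 := by
    ext a
    by_cases ha : coeff a x = 0
    · rw [ha, zero_mul]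
    · rw [h a ha, mul_zero]
  rw [h2] at h1
  exact h1.unique hasSum_zero

/-- The subring of series supported on a submonoid. -/
noncomputable def supported (K : Type*) [NormedField K] [IsUltrametricDist K] [CompleteSpace K]
    (w : AddWeight G) (S : AddSubmonoid G) : Subring (GaussRing K w) where
  carrier := {x | ∀ g ∉ S, coeff g x = 0}
  zero_mem' g _ := map_zero _
  add_mem' {x y} hx hy g hg := by rw [map_add, hx g hg, hy g hg, add_zero]
  neg_mem' {x} hx g hg := by rw [map_neg, hx g hg, neg_zero]
  one_mem' g hg := by
    classical
    rw [← mono_zero_one, coeff_mono, if_neg]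
    rintro rfl
    exact hg S.zero_mem
  mul_mem' {x y} hx hy g hg := by
    refine coeff_mul_eq_zero fun a ha ↦ hy _ fun hga ↦ hg ?_
    have haS : a ∈ S := by
      by_contra h
      exact ha (hx a h)
    simpa using S.add_mem haS hga

theorem mem_supported {S : AddSubmonoid G} {x : GaussRing K w} :
    x ∈ supported K w S ↔ ∀ g ∉ S, coeff g x = 0 := Iff.rfl

theorem mono_mem_supported {S : AddSubmonoid G} {g : G} (hg : g ∈ S) (c : K) :
    mono w g c ∈ supported K w S := by
  classical
  intro h hh
  rw [coeff_mono, if_neg]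
  rintro rfl
  exact hh hg

theorem supported_mono {S S' : AddSubmonoid G} (h : S ≤ S') :
    supported K w S ≤ supported K w S' :=
  fun _ hx g hg ↦ hx g fun hg' ↦ hg (h hg')

theorem isClosed_supported (S : AddSubmonoid G) :
    IsClosed (supported K w S : Set (GaussRing K w)) := by
  have : (supported K w S : Set (GaussRing K w)) = ⋂ g ∈ (S : Set G)ᶜ, {x | coeff g x = 0} := by
    ext x
    simp [mem_supported]
  rw [this]
  exact isClosed_biInter fun g _ ↦ isClosed_eq (continuous_coeff g) continuous_const

instance (S : AddSubmonoid G) : CompleteSpace (supported K w S) :=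
  (isClosed_supported S).completeSpace_coe

/-- Finite sums of monomials approximate a series, keeping the support. -/
theorem exists_sum_mono_norm_sub_lt {S : AddSubmonoid G} {x : GaussRing K w}
    (hx : x ∈ supported K w S) {ε : ℝ} (hε : 0 < ε) :
    ∃ s : Finset G, (∀ g ∈ s, g ∈ S) ∧ ‖x - ∑ g ∈ s, mono w g (coeff g x)‖ < ε := by
  classical
  refine ⟨(finite_setOf_le x hε).toFinset, fun g hg ↦ ?_, norm_lt_of_forall hε fun g ↦ ?_⟩
  · by_contra hgS
    have h1 : ε ≤ ‖coeff g x‖ * w g := by simpa using hg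
    rw [hx g hgS, norm_zero, zero_mul] at h1
    linarith
  · rw [map_sub, coeff_sum_mono]
    split_ifs with hg
    · simpa using hε
    · rw [sub_zero]
      by_contra! hle
      exact hg (by simpa using hle)

/-! ### Dominant exponents and absence of zero divisors -/

/-- The set of exponents at which the Gauss norm is attained. -/
noncomputable def maxSet (x : GaussRing K w) : Set G := {g | ‖coeff g x‖ * w g = ‖x‖}

theorem finite_maxSet {x : GaussRing K w} (hx : x ≠ 0) : (maxSet x).Finite :=
  (finite_setOf_le x (norm_pos_iff.mpr hx)).subset fun _ hg ↦ Eq.ge hg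

theorem maxSet_nonempty {x : GaussRing K w} (hx : x ≠ 0) : (maxSet x).Nonempty := by
  by_contra h
  rw [Set.not_nonempty_iff_eq_empty] at h
  refine lt_irrefl ‖x‖ (norm_lt_of_forall (norm_pos_iff.mpr hx) fun g ↦ ?_)
  refine lt_of_le_of_ne (norm_coeff_le x g) fun hg ↦ ?_
  have : g ∈ maxSet x := hg
  simp [h] at this

theorem lt_of_notMem_maxSet {x : GaussRing K w} {g : G} (hg : g ∉ maxSet x) :
    ‖coeff g x‖ * w g < ‖x‖ :=
  lt_of_le_of_ne (norm_coeff_le x g) hg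

theorem coeff_ne_zero_of_mem_maxSet {x : GaussRing K w} (hx : x ≠ 0) {g : G} (hg : g ∈ maxSet x) :
    coeff g x ≠ 0 := by
  intro h
  have h1 : ‖coeff g x‖ * w g = ‖x‖ := hg
  rw [h, norm_zero, zero_mul] at h1
  exact hx (norm_eq_zero.mp h1.symm)

/-- If `σ₀` is the unique exponent of a sum of monomials of norm at most `M` at which an additive
function is maximal, then multiplication by it multiplies a suitable extremal coefficient by `M`. -/
theorem norm_coeff_sum_mono_mul {s : Finset G} {c : G → K} {M : ℝ} (hM : 0 < M)
    (hs : ∀ σ ∈ s, ‖c σ‖ * w σ ≤ M) {σ₀ : G} (hσ₀ : σ₀ ∈ s) (hσ₀M : ‖c σ₀‖ * w σ₀ = M)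
    (l : G →+ ℤ) (hl : ∀ σ ∈ s, σ ≠ σ₀ → l σ < l σ₀) {q : GaussRing K w} (hq : q ≠ 0) :
    ∃ g₀ ∈ maxSet q, (∀ g ∈ maxSet q, l g ≤ l g₀) ∧
      ‖coeff (σ₀ + g₀) ((∑ σ ∈ s, mono w σ (c σ)) * q)‖ * w (σ₀ + g₀) = M * ‖q‖ := by
  classical
  obtain ⟨g₀, hg₀, hmax⟩ := Set.exists_max_image _ l (finite_maxSet hq) (maxSet_nonempty hq)
  refine ⟨g₀, hg₀, hmax, ?_⟩
  have hq0 : 0 < ‖q‖ := norm_pos_iff.mpr hq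
  have h1 : coeff (σ₀ + g₀) ((∑ σ ∈ s, mono w σ (c σ)) * q) =
      c σ₀ * coeff g₀ q + ∑ σ ∈ s.erase σ₀, c σ * coeff (σ₀ + g₀ - σ) q := by
    rw [Finset.sum_mul, map_sum]
    simp only [coeff_mono_mul]
    rw [← Finset.add_sum_erase _ _ hσ₀, add_sub_cancel_left]
  have h2 : ‖c σ₀ * coeff g₀ q‖ * w (σ₀ + g₀) = M * ‖q‖ := by
    have : ‖coeff g₀ q‖ * w g₀ = ‖q‖ := hg₀
    rw [norm_mul, w.map_add, mul_mul_mul_comm, hσ₀M, this]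
  have h3 : ‖∑ σ ∈ s.erase σ₀, c σ * coeff (σ₀ + g₀ - σ) q‖ < ‖c σ₀ * coeff g₀ q‖ := by
    have hpos : 0 < ‖c σ₀ * coeff g₀ q‖ := by
      by_contra! h
      have := mul_nonpos_of_nonpos_of_nonneg h (w.pos (σ₀ + g₀)).le
      rw [h2] at this
      exact absurd this (not_le.mpr (mul_pos hM hq0))
    rcases (s.erase σ₀).eq_empty_or_nonempty with he | hne
    · rw [he]; simpa using hpos
    obtain ⟨σ, hσ, hle⟩ := IsUltrametricDist.exists_norm_finsetSum_le_of_nonempty hne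
      (fun σ ↦ c σ * coeff (σ₀ + g₀ - σ) q)
    refine hle.trans_lt ?_
    obtain ⟨hne', hσs⟩ := Finset.mem_erase.mp hσ
    refine lt_of_mul_lt_mul_right ?_ (w.pos (σ₀ + g₀)).le
    rw [h2]
    -- Here l exceeds its maximum l g₀ on `maxSet q`, so this coefficient of q is not dominant.
    have h4 : σ₀ + g₀ - σ ∉ maxSet q := by
      intro h
      have := hmax _ h
      have := hl σ hσs hne'
      simp only [map_sub, map_add] at *
      omega
    have h5 : w (σ₀ + g₀) = w σ * w (σ₀ + g₀ - σ) := by rw [← w.map_add]; congr 1; abel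
    rw [norm_mul, h5, mul_mul_mul_comm]
    exact mul_lt_mul' (hs σ hσs) (lt_of_notMem_maxSet h4)
      (mul_nonneg (norm_nonneg _) (w.pos _).le) hM
  rw [h1, IsUltrametricDist.norm_add_eq_max_of_norm_ne_norm h3.ne', max_eq_left h3.le, h2]

/-- The sum of the monomials of maximal norm. -/
noncomputable def maxPart {x : GaussRing K w} (hx : x ≠ 0) : GaussRing K w :=
  ∑ g ∈ (finite_maxSet hx).toFinset, mono w g (coeff g x)

theorem norm_sub_maxPart_lt {x : GaussRing K w} (hx : x ≠ 0) : ‖x - maxPart hx‖ < ‖x‖ := by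
  classical
  refine norm_lt_of_forall (norm_pos_iff.mpr hx) fun g ↦ ?_
  rw [maxPart, map_sub, coeff_sum_mono]
  split_ifs with hg
  · simpa using hx
  · rw [sub_zero]
    exact lt_of_notMem_maxSet (by simpa using hg)

/-- Additive functions to `ℤ` separate finite sets. -/
def SeparatesFinite (G : Type*) [AddCommGroup G] : Prop :=
  ∀ s : Set G, s.Finite → ∃ l : G →+ ℤ, Set.InjOn l s

/-- Read g as the polynomial Σ gᵢ xⁱ and evaluate at an integer N that is a root of none of the
finitely many nonzero differences. -/
theorem separatesFinite_pi (n : ℕ) : SeparatesFinite (Fin n → ℤ) := by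
  classical
  intro s hs
  let P : (Fin n → ℤ) → Polynomial ℤ := fun g ↦ ∑ i : Fin n, Polynomial.monomial (i : ℕ) (g i)
  have hP : ∀ g, P g = 0 → g = 0 := by
    intro g hg
    ext i
    have := congrArg (fun p ↦ Polynomial.coeff p i) hg
    simpa [P, Polynomial.finsetSum_coeff, Polynomial.coeff_monomial, Fin.val_inj] using this
  let t := hs.toFinset
  let F : Polynomial ℤ := ∏ gh ∈ (t ×ˢ t).filter (fun gh ↦ gh.1 ≠ gh.2), P (gh.1 - gh.2)
  have hF : F ≠ 0 := by
    refine Finset.prod_ne_zero_iff.mpr fun gh hgh h0 ↦ ?_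
    exact (Finset.mem_filter.mp hgh).2 (sub_eq_zero.mp (hP _ h0))
  obtain ⟨N, hN⟩ : ∃ N, F.eval N ≠ 0 := by
    by_contra! h
    exact hF (Polynomial.funext fun r ↦ by simpa using h r)
  refine ⟨AddMonoidHom.mk' (fun g ↦ (P g).eval N) fun g h ↦ ?_, fun g hg h hh hgh ↦ ?_⟩
  · simp [P, Polynomial.eval_finsetSum, Finset.sum_add_distrib]
  · by_contra hne
    apply hN
    rw [Polynomial.eval_prod]
    refine Finset.prod_eq_zero (i := (g, h)) (by simp [t, hg, hh, hne]) ?_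
    have hgh' : (P g).eval N = (P h).eval N := hgh
    have : P (g - h) = P g - P h := by
      simp [P, Finset.sum_sub_distrib]
    simp [this, hgh']

theorem norm_mul_lower_bound {s : Finset G} {c : G → K} {M : ℝ} (hM : 0 < M)
    (hs : ∀ σ ∈ s, ‖c σ‖ * w σ ≤ M) {σ₀ : G} (hσ₀ : σ₀ ∈ s) (hσ₀M : ‖c σ₀‖ * w σ₀ = M)
    (l : G →+ ℤ) (hl : ∀ σ ∈ s, σ ≠ σ₀ → l σ < l σ₀) (q : GaussRing K w) :
    M * ‖q‖ ≤ ‖(∑ σ ∈ s, mono w σ (c σ)) * q‖ := by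
  by_cases hq : q = 0
  · simp [hq]
  obtain ⟨g₀, _, _, h⟩ := norm_coeff_sum_mono_mul hM hs hσ₀ hσ₀M l hl hq
  rw [← h]
  exact norm_coeff_le _ _

instance : Nontrivial (GaussRing K w) := ⟨⟨0, 1, fun h ↦ by
  have := norm_mono (K := K) (w := w) 0 1
  rw [mono_zero_one, ← h] at this
  simp [w.map_zero] at this⟩⟩

/-- A function l injective on the dominant exponents singles out a top term, so multiplying y by the
dominant part of x gives norm at least ‖x‖ ‖y‖. The rest of x is strictly smaller and cannot cancel
this. -/
theorem isDomain (hG : SeparatesFinite G) : IsDomain (GaussRing K w) := by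
  have : NoZeroDivisors (GaussRing K w) := by
    refine ⟨fun {x y} hxy ↦ ?_⟩
    by_contra! h
    obtain ⟨hx, hy⟩ := h
    have hx0 : 0 < ‖x‖ := norm_pos_iff.mpr hx
    have hy0 : 0 < ‖y‖ := norm_pos_iff.mpr hy
    obtain ⟨l, hl⟩ := hG _ (finite_maxSet hx)
    obtain ⟨σ₀, hσ₀, hmax⟩ := Set.exists_max_image _ l (finite_maxSet hx) (maxSet_nonempty hx)
    have h1 := norm_mul_lower_bound (w := w) (s := (finite_maxSet hx).toFinset)
      (c := fun g ↦ coeff g x) hx0 (fun σ _ ↦ norm_coeff_le x σ) (by simpa using hσ₀) hσ₀ l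
      (fun σ hσ hne ↦ lt_of_le_of_ne (hmax σ (by simpa using hσ))
        fun h ↦ hne (hl (by simpa using hσ) hσ₀ h)) y
    have h2 : maxPart hx * y = -((x - maxPart hx) * y) := by
      rw [sub_mul, hxy]; abel
    have h3 : ‖maxPart hx * y‖ < ‖x‖ * ‖y‖ := by
      rw [h2, norm_neg]
      exact (norm_mul_le _ _).trans_lt (mul_lt_mul_of_pos_right (norm_sub_maxPart_lt hx) hy0)
    exact absurd h1 (not_le.mpr h3)
  exact NoZeroDivisors.to_isDomain _

end GaussRing

/-! ### Weierstrass preparation for series -/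

namespace GaussRing

variable {K : Type*} [NormedField K] [IsUltrametricDist K] [CompleteSpace K] {G : Type*}
  [AddCommGroup G] {w : AddWeight G}

/-- The elements of a submonoid killed by an additive function. -/
def slice (S : AddSubmonoid G) (l : G →+ ℤ) : AddSubmonoid G := S ⊓ AddMonoidHom.mker l

theorem mem_slice {S : AddSubmonoid G} {l : G →+ ℤ} {g : G} : g ∈ slice S l ↔ g ∈ S ∧ l g = 0 :=
  Iff.rfl

theorem slice_le (S : AddSubmonoid G) (l : G →+ ℤ) : slice S l ≤ S := fun _ h ↦ h.1

noncomputable instance (S : AddSubmonoid G) (l : G →+ ℤ) :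
    Algebra (supported K w (slice S l)) (supported K w S) :=
  (Subring.inclusion (supported_mono (slice_le S l))).toAlgebra

theorem coe_algebraMap {S : AddSubmonoid G} {l : G →+ ℤ} (a : supported K w (slice S l)) :
    ((algebraMap (supported K w (slice S l)) (supported K w S) a : supported K w S) :
      GaussRing K w) = a := rfl

instance (S : AddSubmonoid G) (l : G →+ ℤ) :
    IsBoundedSMul (supported K w (slice S l)) (supported K w S) :=
  IsBoundedSMul.of_norm_smul_le fun a x ↦ by
    rw [Algebra.smul_def]
    exact norm_mul_le _ _

/-- A monomial as an element of the ring of series supported on `S`. -/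
noncomputable def monoOf (w : AddWeight G) {S : AddSubmonoid G} {g : G} (hg : g ∈ S) (c : K) :
    supported K w S :=
  ⟨mono w g c, mono_mem_supported hg c⟩

theorem coe_monoOf {S : AddSubmonoid G} {g : G} (hg : g ∈ S) (c : K) :
    (monoOf w hg c : GaussRing K w) = mono w g c := rfl

section Slice

variable {S : AddSubmonoid G} {l : G →+ ℤ} {v : G} (hv : v ∈ S) {D : ℕ}

theorem coe_monoOf_pow (i : ℕ) :
    ((monoOf w hv (1 : K) ^ i : supported K w S) : GaussRing K w) = mono w (i • v) 1 := by
  rw [Subring.coe_pow, coe_monoOf, mono_pow, one_pow]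

theorem coeff_evalCoeffs (a : Fin D → supported K w (slice S l)) (g : G) :
    coeff g (evalCoeffs (monoOf w hv (1 : K)) D a : GaussRing K w) =
      ∑ i : Fin D, coeff (g - (i : ℕ) • v) (a i : GaussRing K w) := by
  rw [evalCoeffs_apply, AddSubmonoidClass.coe_finsetSum, map_sum]
  refine Finset.sum_congr rfl fun i _ ↦ ?_
  rw [Subring.coe_mul, coe_monoOf_pow, coe_algebraMap, mul_comm, coeff_mono_mul, one_mul]

theorem coeff_evalCoeffs_eq_zero (a : Fin D → supported K w (slice S l)) {g : G}
    (hg : ∀ i < D, l g ≠ i * l v) :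
    coeff g (evalCoeffs (monoOf w hv (1 : K)) D a : GaussRing K w) = 0 := by
  rw [coeff_evalCoeffs]
  refine Finset.sum_eq_zero fun i _ ↦ (a i).2 _ fun h ↦ hg i i.2 ?_
  have := (mem_slice.mp h).2
  rw [map_sub, map_nsmul, sub_eq_zero] at this
  simpa using this

theorem coeff_add_evalCoeffs (hd : 0 < l v) (a : Fin D → supported K w (slice S l)) {g : G}
    (hg : g ∈ slice S l) (i : Fin D) :
    coeff (g + (i : ℕ) • v) (evalCoeffs (monoOf w hv (1 : K)) D a : GaussRing K w) =
      coeff g (a i : GaussRing K w) := by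
  rw [coeff_evalCoeffs, Finset.sum_eq_single i]
  · simp
  · intro j _ hj
    refine (a j).2 _ fun h ↦ hj ?_
    have h1 := (mem_slice.mp h).2
    rw [map_sub, map_add, (mem_slice.mp hg).2, map_nsmul, map_nsmul, zero_add, sub_eq_zero,
      nsmul_eq_mul, nsmul_eq_mul] at h1
    have h2 := mul_right_cancel₀ hd.ne' h1
    exact Fin.ext (by exact_mod_cast h2.symm)
  · simp

/-- As l v > 0, the terms aᵢ tⁱ have disjoint supports, so the coefficients of aᵢ are read off at g
+ i v. The sum of the inverse weights merely bounds each of them. -/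
theorem exists_norm_le_evalCoeffs (hd : 0 < l v) :
    ∃ C : ℝ, ∀ a : Fin D → supported K w (slice S l),
      ‖a‖ ≤ C * ‖evalCoeffs (monoOf w hv (1 : K)) D a‖ := by
  have hpos : ∀ i : Fin D, 0 < (w v ^ (i : ℕ))⁻¹ := fun i ↦ inv_pos.mpr (pow_pos (w.pos v) _)
  have hC : 0 ≤ ∑ i : Fin D, (w v ^ (i : ℕ))⁻¹ := Finset.sum_nonneg fun i _ ↦ (hpos i).le
  refine ⟨∑ i : Fin D, (w v ^ (i : ℕ))⁻¹, fun a ↦ ?_⟩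
  refine (pi_norm_le_iff_of_nonneg (mul_nonneg hC (norm_nonneg _))).mpr fun i ↦ ?_
  refine le_trans ?_ (mul_le_mul_of_nonneg_right (Finset.single_le_sum
    (f := fun i : Fin D ↦ (w v ^ (i : ℕ))⁻¹) (fun i _ ↦ (hpos i).le) (Finset.mem_univ i))
    (norm_nonneg _))
  refine norm_le_of_forall (x := (a i : GaussRing K w))
    (mul_nonneg (hpos i).le (norm_nonneg _)) fun g ↦ ?_
  by_cases hg : g ∈ slice S l
  · rw [← coeff_add_evalCoeffs hv hd a hg i, inv_mul_eq_div, le_div_iff₀ (pow_pos (w.pos v) _),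
      mul_assoc, ← w.map_nsmul, ← w.map_add]
    exact norm_coeff_le _ _
  · rw [(a i).2 g hg, norm_zero, zero_mul]
    exact mul_nonneg (hpos i).le (norm_nonneg _)

/-- The norm estimate for a sum of monomials with a unique top term `t ^ D` and, unless the
exponents in `S` are nonnegative, a unique bottom term. -/
theorem divEstimate (hd : 0 < l v) {s : Finset G} {c : G → K}
    (hs : ∀ σ ∈ s, ‖c σ‖ * w σ ≤ w (D • v)) (hD : D • v ∈ s) (hcD : c (D • v) = 1)
    (htop : ∀ σ ∈ s, σ ≠ D • v → l σ < l (D • v))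
    (hbot : (∀ g ∈ S, 0 ≤ l g) ∨ ∃ σ₁ ∈ s, l σ₁ = 0 ∧ ‖c σ₁‖ * w σ₁ = w (D • v) ∧
      ∀ σ ∈ s, σ ≠ σ₁ → 0 < l σ) {f : supported K w S}
    (hf : (f : GaussRing K w) = ∑ σ ∈ s, mono w σ (c σ)) :
    DivEstimate (supported K w (slice S l)) (monoOf w hv (1 : K)) D (w (D • v)) f := by
  have hM := w.pos (D • v)
  refine ⟨?_, fun a q ↦ ?_⟩
  · change ‖(f : GaussRing K w)‖ ≤ _
    rw [hf]
    exact IsUltrametricDist.norm_sum_le_of_forall_le_of_nonneg hM.le fun σ hσ ↦ by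
      rw [norm_mono]; exact hs σ hσ
  by_cases hq : q = 0
  · simp [hq]
  have hq' : (q : GaussRing K w) ≠ 0 := fun h ↦ hq (Subtype.ext h)
  have key : ∀ g, (∀ i < D, l g ≠ i * l v) →
      ‖coeff g ((∑ σ ∈ s, mono w σ (c σ)) * (q : GaussRing K w))‖ * w g =
        w (D • v) * ‖(q : GaussRing K w)‖ →
      w (D • v) * ‖q‖ ≤ ‖evalCoeffs (monoOf w hv (1 : K)) D a + f * q‖ := by
    intro g hg h
    have h1 := norm_coeff_le
      ((evalCoeffs (monoOf w hv (1 : K)) D a + f * q : supported K w S) : GaussRing K w) g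
    have h2 : coeff g ((evalCoeffs (monoOf w hv (1 : K)) D a + f * q : supported K w S) :
        GaussRing K w) = coeff g ((∑ σ ∈ s, mono w σ (c σ)) * (q : GaussRing K w)) := by
      rw [Subring.coe_add, map_add, coeff_evalCoeffs_eq_zero hv a hg, zero_add, Subring.coe_mul,
        hf]
    rw [h2, h] at h1
    exact h1
  -- A remainder has l-values i l v with 0 ≤ i < D only. If l g₀ ≥ 0, the top term of f gives a
  -- dominant exponent of f q above this range; otherwise the bottom term gives one below it. The
  -- remainder cannot cancel either.
  obtain ⟨g₀, hg₀, hmax, h0⟩ := norm_coeff_sum_mono_mul hM hs hD (by simp [hcD]) l htop hq'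
  by_cases hl : 0 ≤ l g₀
  · refine key _ (fun i hi h ↦ ?_) h0
    rw [map_add, map_nsmul, nsmul_eq_mul] at h
    have : (i : ℤ) < D := by exact_mod_cast hi
    nlinarith
  · rcases hbot with hbot | ⟨σ₁, hσ₁, hl₁, hc₁, hbot⟩
    · have : g₀ ∈ S := by
        by_contra h
        exact coeff_ne_zero_of_mem_maxSet hq' hg₀ (q.2 _ h)
      exact absurd (hbot _ this) hl
    · obtain ⟨g₁, hg₁, hmax₁, h1⟩ := norm_coeff_sum_mono_mul hM hs hσ₁ hc₁ (-l)
        (fun σ hσ hne ↦ by simpa [hl₁] using hbot σ hσ hne) hq'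
      refine key _ (fun i hi h ↦ ?_) h1
      have h2 := hmax₁ _ hg₀
      rw [map_add, hl₁, zero_add] at h
      simp only [AddMonoidHom.neg_apply, neg_le_neg_iff] at h2
      have : 0 ≤ (i : ℤ) * l v := by positivity
      omega

/-- Polynomials in `t`, modulo a monic polynomial with invertible constant term, are dense. -/
theorem denseRange_divMap (hd : 0 < l v)
    (hdec : ∀ g ∈ S, ∃ k : ℤ, g - k • v ∈ slice S l)
    (hbot : (∀ g ∈ S, 0 ≤ l g) ∨ -v ∈ S) (f : supported K w S)
    (b : Fin D → supported K w (slice S l))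
    (hf : f = monoOf w hv (1 : K) ^ D + evalCoeffs (monoOf w hv (1 : K)) D b)
    (hb : (∀ g ∈ S, 0 ≤ l g) ∨ ∀ h : 0 < D, IsUnit (b ⟨0, h⟩)) :
    DenseRange (divMap (A := supported K w (slice S l)) (monoOf w hv (1 : K)) D f) := by
  set t : supported K w S := monoOf w hv (1 : K) with ht
  -- W is the image of `divMap`. It turns out stable under t, and under t⁻¹ if that lies in the
  -- ring; so it contains all monomials, whose sums are dense.
  let W : Submodule (supported K w (slice S l)) (supported K w S) :=
    LinearMap.range (evalCoeffs (A := supported K w (slice S l)) t D) ⊔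
      LinearMap.range (LinearMap.mulLeft (supported K w (slice S l)) f)
  have hfW : ∀ q, f * q ∈ W := fun q ↦ (le_sup_right : _ ≤ W) ⟨q, rfl⟩
  have heW : ∀ a, evalCoeffs t D a ∈ W := fun a ↦ (le_sup_left : _ ≤ W) ⟨a, rfl⟩
  have hlt : ∀ i < D, t ^ i ∈ W := by
    intro i hi
    have := heW (Pi.single ⟨i, hi⟩ 1)
    rwa [evalCoeffs, Fintype.linearCombination_apply_single, one_smul] at this
  have hWrange : ∀ x ∈ W, x ∈ Set.range (divMap (A := supported K w (slice S l)) t D f) := by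
    intro x hx
    obtain ⟨_, ⟨a, rfl⟩, _, ⟨q, rfl⟩, rfl⟩ := Submodule.mem_sup.mp hx
    exact ⟨(a, q), rfl⟩
  have hind : ∀ u, (∀ i < D, u * t ^ i ∈ W) → ∀ x ∈ W, u * x ∈ W := by
    intro u hu x hx
    obtain ⟨_, ⟨a, rfl⟩, _, ⟨q, rfl⟩, rfl⟩ := Submodule.mem_sup.mp hx
    rw [mul_add]
    refine W.add_mem ?_ ?_
    · rw [evalCoeffs_apply, Finset.mul_sum]
      refine W.sum_mem fun i _ ↦ ?_
      rw [mul_left_comm, ← Algebra.smul_def]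
      exact W.smul_mem _ (hu i i.2)
    · rw [LinearMap.mulLeft_apply, mul_left_comm]
      exact hfW _
  have hup : ∀ x ∈ W, t * x ∈ W := by
    refine hind t fun i hi ↦ ?_
    rw [← pow_succ']
    rcases (Nat.succ_le_of_lt hi).lt_or_eq with h | h
    · exact hlt _ h
    · have : t ^ (i + 1) = f * 1 - evalCoeffs t D b := by
        rw [mul_one, hf, add_sub_cancel_right, ← Nat.succ_eq_add_one, h]
      rw [this]
      exact W.sub_mem (hfW _) (heW _)
  have h1W : (1 : supported K w S) ∈ W := by
    rcases D.eq_zero_or_pos with h | h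
    · have : f = 1 := by
        subst h
        simp [hf, evalCoeffs_apply]
      simpa [this] using hfW 1
    · simpa using hlt 0 h
  have hpow : ∀ k : ℕ, t ^ k ∈ W := by
    intro k
    induction k with
    | zero => simpa using h1W
    | succ k ih => rw [pow_succ']; exact hup _ ih
  have hzpow : ∀ k : ℤ, ∀ hk : k • v ∈ S, ((∀ g ∈ S, 0 ≤ l g) → 0 ≤ k) →
      monoOf w hk (1 : K) ∈ W := by
    intro k hk hk0
    obtain ⟨n, rfl | rfl⟩ := k.eq_nat_or_neg
    · have : monoOf w hk (1 : K) = t ^ n := Subtype.ext (by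
        rw [coe_monoOf, ht, coe_monoOf_pow, natCast_zsmul])
      rw [this]
      exact hpow n
    rcases hbot with hbot | hnv
    · have : monoOf w hk (1 : K) = 1 := Subtype.ext (by
        have : n = 0 := by have := hk0 hbot; omega
        rw [coe_monoOf, this, Nat.cast_zero, neg_zero, zero_smul, mono_zero_one, Subring.coe_one])
      rwa [this]
    have hlv : ¬ ∀ g ∈ S, 0 ≤ l g := fun h ↦ by
      have := h _ hnv
      rw [map_neg] at this
      omega
    replace hb := hb.resolve_left hlv
    set u : supported K w S := monoOf w hnv (1 : K) with hu
    have hut : u * t = 1 := Subtype.ext (by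
      rw [Subring.coe_mul, coe_monoOf, coe_monoOf, mono_mul_mono, neg_add_cancel, one_mul,
        mono_zero_one, Subring.coe_one])
    have hus : ∀ i : ℕ, u * t ^ (i + 1) = t ^ i := fun i ↦ by
      rw [pow_succ', ← mul_assoc, hut, one_mul]
    have huW : ∀ x ∈ W, u * x ∈ W := by
      refine hind u fun i hi ↦ ?_
      rcases i with _ | i
      swap
      · rw [hus]
        exact hpow i
      obtain ⟨b₀, hb₀⟩ := hb hi
      -- In t⁻¹ f every term except b₀ t⁻¹ is a nonnegative power of t times an element of A; as b₀
      -- is a unit, t⁻¹ lies in W.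
      have h1 : algebraMap _ (supported K w S) (b ⟨0, hi⟩) * u =
          f * u - u * t ^ D - ∑ i ∈ Finset.univ.erase (⟨0, hi⟩ : Fin D),
            algebraMap _ (supported K w S) (b i) * (u * t ^ (i : ℕ)) := by
        have h2 := evalCoeffs_apply t b
        rw [← Finset.add_sum_erase _ _ (Finset.mem_univ (⟨0, hi⟩ : Fin D)), pow_zero, mul_one] at h2
        rw [hf, h2, add_mul, add_mul, Finset.sum_mul]
        have : ∀ i, algebraMap _ (supported K w S) (b i) * t ^ (i : ℕ) * u =
          algebraMap _ (supported K w S) (b i) * (u * t ^ (i : ℕ)) := fun i ↦ by ring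
        simp only [this]
        ring
      have h3 : b ⟨0, hi⟩ • u ∈ W := by
        rw [Algebra.smul_def, h1]
        refine W.sub_mem (W.sub_mem (hfW _) ?_) (W.sum_mem fun i hi' ↦ ?_)
        · obtain ⟨D', rfl⟩ := Nat.exists_eq_add_of_lt hi
          rw [zero_add, hus]
          exact hpow _
        · obtain ⟨j, hj⟩ : ∃ j, (i : ℕ) = j + 1 := by
            refine Nat.exists_eq_succ_of_ne_zero fun h ↦ (Finset.mem_erase.mp hi').1 (Fin.ext h)
          rw [hj, hus, ← Algebra.smul_def]
          exact W.smul_mem _ (hpow _)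
      have h4 := W.smul_mem (↑b₀⁻¹ : supported K w (slice S l)) h3
      rwa [smul_smul, ← hb₀, Units.inv_mul, one_smul, ← mul_one u, ← pow_zero t] at h4
    have hupow : ∀ k : ℕ, u ^ k ∈ W := by
      intro k
      induction k with
      | zero => simpa using h1W
      | succ k ih => rw [pow_succ']; exact huW _ ih
    have : monoOf w hk (1 : K) = u ^ n := Subtype.ext (by
      rw [coe_monoOf, hu, coe_monoOf_pow, smul_neg, neg_smul, natCast_zsmul])
    rw [this]
    exact hupow n
  have hmono : ∀ g, ∀ hg : g ∈ S, ∀ c : K, monoOf w hg c ∈ W := by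
    intro g hg c
    obtain ⟨k, hk⟩ := hdec g hg
    have hlg : l g = k * l v := by
      have := (mem_slice.mp hk).2
      rw [map_sub, map_zsmul, sub_eq_zero] at this
      simpa using this
    have hk0 : (∀ g ∈ S, 0 ≤ l g) → 0 ≤ k := fun h ↦ by
      have := h g hg
      rw [hlg] at this
      exact nonneg_of_mul_nonneg_left this hd
    have hkS : k • v ∈ S := by
      rcases le_or_gt 0 k with h | h
      · lift k to ℕ using h
        rw [natCast_zsmul]
        exact S.nsmul_mem hv k
      · obtain ⟨n, rfl⟩ := Int.exists_eq_neg_ofNat h.le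
        have := hbot.resolve_left fun hb ↦ absurd (hk0 hb) (not_le.mpr h)
        rw [neg_smul, natCast_zsmul, ← smul_neg]
        exact S.nsmul_mem this n
    have : monoOf w hg c = (monoOf w hk c : supported K w (slice S l)) • monoOf w hkS (1 : K) :=
      Subtype.ext (by
        rw [Algebra.smul_def, Subring.coe_mul, coe_algebraMap, coe_monoOf, coe_monoOf, coe_monoOf,
          mono_mul_mono, sub_add_cancel, mul_one])
    rw [this]
    exact W.smul_mem _ (hzpow k hkS hk0)
  intro x
  rw [Metric.mem_closure_iff]
  intro ε hε
  obtain ⟨s, hs, hlt⟩ := exists_sum_mono_norm_sub_lt x.2 hε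
  refine ⟨∑ g ∈ s.attach, monoOf w (hs g g.2) (coeff g.1 (x : GaussRing K w)),
    hWrange _ (W.sum_mem fun g _ ↦ hmono _ _ _), ?_⟩
  rw [Subtype.dist_eq, dist_eq_norm, AddSubmonoidClass.coe_finsetSum]
  simp only [coe_monoOf]
  rwa [Finset.sum_attach s fun g ↦ mono w g (coeff g (x : GaussRing K w))]

theorem isUnit_monoOf {g : G} (hg : g ∈ S) (hg' : -g ∈ S) {c : K} (hc : c ≠ 0) :
    IsUnit (monoOf w hg c) :=
  IsUnit.of_mul_eq_one (monoOf w hg' c⁻¹) (Subtype.ext (by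
    rw [Subring.coe_mul, coe_monoOf, coe_monoOf, mono_mul_mono, add_neg_cancel, mul_inv_cancel₀ hc,
      mono_zero_one, Subring.coe_one]))

/-- Weierstrass preparation for series close to a sum of monomials with a unique top term `t ^ D`
and, unless the exponents in `S` are nonnegative, a unique bottom term. -/
theorem exists_isWeierstrassDivisor_of_norm_sub_lt (hd : 0 < l v)
    (hdec : ∀ g ∈ S, ∃ k : ℤ, g - k • v ∈ slice S l) {s : Finset G} {c : G → K}
    (hs : ∀ σ ∈ s, ‖c σ‖ * w σ ≤ w (D • v)) (hsS : ∀ σ ∈ s, σ ∈ S) (hsl : ∀ σ ∈ s, 0 ≤ l σ)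
    (hD : D • v ∈ s) (hcD : c (D • v) = 1) (htop : ∀ σ ∈ s, σ ≠ D • v → l σ < l (D • v))
    (hbot : (∀ g ∈ S, 0 ≤ l g) ∨ -v ∈ S ∧ ∃ σ₁ ∈ s, l σ₁ = 0 ∧ ‖c σ₁‖ * w σ₁ = w (D • v) ∧
      (∀ σ ∈ s, σ ≠ σ₁ → 0 < l σ) ∧ -σ₁ ∈ S) {g : supported K w S}
    (hg : ‖(g : GaussRing K w) - ∑ σ ∈ s, mono w σ (c σ)‖ < w (D • v)) :
    ∃ W : (supported K w (slice S l))[X], IsWeierstrassDivisor (monoOf w hv (1 : K)) W ∧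
      ∃ q, aeval (monoOf w hv (1 : K)) W = g * q := by
  classical
  -- Splitting off multiples of v rewrites the sum of monomials as a polynomial in t over A; the top
  -- condition makes it monic of degree D.
  have hidx : ∀ σ ∈ s, ∃ i : ℕ, σ - i • v ∈ slice S l ∧ l σ = i * l v := by
    intro σ hσ
    obtain ⟨k, hk⟩ := hdec σ (hsS σ hσ)
    have hlσ : l σ = k * l v := by
      have := (mem_slice.mp hk).2
      rw [map_sub, map_zsmul, sub_eq_zero] at this
      simpa using this
    have hk0 : 0 ≤ k := nonneg_of_mul_nonneg_left (hlσ ▸ hsl σ hσ) hd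
    lift k to ℕ using hk0
    exact ⟨k, by rwa [← natCast_zsmul], hlσ⟩
  choose! idx hidxS hidxl using hidx
  have hidxlt : ∀ σ ∈ s.erase (D • v), idx σ < D := by
    intro σ hσ
    obtain ⟨hne, hσ⟩ := Finset.mem_erase.mp hσ
    have h1 := htop σ hσ hne
    rw [hidxl σ hσ, map_nsmul, nsmul_eq_mul] at h1
    exact_mod_cast lt_of_mul_lt_mul_right h1 hd.le
  let a : G → supported K w (slice S l) := fun σ ↦
    if h : σ - idx σ • v ∈ slice S l then monoOf w h (c σ) else 0
  have ha : ∀ σ (hσ : σ ∈ s), algebraMap _ (supported K w S) (a σ) * monoOf w hv (1 : K) ^ idx σ =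
      monoOf w (hsS σ hσ) (c σ) := by
    intro σ hσ
    refine Subtype.ext ?_
    rw [Subring.coe_mul, coe_algebraMap, coe_monoOf_pow, coe_monoOf]
    simp only [a, dif_pos (hidxS σ hσ)]
    rw [coe_monoOf, mono_mul_mono, sub_add_cancel, mul_one]
  let b : Fin D → supported K w (slice S l) := fun i ↦
    ∑ σ ∈ s.erase (D • v), if idx σ = i then a σ else 0
  let f : supported K w S := monoOf w hv (1 : K) ^ D + evalCoeffs (monoOf w hv (1 : K)) D b
  have hf : (f : GaussRing K w) = ∑ σ ∈ s, mono w σ (c σ) := by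
    have h1 : evalCoeffs (monoOf w hv (1 : K)) D b = ∑ σ ∈ s.erase (D • v),
        algebraMap _ (supported K w S) (a σ) * monoOf w hv (1 : K) ^ idx σ := by
      rw [evalCoeffs_apply]
      simp only [b, map_sum, Finset.sum_mul]
      rw [Finset.sum_comm]
      refine Finset.sum_congr rfl fun σ hσ ↦ ?_
      rw [Finset.sum_eq_single ⟨idx σ, hidxlt σ hσ⟩]
      · simp
      · intro i _ hi
        rw [if_neg (fun h ↦ hi (Fin.ext h.symm)), map_zero, zero_mul]
      · simp
    rw [← Finset.add_sum_erase _ _ hD, hcD, Subring.coe_add, coe_monoOf_pow, h1,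
      AddSubmonoidClass.coe_finsetSum]
    congr 1
    refine Finset.sum_congr rfl fun σ hσ ↦ ?_
    rw [ha σ (Finset.mem_of_mem_erase hσ), coe_monoOf]
  have hbu : (∀ g ∈ S, 0 ≤ l g) ∨ ∀ h : 0 < D, IsUnit (b ⟨0, h⟩) := by
    refine hbot.imp id ?_
    rintro ⟨-, σ₁, hσ₁, hl₁, hc₁, hpos, hneg⟩ h
    have hi₁ : idx σ₁ = 0 := by
      have h2 := hidxl σ₁ hσ₁
      rw [hl₁] at h2
      exact_mod_cast (mul_eq_zero.mp h2.symm).resolve_right hd.ne'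
    have hne : σ₁ ≠ D • v := by
      rintro rfl
      rw [map_nsmul, nsmul_eq_mul] at hl₁
      exact (mul_pos (by exact_mod_cast h) hd).ne' hl₁
    have hσS : σ₁ - idx σ₁ • v ∈ slice S l := hidxS σ₁ hσ₁
    -- Only σ₁ has l-value 0, so the constant coefficient is a single monomial, invertible because
    -- -σ₁ lies in S.
    have hb0 : b ⟨0, h⟩ = monoOf w hσS (c σ₁) := by
      simp only [b]
      rw [Finset.sum_eq_single σ₁]
      · rw [if_pos hi₁]
        simp only [a, dif_pos hσS]
      · intro σ hσ hne'
        rw [if_neg fun h0 ↦ ?_]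
        have h3 := hidxl σ (Finset.mem_of_mem_erase hσ)
        rw [h0, Nat.cast_zero, zero_mul] at h3
        exact (hpos σ (Finset.mem_of_mem_erase hσ) hne').ne' h3
      · intro h0
        exact absurd (Finset.mem_erase.mpr ⟨hne, hσ₁⟩) h0
    rw [hb0]
    refine isUnit_monoOf hσS ?_ ?_
    · rw [hi₁, zero_smul, sub_zero]
      exact ⟨hneg, by simpa using hl₁⟩
    · intro h0
      rw [h0, norm_zero, zero_mul] at hc₁
      exact (w.pos _).ne hc₁
  have hDE := divEstimate hv hd hs hD hcD htop (hbot.imp id fun ⟨_, σ₁, h1, h2, h3, h4, _⟩ ↦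
    ⟨σ₁, h1, h2, h3, h4⟩) hf
  refine hDE.exists_isWeierstrassDivisor (w.pos _) b rfl ?_ (exists_norm_le_evalCoeffs hv hd)
    (denseRange_divMap hv hd hdec (hbot.imp id And.left) f b rfl hbu) ?_
  · change ‖((monoOf w hv (1 : K) ^ D : supported K w S) : GaussRing K w)‖ ≤ _
    rw [coe_monoOf_pow, norm_mono, norm_one, one_mul]
  · change ‖(g : GaussRing K w) - (f : GaussRing K w)‖ < _
    rwa [hf]

end Slice

end GaussRing

/-! ### Splitting idempotents with denominators -/

/-- An idempotent which splits after inverting a divisor of the value of a polynomial with division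
splits. -/
theorem exists_split_of_isWeierstrassDivisor {A : Type u} {T : Type*} [CommRing A] [IsDomain A]
    [CommRing T] [Algebra A T] (hA : SplitsIdempotents A) {t : T} {w : A[X]}
    (hw : IsWeierstrassDivisor t w) {f q : T} (hf : aeval t w = f * q) {m k : ℕ}
    {p : Matrix (Fin m) (Fin m) T} (hp : p * p = p) {X : Matrix (Fin m) (Fin k) T}
    {Y : Matrix (Fin k) (Fin m) T} (hpX : p * X = X) (hYX : Y * X = f • 1) (hXY : X * Y = f • p) :
    ∃ (k : ℕ) (X : Matrix (Fin m) (Fin k) T) (Y : Matrix (Fin k) (Fin m) T),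
      Y * X = 1 ∧ X * Y = p := by
  let P := LinearMap.range p.mulVecLin
  have hP : ∀ x ∈ P, p.mulVec x = x := by
    rintro _ ⟨y, rfl⟩
    simp [hp]
  let π : (Fin m → T) →ₗ[T] P := p.mulVecLin.rangeRestrict
  have hπ : π ∘ₗ P.subtype = LinearMap.id := LinearMap.ext fun x ↦ Subtype.ext (hP x x.2)
  have : Module.Finite T P := Module.Finite.range _
  have : Module.Projective T P := Module.Projective.of_split P.subtype π hπ
  -- X and q Y compose to f q = w(t) in both orders: a matrix factorization on the range of p.
  let α : (Fin k → T) →ₗ[T] P := π ∘ₗ X.mulVecLin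
  let β : P →ₗ[T] (Fin k → T) := q • (Y.mulVecLin ∘ₗ P.subtype)
  have hα : ∀ y, (α y : Fin m → T) = X.mulVec y := fun y ↦ by
    change p.mulVec (X.mulVec y) = X.mulVec y
    rw [Matrix.mulVec_mulVec, hpX]
  have hβ : ∀ x, β x = q • Y.mulVec x := fun x ↦ rfl
  have : Module.Free T P := by
    refine free_of_matrix_factorization hA hw α β (fun x ↦ ?_) fun y ↦ ?_
    · apply Subtype.ext
      rw [hα, hβ, Matrix.mulVec_smul, Matrix.mulVec_mulVec, hXY, Matrix.smul_mulVec, hP _ x.2,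
        smul_smul, hf, mul_comm q]
      rfl
    · rw [hβ, hα, Matrix.mulVec_mulVec, hYX, Matrix.smul_mulVec, Matrix.one_mulVec, smul_smul, hf,
        mul_comm q]
  exact exists_split_of_free_range hp

/-- Over a domain an idempotent splits after inverting a nonzero element. -/
theorem exists_split_of_isDomain {T : Type*} [CommRing T] [IsDomain T] {m : ℕ}
    {p : Matrix (Fin m) (Fin m) T} (hp : p * p = p) :
    ∃ f : T, f ≠ 0 ∧ ∃ (k : ℕ) (X : Matrix (Fin m) (Fin k) T) (Y : Matrix (Fin k) (Fin m) T),
      p * X = X ∧ Y * X = f • 1 ∧ X * Y = f • p := by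
  classical
  let F := FractionRing T
  obtain ⟨k, X, Y, hYX, hXY⟩ := splitsIdempotents_of_field F m (p.map (algebraMap T F)) (by
    rw [← Matrix.map_mul, hp])
  obtain ⟨c, hc⟩ := IsLocalization.exist_integer_multiples_of_finite (nonZeroDivisors T)
    (Sum.elim (fun ij : Fin m × Fin k ↦ X ij.1 ij.2) fun ij : Fin k × Fin m ↦ Y ij.1 ij.2)
  choose x hx using fun ij ↦ hc (Sum.inl ij)
  choose y hy using fun ij ↦ hc (Sum.inr ij)
  let X' : Matrix (Fin m) (Fin k) T := Matrix.of fun i j ↦ x (i, j)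
  let Y' : Matrix (Fin k) (Fin m) T := Matrix.of fun i j ↦ y (i, j)
  have hX' : X'.map (algebraMap T F) = algebraMap T F c • X := by
    ext i j
    simpa [X', Algebra.smul_def] using hx (i, j)
  have hY' : Y'.map (algebraMap T F) = algebraMap T F c • Y := by
    ext i j
    simpa [Y', Algebra.smul_def] using hy (i, j)
  have hinj : ∀ {a b : ℕ} (A B : Matrix (Fin a) (Fin b) T),
      A.map (algebraMap T F) = B.map (algebraMap T F) → A = B := fun A B h ↦
    Matrix.map_injective (IsFractionRing.injective T F) h
  refine ⟨c * c, mul_ne_zero (nonZeroDivisors.ne_zero c.2) (nonZeroDivisors.ne_zero c.2), k, X', Y',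
    hinj _ _ ?_, hinj _ _ ?_, hinj _ _ ?_⟩
  · rw [Matrix.map_mul, hX', ← hXY, Matrix.mul_smul, Matrix.mul_assoc, hYX, Matrix.mul_one]
  · rw [Matrix.map_mul, hX', hY', Matrix.mul_smul, Matrix.smul_mul, hYX, smul_smul,
      Matrix.map_smul' _ _ _ (by simp), Matrix.map_one _ (map_zero _) (map_one _), map_mul]
  · rw [Matrix.map_mul, hX', hY', Matrix.mul_smul, Matrix.smul_mul, hXY, smul_smul,
      Matrix.map_smul' _ _ _ (by simp), map_mul]

/-! ### The Laurent case: induction on the rank of the exponent group -/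

namespace GaussRing

variable {K : Type*} [NormedField K] [IsUltrametricDist K] [CompleteSpace K] {G : Type*}
  [AddCommGroup G] {w : AddWeight G}

/-- With 0 as the only exponent, the ring is the field K. -/
theorem splitsIdempotents_supported_bot :
    SplitsIdempotents (supported K w (⊥ : AddSubmonoid G)) := by
  classical
  let φ : K →+* supported K w (⊥ : AddSubmonoid G) :=
    { toFun c := monoOf w (AddSubmonoid.zero_mem _) c
      map_one' := rfl
      map_mul' c d := Subtype.ext (by
        rw [Subring.coe_mul, coe_monoOf, coe_monoOf, coe_monoOf, mono_mul_mono, add_zero])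
      map_zero' := Subtype.ext (mono_zero _)
      map_add' c d := Subtype.ext (mono_add _ _ _) }
  refine (splitsIdempotents_of_field K).of_ringEquiv (RingEquiv.ofBijective φ ⟨φ.injective,
    fun x ↦ ⟨coeff 0 (x : GaussRing K w), Subtype.ext (ext fun g ↦ ?_)⟩⟩)
  change coeff g (mono w 0 (coeff 0 (x : GaussRing K w))) = _
  rw [coeff_mono]
  split_ifs with hg
  · rw [hg]
  · exact (x.2 g fun h ↦ hg (AddSubmonoid.mem_bot.mp h).symm).symm

/-- A nonzero element supported on a subgroup becomes, after multiplication by an invertible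
monomial, close to a sum of monomials with unique top and bottom terms. -/
theorem exists_isWeierstrassDivisor_of_ne_zero {L : AddSubgroup G} {l : G →+ ℤ} {v : G}
    (hv : v ∈ L.toAddSubmonoid) (hd : 0 < l v) (hdvd : ∀ g ∈ L, l v ∣ l g)
    {f : supported K w L.toAddSubmonoid} (hf : f ≠ 0)
    (hl : Set.InjOn l (maxSet (f : GaussRing K w))) :
    ∃ W : (supported K w (slice L.toAddSubmonoid l))[X],
      IsWeierstrassDivisor (monoOf w hv (1 : K)) W ∧
        ∃ q, aeval (monoOf w hv (1 : K)) W = f * q := by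
  classical
  have hf' : (f : GaussRing K w) ≠ 0 := fun h ↦ hf (Subtype.ext h)
  have hfin := finite_maxSet hf'
  have hmS : ∀ g ∈ maxSet (f : GaussRing K w), g ∈ L := fun g hg ↦ by
    by_contra h
    exact coeff_ne_zero_of_mem_maxSet hf' hg (f.2 g h)
  obtain ⟨τ, hτ, hτmax⟩ := Set.exists_max_image _ l hfin (maxSet_nonempty hf')
  obtain ⟨β, hβ, hβmin⟩ := Set.exists_min_image _ l hfin (maxSet_nonempty hf')
  obtain ⟨D, hD⟩ : ∃ D : ℕ, l τ - l β = D * l v := by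
    obtain ⟨k, hk⟩ := hdvd _ (L.sub_mem (hmS τ hτ) (hmS β hβ))
    rw [map_sub, mul_comm] at hk
    have hk0 : 0 ≤ k := by
      refine nonneg_of_mul_nonneg_left (b := l v) ?_ hd
      have := hβmin τ hτ
      rw [← hk]
      omega
    lift k to ℕ using hk0
    exact ⟨k, hk⟩
  set c₀ := coeff τ (f : GaussRing K w) with hc₀
  have hc₀0 : c₀ ≠ 0 := coeff_ne_zero_of_mem_maxSet hf' hτ
  -- Multiplication by the unit monomial with coefficient c₀⁻¹ and exponent δ moves the top exponent
  -- τ to D • v with coefficient 1, and the bottom exponent β to l-value 0.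
  set δ := D • v - τ with hδ
  have hδL : δ ∈ L := L.sub_mem (L.nsmul_mem hv D) (hmS τ hτ)
  let s : Finset G := hfin.toFinset.map (addRightEmbedding δ)
  let c : G → K := fun σ ↦ c₀⁻¹ * coeff (σ - δ) (f : GaussRing K w)
  have hs' : ∀ σ ∈ s, σ - δ ∈ maxSet (f : GaussRing K w) := by
    intro σ hσ
    obtain ⟨g, hg, rfl⟩ := Finset.mem_map.mp hσ
    simpa using hg
  have hs_mem : ∀ g ∈ maxSet (f : GaussRing K w), g + δ ∈ s := fun g hg ↦
    Finset.mem_map.mpr ⟨g, by simpa using hg, rfl⟩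
  have hτδ : τ + δ = D • v := by rw [hδ]; abel
  have hu : ‖c₀⁻¹‖ * w δ * ‖(f : GaussRing K w)‖ = w (D • v) := by
    have h1 : ‖c₀‖ * w τ = ‖(f : GaussRing K w)‖ := hτ
    have h2 := norm_ne_zero_iff.mpr hc₀0
    rw [← h1, ← hτδ, w.map_add, norm_inv]
    field_simp
  have hsn : ∀ σ ∈ s, ‖c σ‖ * w σ = w (D • v) := by
    intro σ hσ
    have h1 : ‖coeff (σ - δ) (f : GaussRing K w)‖ * w (σ - δ) = ‖(f : GaussRing K w)‖ := hs' σ hσ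
    have h2 : w σ = w δ * w (σ - δ) := by rw [← w.map_add, add_sub_cancel]
    rw [← hu, ← h1, h2, norm_mul]
    ring
  have hlδ : l δ = - l β := by
    rw [hδ, map_sub, map_nsmul, nsmul_eq_mul, ← hD]; ring
  have hsub : ∀ σ, l (σ - δ) = l σ + l β := fun σ ↦ by rw [map_sub, hlδ]; ring
  obtain ⟨W, hW, q, hq⟩ := exists_isWeierstrassDivisor_of_norm_sub_lt hv hd
    (s := s) (c := c) (g := monoOf w hδL c₀⁻¹ * f) (D := D)
    (fun g hg ↦ by
      obtain ⟨k, hk⟩ := hdvd g hg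
      refine ⟨k, L.sub_mem hg (L.zsmul_mem hv k), ?_⟩
      change l _ = 0
      rw [map_sub, map_zsmul, hk, smul_eq_mul, mul_comm, sub_self])
    (fun σ hσ ↦ (hsn σ hσ).le)
    (fun σ hσ ↦ by
      have := L.add_mem (hmS _ (hs' σ hσ)) hδL
      rwa [sub_add_cancel] at this)
    (fun σ hσ ↦ by
      have h1 := hβmin _ (hs' σ hσ)
      rw [hsub] at h1
      omega)
    (hτδ ▸ hs_mem τ hτ)
    (by
      simp only [c]
      rw [← hτδ, add_sub_cancel_right, inv_mul_cancel₀ hc₀0])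
    (fun σ hσ hne ↦ by
      refine lt_of_le_of_ne ?_ fun h ↦ hne ?_
      · have h1 := hτmax _ (hs' σ hσ)
        rw [hsub] at h1
        rw [map_nsmul, nsmul_eq_mul, ← hD]
        omega
      · rw [← hτδ, ← sub_eq_iff_eq_add]
        refine hl (hs' σ hσ) hτ ?_
        rw [hsub, h, map_nsmul, nsmul_eq_mul, ← hD]
        ring)
    (Or.inr ⟨L.neg_mem hv, β + δ, hs_mem β hβ, by rw [map_add, hlδ, add_neg_cancel],
      hsn _ (hs_mem β hβ), fun σ hσ hne ↦ by
        have h1 := hβmin _ (hs' σ hσ)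
        rw [hsub] at h1
        refine lt_of_le_of_ne (by omega) fun h ↦ hne ?_
        rw [← sub_eq_iff_eq_add]
        refine hl (hs' σ hσ) hβ ?_
        rw [hsub, ← h, zero_add],
      L.neg_mem (L.add_mem (hmS β hβ) hδL)⟩)
    (by
      have h1 : ∑ σ ∈ s, mono w σ (c σ) = mono w δ c₀⁻¹ * maxPart hf' := by
        simp only [s, Finset.sum_map, addRightEmbedding_apply, c, add_sub_cancel_right, maxPart,
          Finset.mul_sum, mono_mul_mono, add_comm δ]
      rw [h1, Subring.coe_mul, coe_monoOf, ← mul_sub]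
      refine (norm_mul_le _ _).trans_lt ?_
      rw [norm_mono, ← hu]
      exact mul_lt_mul_of_pos_left (norm_sub_maxPart_lt hf')
        (mul_pos (norm_pos_iff.mpr (inv_ne_zero hc₀0)) (w.pos _)))
  exact ⟨W, hW, monoOf w hδL c₀⁻¹ * q, by rw [hq]; ring⟩

/-- l v is the positive generator of l(L), so every element of L is a multiple of v plus an element
of L ∩ ker l. -/
theorem exists_pos_dvd {L : AddSubgroup G} {l : G →+ ℤ} (h : ∃ g ∈ L, l g ≠ 0) :
    ∃ v ∈ L, 0 < l v ∧ ∀ g ∈ L, l v ∣ l g := by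
  obtain ⟨a, ha⟩ := Int.subgroup_cyclic (L.map l)
  have hmem : ∀ x, x ∈ L.map l ↔ a ∣ x := fun x ↦ by
    rw [ha, AddSubgroup.mem_closure_singleton]
    exact ⟨fun ⟨k, hk⟩ ↦ ⟨k, by rw [← hk, smul_eq_mul, mul_comm]⟩,
      fun ⟨k, hk⟩ ↦ ⟨k, by rw [hk, smul_eq_mul, mul_comm]⟩⟩
  obtain ⟨v, hv, hva⟩ := (hmem |a|).mpr (self_dvd_abs a)
  have hva : l v = |a| := hva
  refine ⟨v, hv, ?_, fun g hg ↦ ?_⟩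
  · rw [hva, abs_pos]
    rintro rfl
    obtain ⟨g, hg, hg0⟩ := h
    exact hg0 (zero_dvd_iff.mp ((hmem _).mp ⟨g, hg, rfl⟩))
  · rw [hva, abs_dvd]
    exact (hmem _).mp ⟨g, hg, rfl⟩

theorem finrank_inf_ker_lt [Module.Free ℤ G] [Module.Finite ℤ G] {L : AddSubgroup G} {l : G →+ ℤ}
    (h : ∃ g ∈ L, l g ≠ 0) :
    Module.finrank ℤ (L ⊓ l.ker : AddSubgroup G) < Module.finrank ℤ L := by
  let φ : L →ₗ[ℤ] ℤ := (l.comp L.subtype).toIntLinearMap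
  have : Module.Finite ℤ L :=
    Module.Finite.of_injective L.subtype.toIntLinearMap Subtype.val_injective
  have h1 := Submodule.finrank_quotient_add_finrank (LinearMap.ker φ)
  rw [φ.quotKerEquivRange.finrank_eq] at h1
  have h2 : 0 < Module.finrank ℤ (LinearMap.range φ) := by
    have : Nontrivial (LinearMap.range φ) := by
      obtain ⟨g, hg, hg0⟩ := h
      exact ⟨⟨⟨_, ⟨⟨g, hg⟩, rfl⟩⟩, 0, fun h ↦ hg0 (congrArg Subtype.val h)⟩⟩
    exact Module.finrank_pos
  have h3 : Module.finrank ℤ (L ⊓ l.ker : AddSubgroup G) = Module.finrank ℤ (LinearMap.ker φ) := by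
    refine LinearEquiv.finrank_eq (AddEquiv.toIntLinearEquiv
      { toFun x := ⟨⟨x.1, x.2.1⟩, x.2.2⟩
        invFun x := ⟨x.1.1, x.1.2, x.2⟩
        left_inv _ := rfl
        right_inv _ := rfl
        map_add' _ _ := rfl })
  omega

/-- Finite projective modules over rings of Laurent series are free. -/
theorem splitsIdempotents_supported_addSubgroup [Module.Free ℤ G] [Module.Finite ℤ G]
    (hG : SeparatesFinite G) (L : AddSubgroup G) :
    SplitsIdempotents (supported K w L.toAddSubmonoid) := by
  have := isDomain (K := K) (w := w) hG
  induction hr : Module.finrank ℤ L using Nat.strong_induction_on generalizing L with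
  | _ r ih =>
  rcases eq_or_ne L ⊥ with rfl | hL
  · exact splitsIdempotents_supported_bot
  obtain ⟨g, hg, hg0⟩ := L.bot_or_exists_ne_zero.resolve_left hL
  intro m p hp
  obtain ⟨f, hf, k, X, Y, hpX, hYX, hXY⟩ := exists_split_of_isDomain hp
  have hf' : (f : GaussRing K w) ≠ 0 := fun h ↦ hf (Subtype.ext h)
  -- Separating 0 from g as well makes l nonzero on L, so that L ∩ ker l has smaller rank.
  obtain ⟨l, hl⟩ := hG (maxSet (f : GaussRing K w) ∪ {0, g})
    ((finite_maxSet hf').union (by simp))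
  have hlg : ∃ g ∈ L, l g ≠ 0 := ⟨g, hg, fun h ↦ hg0 (hl (by simp) (by simp) (by simpa using h))⟩
  obtain ⟨v, hv, hd, hdvd⟩ := exists_pos_dvd hlg
  obtain ⟨W, hW, q, hq⟩ := exists_isWeierstrassDivisor_of_ne_zero hv hd hdvd hf
    (hl.mono Set.subset_union_left)
  have hA : SplitsIdempotents (supported K w (slice L.toAddSubmonoid l)) :=
    ih _ (hr ▸ finrank_inf_ker_lt hlg) (L ⊓ l.ker) rfl
  exact exists_split_of_isWeierstrassDivisor hA hW hq hp hpX hYX hXY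

end GaussRing

/-! ### From inverted variables to nonnegative exponents -/

namespace GaussRing

variable {K : Type*} [NormedField K] [IsUltrametricDist K] [CompleteSpace K] {G : Type*}
  [AddCommGroup G] {w : AddWeight G}

section Localization

variable {S S' : AddSubmonoid G} {v : G}

/-- If `S'` is obtained from `S` by making `v` invertible, series supported on `S'` are
approximated by fractions of series supported on `S` with denominators powers of the monomial of
exponent `v`. -/
theorem eventually_exists_norm_sub_lt (h : S ≤ S') (hv : v ∈ S) (hv' : -v ∈ S')
    (hloc : ∀ g ∈ S', ∃ k : ℕ, g + k • v ∈ S) (y : supported K w S') {ε : ℝ} (hε : 0 < ε) :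
    ∀ᶠ N : ℕ in atTop, ∃ x : supported K w S,
      ‖y - monoOf w hv' (1 : K) ^ N * Subring.inclusion (supported_mono h) x‖ < ε := by
  obtain ⟨s, hs, hlt⟩ := exists_sum_mono_norm_sub_lt y.2 hε
  have hev : ∀ᶠ N : ℕ in atTop, ∀ g ∈ s, g + N • v ∈ S := by
    rw [Filter.eventually_all_finset]
    intro g hg
    obtain ⟨k, hk⟩ := hloc g (hs g hg)
    filter_upwards [eventually_ge_atTop k] with N hN
    obtain ⟨j, rfl⟩ := Nat.exists_eq_add_of_le hN
    rw [add_smul, ← add_assoc]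
    exact S.add_mem hk (S.nsmul_mem hv j)
  filter_upwards [hev] with N hN
  refine ⟨⟨∑ g ∈ s, mono w (g + N • v) (coeff g (y : GaussRing K w)),
    Subring.sum_mem _ fun g hg ↦ mono_mem_supported (hN g hg) _⟩, ?_⟩
  change ‖(y : GaussRing K w) - _‖ < ε
  convert hlt using 3
  rw [Subring.coe_mul, coe_monoOf_pow, Subring.coe_inclusion, Finset.mul_sum]
  refine Finset.sum_congr rfl fun g _ ↦ ?_
  rw [mono_mul_mono, one_mul, smul_neg, neg_add_cancel_comm_assoc]

open Matrix in
/-- If finite projective modules are free over the ring where the monomial of exponent `v` is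
inverted and over the ring where it is set to zero, then they are free. -/
theorem splitsIdempotents_of_slice_of_localization {l : G →+ ℤ} [IsDomain (GaussRing K w)]
    (h : S ≤ S') (hv : v ∈ S) (hd : 0 < l v) (hpos : ∀ g ∈ S, 0 ≤ l g)
    (hdec : ∀ g ∈ S, ∃ k : ℤ, g - k • v ∈ slice S l) (hv' : -v ∈ S')
    (hloc : ∀ g ∈ S', ∃ k : ℕ, g + k • v ∈ S)
    (hA : SplitsIdempotents (supported K w (slice S l)))
    (hT : SplitsIdempotents (supported K w S')) : SplitsIdempotents (supported K w S) := by
  intro m p hp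
  let ι := Subring.inclusion (supported_mono (K := K) (w := w) h)
  have hι : Function.Injective ι := Subring.inclusion_injective _
  obtain ⟨k, X, Y, hYX, hXY⟩ := hT m (p.map ι) (by rw [← Matrix.map_mul, hp])
  set p' := p.map ι with hp'
  -- The determinant is 1 at the splitting and depends continuously on it, so it stays near 1 when X
  -- and Y are approximated by matrices over the smaller ring divided by a power of t.
  let F : (Fin m → Fin k → supported K w S') × (Fin k → Fin m → supported K w S') →
    supported K w S' := fun z ↦ (of z.2 * p' * of z.1).det
  have hF : Continuous F := by
    refine Continuous.matrix_det ?_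
    exact (Continuous.matrix_mul (continuous_snd) continuous_const).matrix_mul continuous_fst
  have hF1 : F (X, Y) = 1 := by
    change (Y * p' * X).det = 1
    rw [← hXY, ← Matrix.mul_assoc, hYX, Matrix.one_mul, hYX, det_one]
  obtain ⟨δ, hδ, hFδ⟩ := Metric.continuous_iff.mp hF (X, Y) 1 one_pos
  have hX := fun i j ↦ eventually_exists_norm_sub_lt h hv hv' hloc (X i j) hδ
  have hY := fun i j ↦ eventually_exists_norm_sub_lt h hv hv' hloc (Y i j) hδ
  simp only [← eventually_all] at hX hY
  obtain ⟨N, hXN, hYN⟩ := (hX.and hY).exists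
  choose X₁ hX₁ using hXN
  choose Y₁ hY₁ using hYN
  set u : supported K w S' := monoOf w hv' (1 : K) ^ N with hu
  let X₂ : Matrix (Fin m) (Fin k) (supported K w S) := of X₁
  let Y₂ : Matrix (Fin k) (Fin m) (supported K w S) := of Y₁
  have hclose := hFδ (fun i j ↦ u * ι (X₁ i j), fun i j ↦ u * ι (Y₁ i j)) (by
    rw [dist_comm, Prod.dist_eq]
    refine max_lt ?_ ?_
    · refine (dist_pi_lt_iff hδ).mpr fun i ↦ (dist_pi_lt_iff hδ).mpr fun j ↦ ?_
      rw [dist_eq_norm]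
      exact hX₁ i j
    · refine (dist_pi_lt_iff hδ).mpr fun i ↦ (dist_pi_lt_iff hδ).mpr fun j ↦ ?_
      rw [dist_eq_norm]
      exact hY₁ i j)
  let f := (Y₂ * p * X₂).det
  have hιf : ι f = (Y₂.map ι * p' * X₂.map ι).det := by
    rw [RingHom.map_det, RingHom.mapMatrix_apply, Matrix.map_mul, Matrix.map_mul]
  have hFf : F (fun i j ↦ u * ι (X₁ i j), fun i j ↦ u * ι (Y₁ i j)) = u ^ (2 * k) * ι f := by
    have h1 : (of fun i j ↦ u * ι (X₁ i j)) = u • X₂.map ι := rfl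
    have h2 : (of fun i j ↦ u * ι (Y₁ i j)) = u • Y₂.map ι := rfl
    simp only [F]
    rw [h1, h2, Matrix.smul_mul, Matrix.smul_mul, Matrix.mul_smul, smul_smul, det_smul, hιf,
      Fintype.card_fin, ← pow_two, pow_mul]
  rw [hF1, hFf, dist_eq_norm] at hclose
  set D := N * (2 * k) with hD
  -- Each of the two k × k scalings contributes uᵏ with u = t⁻ᴺ; clearing them shows that f is
  -- dominated by the single monomial t ^ D, D = 2 k N.
  have hfD : ‖(f : GaussRing K w) - mono w (D • v) 1‖ < w (D • v) := by
    have h1 : (f : GaussRing K w) - mono w (D • v) 1 =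
        mono w (D • v) 1 * ((u ^ (2 * k) * ι f - 1 : supported K w S') : GaussRing K w) := by
      have h2 : ((u ^ (2 * k) : supported K w S') : GaussRing K w) = mono w (-(D • v)) 1 := by
        rw [hu, ← pow_mul, coe_monoOf_pow, smul_neg]
      rw [AddSubgroupClass.coe_sub, Subring.coe_mul, h2, mul_sub, ← mul_assoc, mono_mul_mono, add_neg_cancel,
        one_mul, mono_zero_one, one_mul, Subring.coe_one, mul_one]
      rfl
    rw [h1]
    refine (norm_mul_le _ _).trans_lt ?_
    rw [norm_mono, norm_one, one_mul]
    exact mul_lt_of_lt_one_right (w.pos _) hclose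
  obtain ⟨W, hW, q, hq⟩ := exists_isWeierstrassDivisor_of_norm_sub_lt hv hd hdec (D := D)
    (s := {D • v}) (c := fun _ ↦ 1) (g := f) (by simp) (by simpa using S.nsmul_mem hv D)
    (by simpa using hpos _ (S.nsmul_mem hv D)) (by simp) rfl (by simp) (Or.inl hpos)
    (by simpa using hfD)
  -- The adjugate inverts Y₂ p X₂ up to its determinant f. The identity for the other product is
  -- checked over the larger ring, where p = X Y factors Y₂ p X₂ into the square matrices Y₂ X and Y
  -- X₂.
  refine exists_split_of_isWeierstrassDivisor hA hW hq hp (X := p * X₂)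
    (Y := (Y₂ * p * X₂).adjugate * (Y₂ * p)) ?_ ?_ ?_
  · rw [← Matrix.mul_assoc, hp]
  · have h1 : Y₂ * p * (p * X₂) = Y₂ * p * X₂ := by
      rw [← Matrix.mul_assoc, Matrix.mul_assoc Y₂, hp]
    rw [Matrix.mul_assoc, h1, adjugate_mul]
  · refine Matrix.map_injective hι ?_
    have h1 : (Y₂ * p * X₂).adjugate.map ι = (Y₂.map ι * p' * X₂.map ι).adjugate := by
      have := RingHom.map_adjugate ι (Y₂ * p * X₂)
      rw [RingHom.mapMatrix_apply, RingHom.mapMatrix_apply] at this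
      rw [this, Matrix.map_mul, Matrix.map_mul]
    have h2 : Y₂.map ι * p' * X₂.map ι = (Y₂.map ι * X) * (Y * X₂.map ι) := by
      rw [← hXY]
      simp only [Matrix.mul_assoc]
    change Matrix.map _ ι = Matrix.map _ ι
    rw [Matrix.map_mul, Matrix.map_mul, Matrix.map_mul, Matrix.map_mul, h1,
      Matrix.map_smul' _ _ _ (by simp), hιf, h2, adjugate_mul_distrib, det_mul, ← hp']
    set V := Y₂.map ι * X
    set U := Y * X₂.map ι
    calc p' * X₂.map ι * (U.adjugate * V.adjugate * (Y₂.map ι * p'))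
        = X * (U * U.adjugate) * (V.adjugate * V) * Y := by
          simp only [← hXY, U, V, Matrix.mul_assoc]
      _ = (V.det * U.det) • p' := by
          rw [mul_adjugate, adjugate_mul, Matrix.mul_smul, Matrix.mul_smul, Matrix.mul_one,
            Matrix.mul_one, Matrix.smul_mul, Matrix.smul_mul, smul_smul, hXY]

end Localization

/-- Exponents vanishing on `Z` and nonnegative on `N`. -/
def orthant {n : ℕ} (Z N : Finset (Fin n)) : AddSubmonoid (Fin n → ℤ) where
  carrier := {g | (∀ i ∈ Z, g i = 0) ∧ ∀ i ∈ N, 0 ≤ g i}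
  zero_mem' := by simp
  add_mem' {a b} ha hb := ⟨fun i hi ↦ by simp [ha.1 i hi, hb.1 i hi],
    fun i hi ↦ add_nonneg (ha.2 i hi) (hb.2 i hi)⟩

theorem mem_orthant {n : ℕ} {Z N : Finset (Fin n)} {g : Fin n → ℤ} :
    g ∈ orthant Z N ↔ (∀ i ∈ Z, g i = 0) ∧ ∀ i ∈ N, 0 ≤ g i := Iff.rfl

/-- Induction on N for all Z at once: setting the i-th variable to zero moves i from N to Z,
inverting it removes i from N. For N empty the exponents form a group, which is the Laurent case. -/
theorem splitsIdempotents_supported_orthant {n : ℕ} (w : AddWeight (Fin n → ℤ))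
    (Z N : Finset (Fin n)) : SplitsIdempotents (supported K w (orthant Z N)) := by
  classical
  have := isDomain (K := K) (w := w) (separatesFinite_pi n)
  induction N using Finset.induction_on generalizing Z with
  | empty =>
    have hneg : ∀ {g}, g ∈ orthant Z ∅ → -g ∈ orthant Z ∅ := fun hg ↦
      ⟨fun i hi ↦ neg_eq_zero.mpr (hg.1 i hi), by simp⟩
    let L : AddSubgroup (Fin n → ℤ) := { orthant Z ∅ with neg_mem' := hneg }
    exact splitsIdempotents_supported_addSubgroup (separatesFinite_pi n) L
  | insert i N hi ih =>
    by_cases hiZ : i ∈ Z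
    · have : orthant Z (insert i N) = orthant Z N := by
        ext g
        simp only [mem_orthant, Finset.forall_mem_insert]
        exact and_congr_right fun h ↦ by simp [h i hiZ]
      rw [this]
      exact ih Z
    have hslice : slice (orthant Z (insert i N)) (Pi.evalAddMonoidHom (fun _ ↦ ℤ) i) =
        orthant (insert i Z) N := by
      ext g
      simp only [mem_slice, mem_orthant, Finset.forall_mem_insert, Pi.evalAddMonoidHom_apply]
      constructor
      · rintro ⟨⟨h1, -, h2⟩, h3⟩
        exact ⟨⟨h3, h1⟩, h2⟩
      · rintro ⟨⟨h3, h1⟩, h2⟩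
        exact ⟨⟨h1, h3.ge, h2⟩, h3⟩
    refine splitsIdempotents_of_slice_of_localization (S' := orthant Z N) (v := Pi.single i 1)
      (l := Pi.evalAddMonoidHom (fun _ ↦ ℤ) i) ?_ ?_ (by simp) ?_ ?_ ?_ ?_ (hslice ▸ ih _) (ih Z)
    · exact fun g hg ↦ ⟨hg.1, fun j hj ↦ hg.2 j (Finset.mem_insert_of_mem hj)⟩
    · refine ⟨fun j hj ↦ Pi.single_eq_of_ne (show j ≠ i from fun h ↦ hiZ (h ▸ hj)) _, fun j _ ↦ ?_⟩
      exact (Pi.single_nonneg.mpr zero_le_one : (0 : Fin n → ℤ) ≤ Pi.single i 1) j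
    · exact fun g hg ↦ hg.2 i (Finset.mem_insert_self i N)
    · intro g hg
      have hj : ∀ j, j ≠ i → (g - g i • (Pi.single i 1 : Fin n → ℤ)) j = g j := fun j hj ↦ by
        simp [hj]
      have hi0 : (g - g i • (Pi.single i 1 : Fin n → ℤ)) i = 0 := by simp
      refine ⟨g i, ⟨fun j hjZ ↦ ?_, fun j hjN ↦ ?_⟩, hi0⟩
      · rw [hj j fun h ↦ hiZ (h ▸ hjZ)]
        exact hg.1 j hjZ
      · rcases eq_or_ne j i with rfl | hji
        · exact hi0.ge
        · rw [hj j hji]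
          exact hg.2 j hjN
    · refine ⟨fun j hj ↦ ?_, fun j hj ↦ ?_⟩
      · simp [show j ≠ i from fun h ↦ hiZ (h ▸ hj)]
      · simp [show j ≠ i from fun h ↦ hi (h ▸ hj)]
    · intro g hg
      have hj : ∀ (k : ℕ) j, j ≠ i → (g + k • (Pi.single i 1 : Fin n → ℤ)) j = g j :=
        fun k j hj ↦ by simp [hj]
      refine ⟨(g i).natAbs, fun j hjZ ↦ ?_, fun j hjN ↦ ?_⟩
      · rw [hj _ j fun h ↦ hiZ (h ▸ hjZ)]
        exact hg.1 j hjZ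
      · rcases eq_or_ne j i with rfl | hji
        · simpa using neg_le_iff_add_nonneg.mp (neg_abs_le (g j))
        · rw [hj _ j hji]
          exact hg.2 j ((Finset.mem_insert.mp hjN).resolve_left hji)

end GaussRing

/-! ### Comparison with restricted power series -/

namespace GaussRing

variable {K : Type*} [NormedField K] [IsUltrametricDist K] [CompleteSpace K]

/-- The weight on exponents determined by a tuple of radii. -/
noncomputable def radiusWeight {n : ℕ} (ρ : Fin n → ℝ) (hρ : ∀ i, 0 < ρ i) :
    AddWeight (Fin n → ℤ) where
  toFun g := ∏ i, ρ i ^ g i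
  pos g := Finset.prod_pos fun i _ ↦ zpow_pos (hρ i) _
  map_add g h := by
    rw [← Finset.prod_mul_distrib]
    exact Finset.prod_congr rfl fun i _ ↦ zpow_add₀ (hρ i).ne' _ _

/-- Natural exponents as integral exponents. -/
def intExponent {n : ℕ} (m : Fin n →₀ ℕ) : Fin n → ℤ := fun i ↦ m i

section

variable {n : ℕ}

theorem intExponent_injective : Function.Injective (intExponent (n := n)) := fun _ _ h ↦
  Finsupp.ext fun i ↦ Nat.cast_injective (R := ℤ) (congrFun h i)

theorem intExponent_add (a b : Fin n →₀ ℕ) :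
    intExponent (a + b) = intExponent a + intExponent b := by
  ext i
  simp [intExponent]

theorem intExponent_mem_orthant (m : Fin n →₀ ℕ) : intExponent m ∈ orthant ∅ Finset.univ :=
  ⟨by simp, fun i _ ↦ Int.natCast_nonneg _⟩

theorem exists_intExponent_eq {g : Fin n → ℤ} (hg : g ∈ orthant ∅ Finset.univ) :
    ∃ m, intExponent m = g :=
  ⟨Finsupp.equivFunOnFinite.symm fun i ↦ (g i).toNat, funext fun i ↦ by
    simpa [intExponent] using hg.2 i (Finset.mem_univ i)⟩

theorem radiusWeight_intExponent (ρ : Fin n → ℝ) (hρ : ∀ i, 0 < ρ i) (m : Fin n →₀ ℕ) :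
    radiusWeight ρ hρ (intExponent m) = m.prod (ρ · ^ ·) := by
  rw [Finsupp.prod_fintype _ _ fun _ ↦ pow_zero _]
  simp [radiusWeight, intExponent]

variable {ρ : Fin n → ℝ} {hρ : ∀ i, 0 < ρ i}

theorem isRestricted_coeff (x : GaussRing K (radiusWeight ρ hρ)) :
    MvPowerSeries.IsRestricted ρ (fun m ↦ coeff (intExponent m) x : MvPowerSeries (Fin n) K) := by
  -- On n-tuples of natural numbers, the cofinite filter expresses that the total degree tends to
  -- infinity.
  change Tendsto (fun m : Fin n →₀ ℕ ↦ ‖coeff (intExponent m) x‖ * m.prod (ρ · ^ ·)) cofinite (𝓝 0)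
  rw [Metric.tendsto_nhds]
  intro ε hε
  refine ((finite_setOf_le x hε).preimage intExponent_injective.injOn).subset fun m hm ↦ ?_
  by_contra h
  refine hm ?_
  have h1 : ¬ ε ≤ ‖coeff (intExponent m) x‖ * radiusWeight ρ hρ (intExponent m) := h
  rw [radiusWeight_intExponent, not_le] at h1
  change dist (‖coeff (intExponent m) x‖ * _) 0 < ε
  rw [Real.dist_0_eq_abs, abs_of_nonneg]
  · exact h1
  · rw [← radiusWeight_intExponent ρ hρ]
    exact mul_nonneg (norm_nonneg _) (AddWeight.pos _ _).le

theorem coeff_intExponent_mul {x y : GaussRing K (radiusWeight ρ hρ)}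
    (hx : x ∈ supported K (radiusWeight ρ hρ) (orthant ∅ Finset.univ))
    (hy : y ∈ supported K (radiusWeight ρ hρ) (orthant ∅ Finset.univ)) (m : Fin n →₀ ℕ) :
    coeff (intExponent m) (x * y) = ∑ p ∈ Finset.HasAntidiagonal.antidiagonal m,
      coeff (intExponent p.1) x * coeff (intExponent p.2) y := by
  classical
  refine (hasSum_coeff_mul x y (intExponent m)).unique ?_
  have hinj : Set.InjOn (fun p : (Fin n →₀ ℕ) × (Fin n →₀ ℕ) ↦ intExponent p.1)
      (Finset.HasAntidiagonal.antidiagonal m) := by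
    intro p hp q hq hpq
    have h1 : p.1 = q.1 := intExponent_injective hpq
    have h2 := Finset.HasAntidiagonal.mem_antidiagonal.mp hp
    rw [← Finset.HasAntidiagonal.mem_antidiagonal.mp hq, h1] at h2
    exact Prod.ext h1 (add_left_cancel h2)
  have h1 : ∑ p ∈ Finset.HasAntidiagonal.antidiagonal m, coeff (intExponent p.1) x * coeff (intExponent p.2) y =
      ∑ h ∈ (Finset.HasAntidiagonal.antidiagonal m).image fun p ↦ intExponent p.1,
        coeff h x * coeff (intExponent m - h) y := by
    rw [Finset.sum_image hinj]
    refine Finset.sum_congr rfl fun p hp ↦ ?_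
    rw [← Finset.HasAntidiagonal.mem_antidiagonal.mp hp, intExponent_add, add_sub_cancel_left]
  rw [h1]
  refine hasSum_sum_of_ne_finset_zero fun h hh ↦ ?_
  by_contra h0
  obtain ⟨hx0, hy0⟩ := mul_ne_zero_iff.mp h0
  obtain ⟨a, ha⟩ := exists_intExponent_eq (not_not.mp fun h' ↦ hx0 (hx _ h'))
  obtain ⟨b, hb⟩ := exists_intExponent_eq (not_not.mp fun h' ↦ hy0 (hy _ h'))
  refine hh (Finset.mem_image.mpr ⟨(a, b), Finset.HasAntidiagonal.mem_antidiagonal.mpr ?_, ha⟩)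
  apply intExponent_injective
  rw [intExponent_add, ha, hb, add_sub_cancel]

variable (ρ hρ) in
/-- Series supported on the orthant as restricted power series. -/
noncomputable def toRestricted :
    supported K (radiusWeight ρ hρ) (orthant ∅ Finset.univ) →+*
      MvPowerSeries.IsRestricted.subring (R := K) ρ where
  toFun x := ⟨fun m ↦ coeff (intExponent m) (x : GaussRing K (radiusWeight ρ hρ)),
    isRestricted_coeff _⟩
  map_one' := by
    classical
    refine Subtype.ext (MvPowerSeries.ext fun m ↦ ?_)
    change coeff (intExponent m) (1 : GaussRing K (radiusWeight ρ hρ)) =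
      MvPowerSeries.coeff m (1 : MvPowerSeries (Fin n) K)
    rw [MvPowerSeries.coeff_one, ← mono_zero_one, coeff_mono]
    have h0 : intExponent (0 : Fin n →₀ ℕ) = 0 := rfl
    refine if_congr ?_ rfl rfl
    rw [← h0, intExponent_injective.eq_iff, eq_comm]
  map_mul' x y := by
    classical
    refine Subtype.ext (MvPowerSeries.ext fun m ↦ ?_)
    refine (coeff_intExponent_mul x.2 y.2 m).trans ?_
    rw [Subring.coe_mul, MvPowerSeries.coeff_mul]
    rfl
  map_zero' := Subtype.ext (MvPowerSeries.ext fun m ↦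
    map_zero (coeff (K := K) (w := radiusWeight ρ hρ) (intExponent m)))
  map_add' x y := Subtype.ext (MvPowerSeries.ext fun m ↦
    map_add (coeff (intExponent m)) (x : GaussRing K (radiusWeight ρ hρ)) y)

theorem toRestricted_injective : Function.Injective (toRestricted (K := K) ρ hρ) := by
  intro x y hxy
  refine Subtype.ext (ext fun g ↦ ?_)
  by_cases hg : g ∈ orthant ∅ Finset.univ
  · obtain ⟨m, rfl⟩ := exists_intExponent_eq hg
    exact congrArg (fun f ↦ MvPowerSeries.coeff m (Subtype.val f)) hxy
  · rw [x.2 g hg, y.2 g hg]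

/-- In a complete ultrametric group terms tending to zero are summable; continuity of the
coefficient maps identifies the sum of the monomials of f. -/
theorem toRestricted_surjective : Function.Surjective (toRestricted (K := K) ρ hρ) := by
  classical
  intro f
  have hf : Tendsto (fun m : Fin n →₀ ℕ ↦
      ‖MvPowerSeries.coeff m (f : MvPowerSeries (Fin n) K)‖ * m.prod (ρ · ^ ·)) cofinite (𝓝 0) := f.2
  let u : (Fin n →₀ ℕ) → GaussRing K (radiusWeight ρ hρ) := fun m ↦
    mono _ (intExponent m) (MvPowerSeries.coeff m (f : MvPowerSeries (Fin n) K))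
  have hu : Summable u := by
    refine NonarchimedeanAddGroup.summable_of_tendsto_cofinite_zero ?_
    rw [tendsto_zero_iff_norm_tendsto_zero]
    simpa only [u, norm_mono, radiusWeight_intExponent] using hf
  have hcoeff : ∀ g, HasSum (fun m ↦ coeff g (u m)) (coeff g (∑' m, u m)) := fun g ↦
    hu.hasSum.map (coeff g) (continuous_coeff g)
  have hm : ∀ m, coeff (intExponent m) (∑' m, u m) =
      MvPowerSeries.coeff m (f : MvPowerSeries (Fin n) K) := by
    intro m
    refine (hcoeff _).unique ?_
    convert hasSum_ite_eq m (MvPowerSeries.coeff m (f : MvPowerSeries (Fin n) K)) using 2 with j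
    simp only [u, coeff_mono, intExponent_injective.eq_iff]
    split_ifs with h
    · rw [h]
    · rfl
  refine ⟨⟨∑' m, u m, fun g hg ↦ (hcoeff g).unique ?_⟩, Subtype.ext (MvPowerSeries.ext fun m ↦ hm m)⟩
  convert hasSum_zero with m
  simp only [u, coeff_mono]
  rw [if_neg]
  rintro rfl
  exact hg (intExponent_mem_orthant m)

end

end GaussRing

theorem proposition6p7 {K : Type*} [NontriviallyNormedField K] [CompleteSpace K]
    [IsUltrametricDist K] (n : ℕ) (ρ : Fin n → ℝ) (hρ : ∀ i, 0 < ρ i)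
    (hρK : ∀ i, ∃ m : ℕ, 0 < m ∧ ∃ a : K, ρ i ^ m = ‖a‖)
    (M : Type*) [AddCommGroup M] [Module (MvPowerSeries.IsRestricted.subring (R := K) ρ) M]
    [Module.Finite (MvPowerSeries.IsRestricted.subring (R := K) ρ) M]
    [Module.Projective (MvPowerSeries.IsRestricted.subring (R := K) ρ) M] :
    Module.Free (MvPowerSeries.IsRestricted.subring (R := K) ρ) M :=
  ((GaussRing.splitsIdempotents_supported_orthant (GaussRing.radiusWeight ρ hρ) ∅
    Finset.univ).of_ringEquiv (RingEquiv.ofBijective (GaussRing.toRestricted ρ hρ)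
      ⟨GaussRing.toRestricted_injective, GaussRing.toRestricted_surjective⟩)).free M
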